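/- Let $\mathfrak{nil}_n$ be the Lie ring of strictly upper-triangular $n\times n$ integer matrices, with basis the matrix units $e_{ab}$, $1\le a<b\le n$. On $\Lambda^*\mathfrak{nil}_n$ consider the boundary $\partial(x_1\cdots x_r)=\sum_{i<j}(-1)^{i+j}[x_i,x_j]\,x_1\cdots\widehat{x_i}\cdots\widehat{x_j}\cdots x_r$ (wedge signs are omitted). For a set $M$ of pairs $(a,b)$, $1\le a<b\le n$, let $e_M$ be the wedge of the $e_{ab}$, $(a,b)\in M$, in lexicographic order. For $w=(w_1,\dots,w_n)\in\mathbb{Z}^n$ let $\llbracket w\rrbracket$ be the subcomplex spanned by all $e_M$ with $w_i=i-|\{x;(x,i)\in M\}|+|\{y;(i,y)\in M\}|$ for all $i$, and let $\llbracket w\rrbracket_1$ be $\llbracket w\rrbracket$ with degrees raised by $1$. If $w_1=2$, let $F_j^w\le\llbracket w\rrbracket$ be the subcomplex spanned by the generators in which some $e_{1i}$ with $i\ge j$ occurs. A *Morse matching* for $\llbracket w\rrbracket$ is a set $\mathcal M$ of pairwise vertex-disjoint edges, with invertible weights, in the weighted digraph whose vertices are the generators $e_M\in\llbracket w\rrbracket$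 and whose edge weights are the nonzero matrix entries of $\partial$, such that after reversing the edges in $\mathcal M$ (weight $c$ becoming $-c^{-1}$) there are no directed cycles and no infinite directed paths in two adjacent degrees. The set of unmatched (critical) generators is $\mathring{\mathcal M}$, and $\mathring\partial$ is the endomorphism of $\langle\mathring{\mathcal M}\rangle$ sending a critical $v$ to the sum, over critical $v'$ of degree one less, of the total weight of directed paths from $v$ to $v'$ in the reversed digraph, times $v'$. **Lemma 3.5.** Let $2\le k\le n$ and $w=(2,w_2,\dots,w_{k-1},2,w_{k+1},\dots,w_n)$. (1) Let $A=\{e_{\{1,\dots,k-1\}\times\{k\}}e_{ka}e_M\in\llbracket w\rrbracket\}$ and $B=\{e_{1a}e_{\{2,\dots,k-1\}\times\{k\}}e_M\in\llbracket w\rrbracket;\ a>k\}$ (generators being taken up to sign). There exists a Morse matching $\mathcal M$ for $\llbracket w\rrbracket$ such that $\mathring{\mathcal M}=A\cup B$, $\mathring\partial|_B=\partial|_B$, and $\mathring\partial|_A$ sends $$e_{\{1,\dots,k-1\}\times\{k\}}e_{ka}e_M\mapsto(-1)^{k+1}\Big(e_{\{1,\dots,k-1\}\times\{k\}}\,\partial(e_{ka}e_M)+n_M\,e_{1a}e_{\{2,\dots,k-1\}\times\{k\}}e_M+\sum_{(b,c)\in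 X}(-1)^{\epsilon_{bc}}e_{1c}e_{\{2,\dots,k-1\}\times\{k\}}e_{ba}e_{M\setminus\{(b,c)\}}\Big),$$ where $n_M=|\{b\in\{1,\dots,k-1\};(b,a)\notin M\}|$, $\epsilon_{bc}$ is the position of $(b,c)$ in $M$ in lexicographic order (counted from $1$), and $X=\{(b,c)\in M;\ b<k<c,\ (b,a)\notin M\}$. (2) $H_*\llbracket w\rrbracket\cong H_*\operatorname{Cone}\varphi$ for some chain map $\varphi\colon F_{k+1}^w\to F_{k+1}^w$. (3) If $k=n-1$, then $H_*\llbracket 2,w_2,\dots,w_{n-2},2,w_n\rrbracket$ is isomorphic to the homology of the cone of multiplication by $w_n-1$ on $\llbracket w_2-1,\dots,w_{n-2}-1,1,w_n\rrbracket_1$. -/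

import Mathlib

noncomputable section

namespace ChevalleyEilenberg

variable (R L : Type*) [CommRing R] [LieRing L] [LieAlgebra R L]

/-- The action `x ↦ (u ↦ θ x u)` of a Lie algebra on its exterior algebra, written as `u ↦ (x ↦ θ x u)`:
`θ x` is the derivation of the exterior algebra extending `y ↦ ⁅x, y⁆`. It is defined by recursion:
`θ x 1 = 0` and `θ x (m ∧ u) = ⁅x, m⁆ ∧ u + m ∧ θ x u`. -/
def lieAction : ExteriorAlgebra R L →ₗ[R] L →ₗ[R] ExteriorAlgebra R L :=
  CliffordAlgebra.foldr' (0 : QuadraticForm R L)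
    (LinearMap.mk₂ R
      (fun (m : L) (p : ExteriorAlgebra R L × (L →ₗ[R] ExteriorAlgebra R L)) =>
        LinearMap.mulRight R p.1 ∘ₗ ExteriorAlgebra.ι R ∘ₗ
            (LieModule.toEnd R L L : L →ₗ[R] Module.End R L).flip m +
          LinearMap.mulLeft R (ExteriorAlgebra.ι R m) ∘ₗ p.2)
      (by intros; ext; simp [add_mul]; abel)
      (by intros; ext; simp)
      (by intros; ext; simp [mul_add]; abel)
      (by intros; ext; simp))
    (by
      intro m x fx
      ext y
      have h := ExteriorAlgebra.ι_add_mul_swap (R := R) ⁅y, m⁆ m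
      have h2 := ExteriorAlgebra.ι_sq_zero (R := R) m
      simp only [LinearMap.mk₂_apply, LinearMap.add_apply, LinearMap.comp_apply,
        LinearMap.mulRight_apply, LinearMap.mulLeft_apply, LinearMap.flip_apply]
      simp only [zero_apply, zero_smul, LinearMap.zero_apply, mul_add]
      change ExteriorAlgebra.ι R ⁅y, m⁆ * (ExteriorAlgebra.ι R m * x) +
        (ExteriorAlgebra.ι R m * (ExteriorAlgebra.ι R ⁅y, m⁆ * x) +
          ExteriorAlgebra.ι R m * (ExteriorAlgebra.ι R m * fx y)) = 0
      rw [← mul_assoc, ← mul_assoc, ← mul_assoc, h2, zero_mul, add_zero, ← add_mul, h, zero_mul])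
    0

variable {R L}

theorem lieAction_one (x : L) : lieAction R L 1 x = 0 := by
  have h : lieAction R L (algebraMap R _ 1) = (1 : R) • (0 : L →ₗ[R] ExteriorAlgebra R L) :=
    CliffordAlgebra.foldr'_algebraMap _ _ _ _ _
  rw [map_one, smul_zero] at h
  rw [h, LinearMap.zero_apply]

theorem lieAction_ι_mul (x m : L) (u : ExteriorAlgebra R L) :
    lieAction R L (ExteriorAlgebra.ι R m * u) x =
      ExteriorAlgebra.ι R ⁅x, m⁆ * u + ExteriorAlgebra.ι R m * lieAction R L u x := by
  unfold lieAction
  erw [CliffordAlgebra.foldr'_ι_mul]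
  rfl

variable (R L) in
/-- The Chevalley–Eilenberg boundary on the exterior algebra of a Lie algebra, by recursion:
`∂ 1 = 0` and `∂ (m ∧ u) = - θ m u - m ∧ ∂ u`. The closed formula is `boundary_prod`. -/
def boundary : ExteriorAlgebra R L →ₗ[R] ExteriorAlgebra R L :=
  CliffordAlgebra.foldr' (0 : QuadraticForm R L)
    (LinearMap.mk₂ R
      (fun (m : L) (p : ExteriorAlgebra R L × ExteriorAlgebra R L) =>
        -(lieAction R L p.1 m) - ExteriorAlgebra.ι R m * p.2)
      (by intros; simp [add_mul]; abel)
      (by intros; simp [smul_sub])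
      (by intros; simp [mul_add]; abel)
      (by intros; simp [smul_sub]))
    (by
      intro m x fx
      have h2 := ExteriorAlgebra.ι_sq_zero (R := R) m
      simp only [LinearMap.mk₂_apply, zero_apply, zero_smul]
      change -(lieAction R L (ExteriorAlgebra.ι R m * x) m) -
        ExteriorAlgebra.ι R m * (-(lieAction R L x m) - ExteriorAlgebra.ι R m * fx) = 0
      rw [lieAction_ι_mul, lie_self, map_zero, mul_sub, ← mul_assoc, h2]
      simp)
    0

theorem boundary_one : boundary R L 1 = 0 := by
  have h : boundary R L (algebraMap R _ 1) = (1 : R) • (0 : ExteriorAlgebra R L) :=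
    CliffordAlgebra.foldr'_algebraMap _ _ _ _ _
  rw [map_one, smul_zero] at h
  exact h

theorem boundary_ι_mul (m : L) (u : ExteriorAlgebra R L) :
    boundary R L (ExteriorAlgebra.ι R m * u) =
      -(lieAction R L u m) - ExteriorAlgebra.ι R m * boundary R L u := by
  unfold boundary
  erw [CliffordAlgebra.foldr'_ι_mul]
  rfl

theorem lieAction_lie (x y : L) (u : ExteriorAlgebra R L) :
    lieAction R L u ⁅x, y⁆ =
      lieAction R L (lieAction R L u y) x - lieAction R L (lieAction R L u x) y := by
  induction u using CliffordAlgebra.left_induction with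
  | algebraMap r =>
    rw [Algebra.algebraMap_eq_smul_one]
    have := fun x => lieAction_one (R := R) (L := L) x
    simp_rw [map_smul, LinearMap.smul_apply, this, smul_zero, map_zero]
    simp
  | add u v hu hv => simp only [map_add, LinearMap.add_apply, hu, hv]; abel
  | ι_mul u m hu =>
    simp only [lieAction_ι_mul, map_add, LinearMap.add_apply, hu, lie_lie, map_sub, sub_mul, mul_sub]
    abel

theorem boundary_lieAction (x : L) (u : ExteriorAlgebra R L) :
    boundary R L (lieAction R L u x) = lieAction R L (boundary R L u) x := by
  induction u using CliffordAlgebra.left_induction with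
  | algebraMap r =>
    rw [Algebra.algebraMap_eq_smul_one]
    simp_rw [map_smul, LinearMap.smul_apply, lieAction_one, boundary_one]
    simp
  | add u v hu hv => simp only [map_add, LinearMap.add_apply, hu, hv]
  | ι_mul u m hu =>
    simp only [lieAction_ι_mul, boundary_ι_mul, map_add, map_sub, map_neg, LinearMap.sub_apply,
      LinearMap.neg_apply, hu, lieAction_lie]
    abel

theorem boundary_boundary (u : ExteriorAlgebra R L) : boundary R L (boundary R L u) = 0 := by
  induction u using CliffordAlgebra.left_induction with
  | algebraMap r =>
    rw [Algebra.algebraMap_eq_smul_one]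
    simp_rw [map_smul, boundary_one]
    simp
  | add u v hu hv => simp only [map_add, hu, hv, add_zero]
  | ι_mul u m hu =>
    simp only [boundary_ι_mul, boundary_lieAction, map_sub, map_neg, hu, mul_zero]
    abel

theorem lieAction_prod (x : L) (l : List L) :
    lieAction R L (l.map (ExteriorAlgebra.ι R)).prod x =
      ∑ j ∈ Finset.range l.length, (-1 : R) ^ j •
        (ExteriorAlgebra.ι R ⁅x, l.getD j 0⁆ *
          ((l.eraseIdx j).map (ExteriorAlgebra.ι R)).prod) := by
  induction l with
  | nil => simp [lieAction_one]
  | cons y l ih =>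
    rw [List.map_cons, List.prod_cons, lieAction_ι_mul, ih, List.length_cons,
      Finset.sum_range_succ', add_comm, Finset.mul_sum]
    congr 1
    · refine Finset.sum_congr rfl fun j _ => ?_
      have h := ExteriorAlgebra.ι_add_mul_swap (R := R) y ⁅x, l.getD j 0⁆
      rw [mul_smul_comm, ← mul_assoc, eq_neg_of_add_eq_zero_left h]
      simp [pow_succ, mul_assoc]
    · simp

/-- The boundary of a wedge `x₁ ∧ ⋯ ∧ xₖ` is
`∑_{i < j} (-1)^(i+j) ⁅xᵢ, xⱼ⁆ ∧ x₁ ∧ ⋯ x̂ᵢ ⋯ x̂ⱼ ⋯ ∧ xₖ`. -/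
theorem boundary_prod (l : List L) :
    boundary R L (l.map (ExteriorAlgebra.ι R)).prod =
      ∑ i ∈ Finset.range l.length, ∑ j ∈ Finset.range l.length with i < j,
        (-1 : R) ^ (i + j) • (ExteriorAlgebra.ι R ⁅l.getD i 0, l.getD j 0⁆ *
          (((l.eraseIdx j).eraseIdx i).map (ExteriorAlgebra.ι R)).prod) := by
  induction l with
  | nil => simp [boundary_one]
  | cons y l ih =>
    rw [List.map_cons, List.prod_cons, boundary_ι_mul, ih, List.length_cons,
      Finset.sum_range_succ', lieAction_prod, Finset.mul_sum, sub_eq_add_neg, add_comm]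
    congr 1
    · rw [← Finset.sum_neg_distrib]
      refine Finset.sum_congr rfl fun i _ => ?_
      rw [Finset.sum_filter, Finset.sum_filter, Finset.sum_range_succ', Finset.mul_sum,
        ← Finset.sum_neg_distrib]
      simp only [not_lt_zero, if_false, add_zero]
      refine Finset.sum_congr rfl fun j _ => ?_
      by_cases hij : i < j
      · have h := ExteriorAlgebra.ι_add_mul_swap (R := R) y ⁅l.getD i 0, l.getD j 0⁆
        simp only [hij, add_lt_add_iff_right, if_true]
        rw [mul_smul_comm, ← mul_assoc, eq_neg_of_add_eq_zero_left h]
        simp [mul_assoc, show i + 1 + (j + 1) = i + j + 2 by ring, pow_add]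
      · simp [hij]
    · rw [Finset.sum_filter, Finset.sum_range_succ', ← Finset.sum_neg_distrib]
      simp [pow_succ]

end ChevalleyEilenberg

/-! ### Algebraic Morse theory -/

namespace AlgMorse

variable {V R : Type*} [CommRing R]

/- A weighted digraph on `V` is a function `wt : V → V → R`; its edges `u → v` are the pairs with
`wt u v ≠ 0`. The digraph of a complex of free modules with basis indexed by `V` has as weights the
entries of the matrices of the boundary. A matching is given by its set of edges. -/

open Classical in
/-- The weighted digraph obtained by reversing the edges in `𝓜`: an edge of weight `c` in `𝓜` is
replaced by an edge of weight `-c⁻¹` in the opposite direction. -/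
def reversed (wt : V → V → R) (𝓜 : Set (V × V)) (u v : V) : R :=
  if (v, u) ∈ 𝓜 then -Ring.inverse (wt v u) else if (u, v) ∈ 𝓜 then 0 else wt u v

/-- There is an edge `u → v` in the weighted digraph `wt`. -/
def Edge (wt : V → V → R) (u v : V) : Prop := wt u v ≠ 0

/-- `𝓜` is a Morse matching in the weighted digraph `wt`, whose vertices have degrees `deg`. -/
structure IsMorseMatching (deg : V → ℕ) (wt : V → V → R) (𝓜 : Set (V × V)) : Prop where
  edge : ∀ p ∈ 𝓜, Edge wt p.1 p.2
  disjoint : ∀ p ∈ 𝓜, ∀ q ∈ 𝓜, p ≠ q → p.1 ≠ q.1 ∧ p.1 ≠ q.2 ∧ p.2 ≠ q.1 ∧ p.2 ≠ q.2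
  isUnit : ∀ p ∈ 𝓜, IsUnit (wt p.1 p.2)
  acyclic : ∀ v, ¬ Relation.TransGen (Edge (reversed wt 𝓜)) v v
  noInfinitePath : ∀ d : ℕ, ¬ ∃ f : ℕ → V, ∀ i,
    Edge (reversed wt 𝓜) (f i) (f (i + 1)) ∧ (deg (f i) = d ∨ deg (f i) = d + 1)

/-- The critical (unmatched) vertices. -/
def critical (𝓜 : Set (V × V)) : Set V := {v | ∀ p ∈ 𝓜, p.1 ≠ v ∧ p.2 ≠ v}

/-- The directed paths from `u` to `v`: a path `u → x₁ → ⋯ → xₘ = v` is given by the list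
`[x₁, …, xₘ]`. -/
def paths (wt : V → V → R) (u v : V) : Set (List V) :=
  {l | List.IsChain (Edge wt) (u :: l) ∧ (u :: l).getLast (List.cons_ne_nil u l) = v}

/-- The weight of a directed path: the product of the weights of its edges. -/
def pathWeight (wt : V → V → R) : V → List V → R
  | _, [] => 1
  | u, v :: l => wt u v * pathWeight wt v l

/-- The sum of the weights of all directed paths from `u` to `v` after reversing `𝓜`. -/
def morseCoeff (wt : V → V → R) (𝓜 : Set (V × V)) (u v : V) : R :=
  ∑ᶠ l ∈ paths (reversed wt 𝓜) u v, pathWeight (reversed wt 𝓜) u l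

open Classical in
/-- The boundary of the Morse complex, the free module spanned by the critical vertices: the
coefficient of `v` in the boundary of `u` is the sum of the weights of directed paths from `u` to `v`
if `v` has degree one less than `u`. -/
def morseBoundary [Finite V] (deg : V → ℕ) (wt : V → V → R) (𝓜 : Set (V × V)) :
    (critical 𝓜 →₀ R) →ₗ[R] (critical 𝓜 →₀ R) :=
  Finsupp.linearCombination R fun u => Finsupp.equivFunOnFinite.symm fun v =>
    if deg v + 1 = deg u then morseCoeff wt 𝓜 u v else 0

end AlgMorse

/-! ### The Lie ring of strictly upper triangular matrices -/

namespace NilTorsion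

open ChevalleyEilenberg

attribute [local instance] LieRing.ofAssociativeRing

/-- The index set `{1, …, n}` of rows and columns. -/
abbrev Idx (n : ℕ) : Type := {i : ℕ // i ∈ Finset.Icc 1 n}

/-- The Lie ring of strictly upper triangular integral `n × n` matrices. -/
def nil (n : ℕ) : LieSubalgebra ℤ (Matrix (Idx n) (Idx n) ℤ) where
  carrier := {A | ∀ i j, j ≤ i → A i j = 0}
  add_mem' := by
    intro A B hA hB i j h
    simp [hA i j h, hB i j h]
  zero_mem' := by
    intro i j _
    rfl
  smul_mem' := by
    intro c A hA i j h
    simp [hA i j h]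
  lie_mem' := by
    intro A B hA hB i j h
    have key : ∀ C D : Matrix (Idx n) (Idx n) ℤ, (∀ i j, j ≤ i → C i j = 0) →
        (∀ i j, j ≤ i → D i j = 0) → (C * D) i j = 0 := by
      intro C D hC hD
      rw [Matrix.mul_apply]
      refine Finset.sum_eq_zero fun x _ => ?_
      rcases le_total x i with hx | hx
      · rw [hC i x hx, zero_mul]
      · rw [hD x j (h.trans hx), mul_zero]
    rw [Ring.lie_def, Matrix.sub_apply, key A B hA hB, key B A hB hA, sub_zero]

/-- The set of all `(a, b)` with `1 ≤ a < b ≤ n`, ordered lexicographically. -/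
abbrev Pair (n : ℕ) : Type := {p : Idx n ×ₗ Idx n // (ofLex p).1 < (ofLex p).2}

variable {n : ℕ}

/-- The number `a` of the pair `(a, b)`. -/
def Pair.left (p : Pair n) : ℕ := (ofLex p.1).1

/-- The number `b` of the pair `(a, b)`. -/
def Pair.right (p : Pair n) : ℕ := (ofLex p.1).2

theorem Pair.left_pos (p : Pair n) : 1 ≤ p.left := (Finset.mem_Icc.mp (ofLex p.1).1.2).1

theorem Pair.left_lt_right (p : Pair n) : p.left < p.right := p.2

theorem Pair.right_le (p : Pair n) : p.right ≤ n := (Finset.mem_Icc.mp (ofLex p.1).2.2).2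

theorem Pair.ext_iff' {p q : Pair n} : p = q ↔ p.left = q.left ∧ p.right = q.right := by
  constructor
  · rintro rfl
    exact ⟨rfl, rfl⟩
  · rintro ⟨h1, h2⟩
    exact Subtype.ext (ofLex.injective (Prod.ext (Subtype.ext h1) (Subtype.ext h2)))

theorem Pair.exists_mk {a b : ℕ} (h1 : 1 ≤ a) (h2 : a < b) (h3 : b ≤ n) :
    ∃ p : Pair n, p.left = a ∧ p.right = b :=
  ⟨⟨toLex (⟨a, Finset.mem_Icc.mpr ⟨h1, h2.le.trans h3⟩⟩,
    ⟨b, Finset.mem_Icc.mpr ⟨h1.trans h2.le, h3⟩⟩), h2⟩, rfl, rfl⟩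

variable (n) in
/-- The matrix `e_{ab}` with entry `1` in position `(a, b)` and `0` elsewhere, for `1 ≤ a < b ≤ n`
(it is `0` for other `a`, `b`). -/
def matUnit (a b : ℕ) : nil n :=
  ⟨Matrix.of fun i j => if i < j ∧ (i : ℕ) = a ∧ (j : ℕ) = b then 1 else 0, by
    intro i j h
    simp [not_lt.mpr h]⟩

theorem matUnit_apply (a b : ℕ) (i j : Idx n) : (matUnit n a b).1 i j =
    if i < j ∧ (i : ℕ) = a ∧ (j : ℕ) = b then 1 else 0 := rfl

/-- Strictly upper triangular matrices as functions on pairs. -/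
def nilEquiv (n : ℕ) : nil n ≃ₗ[ℤ] (Pair n → ℤ) where
  toFun A p := A.1 (ofLex p.1).1 (ofLex p.1).2
  map_add' _ _ := rfl
  map_smul' _ _ := rfl
  invFun f := ⟨Matrix.of fun i j => if h : i < j then f ⟨toLex (i, j), h⟩ else 0, by
    intro i j h
    simp [not_lt.mpr h]⟩
  left_inv := by
    intro A
    ext i j
    by_cases h : i < j
    · simp [h]
    · simp [h, A.2 i j (not_lt.mp h)]
  right_inv := by
    intro f
    funext p
    simp [p.2]

/-- The basis of matrix units `e_{ab}`, `a < b`. -/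
def nilBasis (n : ℕ) : Module.Basis (Pair n) ℤ (nil n) :=
  Module.Basis.ofEquivFun (nilEquiv n)

theorem nilBasis_apply (p : Pair n) : nilBasis n p = matUnit n p.left p.right := by
  apply (nilEquiv n).injective
  funext q
  have h1 : nilEquiv n (nilBasis n p) q = (Pi.single p 1 : Pair n → ℤ) q := by
    simp [nilBasis, Module.Basis.coe_ofEquivFun]
  rw [h1]
  change _ = (matUnit n p.left p.right).1 _ _
  rw [matUnit_apply, Pi.single_apply]
  refine if_congr ?_ rfl rfl
  rw [Pair.ext_iff']
  exact ⟨fun h => ⟨q.2, h⟩, fun h => h.2⟩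

/-- The exterior algebra of the Lie ring of strictly upper triangular matrices. -/
abbrev ExtNil (n : ℕ) : Type := ExteriorAlgebra ℤ (nil n)

variable (n) in
/-- The generator `e_{ab}` as an element of the exterior algebra. -/
def e (a b : ℕ) : ExtNil n := ExteriorAlgebra.ι ℤ (matUnit n a b)

/-- The boundary of the exterior algebra. -/
def bd (n : ℕ) : ExtNil n →ₗ[ℤ] ExtNil n := boundary ℤ (nil n)

/-- The basis of wedges `e_M`, for `M` a set of pairs. See `wedge_eq`. -/
def wedge (n : ℕ) : Module.Basis (Finset (Pair n)) ℤ (ExtNil n) := (nilBasis n).ExteriorAlgebra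

/-- `e_M` is the wedge of the `e_{ab}` with `(a, b) ∈ M`, in lexicographic order. -/
theorem wedge_eq (M : Finset (Pair n)) :
    wedge n M = ((M.sort (· ≤ ·)).map fun p => e n p.left p.right).prod := by
  rw [wedge, ExteriorAlgebra.basis_apply_ofCard (n := M.card) _ rfl, ExteriorAlgebra.ιMulti_family,
    ExteriorAlgebra.ιMulti_apply]
  congr 1
  apply List.ext_get
  · simp
  · intro i h1 h2
    simp only [List.get_eq_getElem, List.getElem_ofFn, List.getElem_map, Function.comp_apply, e,
      nilBasis_apply]
    rfl

/-- The list version of a wedge. -/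
def listWedge (l : List (Pair n)) : ExtNil n := (l.map fun p => e n p.left p.right).prod

theorem listWedge_perm {l l' : List (Pair n)} (h : l.Perm l') :
    listWedge l = listWedge l' ∨ listWedge l = -listWedge l' := by
  induction h with
  | nil => exact Or.inl rfl
  | cons x _ ih =>
    rcases ih with ih | ih <;> simp_all [listWedge]
  | swap x y l =>
    right
    simp only [listWedge, List.map_cons, List.prod_cons, ← mul_assoc, e]
    rw [eq_neg_of_add_eq_zero_left (ExteriorAlgebra.ι_add_mul_swap _ _), neg_mul]
  | trans _ _ ih1 ih2 =>
    rcases ih1 with ih1 | ih1 <;> rcases ih2 with ih2 | ih2 <;> simp [ih1, ih2]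

theorem listWedge_of_nodup {l : List (Pair n)} (h : l.Nodup) :
    listWedge l = wedge n l.toFinset ∨ listWedge l = -wedge n l.toFinset := by
  rw [wedge_eq]
  refine listWedge_perm ?_
  rw [List.perm_ext_iff_of_nodup h (Finset.sort_nodup _ _)]
  simp

theorem listWedge_of_not_nodup {l : List (Pair n)} (h : ¬l.Nodup) : listWedge l = 0 := by
  rw [List.nodup_iff_count_le_one] at h
  push Not at h
  obtain ⟨x, hx⟩ := h
  have h1 : l.Perm (x :: l.erase x) :=
    List.perm_cons_erase (List.count_pos_iff.mp (by omega))
  have h2 : (l.erase x).Perm (x :: (l.erase x).erase x) := by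
    refine List.perm_cons_erase (List.count_pos_iff.mp ?_)
    rw [List.count_erase_self]
    omega
  have h3 : listWedge (x :: x :: (l.erase x).erase x) = 0 := by
    simp only [listWedge, List.map_cons, List.prod_cons, ← mul_assoc, e]
    rw [ExteriorAlgebra.ι_sq_zero, zero_mul]
  rcases listWedge_perm (h1.trans (h2.cons x)) with h | h <;> rw [h, h3]
  exact neg_zero

theorem matUnit_val (p : Pair n) :
    (matUnit n p.left p.right).1 = Matrix.single (ofLex p.1).1 (ofLex p.1).2 1 := by
  ext i j
  rw [matUnit_apply, Matrix.single_apply]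
  refine if_congr ?_ rfl rfl
  constructor
  · rintro ⟨-, h1, h2⟩
    exact ⟨Subtype.ext h1.symm, Subtype.ext h2.symm⟩
  · rintro ⟨rfl, rfl⟩
    exact ⟨p.2, rfl, rfl⟩

/-- The composite `(a, c)` of `(a, b)` and `(b, c)`. -/
def Pair.comp (p q : Pair n) (h : p.right = q.left) : Pair n :=
  ⟨toLex ((ofLex p.1).1, (ofLex q.1).2), by
    have h1 := p.left_lt_right
    have h2 := q.left_lt_right
    exact (h1.trans_eq h).trans h2⟩

theorem matUnit_lie (p q : Pair n) :
    ⁅matUnit n p.left p.right, matUnit n q.left q.right⁆ =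
      if h : p.right = q.left then matUnit n (p.comp q h).left (p.comp q h).right
      else if h : q.right = p.left then -matUnit n (q.comp p h).left (q.comp p h).right
      else 0 := by
  have key : ∀ p q : Pair n, (h : p.right = q.left) →
      (matUnit n p.left p.right).1 * (matUnit n q.left q.right).1 =
        (matUnit n (p.comp q h).left (p.comp q h).right).1 := by
    intro p q h
    have h' : (ofLex p.1).2 = (ofLex q.1).1 := Subtype.ext h
    rw [matUnit_val, matUnit_val, matUnit_val, h', Matrix.single_mul_single_same, mul_one]
    rfl
  have key0 : ∀ p q : Pair n, p.right ≠ q.left →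
      (matUnit n p.left p.right).1 * (matUnit n q.left q.right).1 = 0 := by
    intro p q h
    rw [matUnit_val, matUnit_val, Matrix.single_mul_single_of_ne]
    exact fun h' => h (congrArg Subtype.val h')
  apply Subtype.ext
  rw [LieSubalgebra.coe_bracket, Ring.lie_def]
  have hp := p.left_lt_right
  have hq := q.left_lt_right
  split_ifs with h1 h2
  · rw [key p q h1, key0 q p (by omega), sub_zero]
  · rw [key q p h2, key0 p q h1, zero_sub]
    rfl
  · rw [key0 p q h1, key0 q p h2, sub_zero]
    rfl

theorem bd_listWedge_mem (S : Submodule ℤ (ExtNil n)) (l : List (Pair n))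
    (hS : ∀ (p q : Pair n) (h : p.right = q.left) (l' : List (Pair n)), l.Perm (p :: q :: l') →
      listWedge (p.comp q h :: l') ∈ S) : bd n (listWedge l) ∈ S := by
  have hl : listWedge l =
      ((l.map fun p => matUnit n p.left p.right).map (ExteriorAlgebra.ι ℤ)).prod := by
    simp [listWedge, e, Function.comp_def]
  rw [hl, bd, boundary_prod]
  refine Submodule.sum_mem _ fun i _ => Submodule.sum_mem _ fun j hj => Submodule.smul_mem _ _ ?_
  obtain ⟨hj, hij⟩ := Finset.mem_filter.mp hj
  have hj' : j < l.length := by simpa using hj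
  have hi' : i < l.length := hij.trans hj'
  have hi2 : i < (l.eraseIdx j).length := by
    rw [List.length_eraseIdx_of_lt hj']
    omega
  have hget : (l.eraseIdx j)[i] = l[i] := List.getElem_eraseIdx_of_lt hi2 hij
  have hperm : l.Perm (l[i] :: l[j] :: (l.eraseIdx j).eraseIdx i) := by
    refine (List.getElem_cons_eraseIdx_perm hj').symm.trans ?_
    refine (List.Perm.cons _ (List.getElem_cons_eraseIdx_perm hi2).symm).trans ?_
    rw [hget]
    exact List.Perm.swap _ _ _
  rw [List.getD_eq_getElem _ _ (by simpa using hi'), List.getD_eq_getElem _ _ (by simpa using hj'),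
    List.getElem_map, List.getElem_map, matUnit_lie, List.eraseIdx_map, List.eraseIdx_map]
  have hw : ∀ r : Pair n, ExteriorAlgebra.ι ℤ (matUnit n r.left r.right) *
      ((((l.eraseIdx j).eraseIdx i).map fun p => matUnit n p.left p.right).map
        (ExteriorAlgebra.ι ℤ)).prod = listWedge (r :: (l.eraseIdx j).eraseIdx i) := by
    intro r
    simp [listWedge, e, Function.comp_def]
  split_ifs with h1 h2
  · rw [hw]
    exact hS _ _ h1 _ hperm
  · rw [map_neg, neg_mul, hw]
    exact Submodule.neg_mem _ (hS _ _ h2 _ (hperm.trans (List.Perm.swap _ _ _)))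
  · rw [map_zero, zero_mul]
    exact Submodule.zero_mem _


/-- A set of generators such that all the generators in the boundaries of its members belong to it. -/
def ClosedUnderBoundary (S : Set (Finset (Pair n))) : Prop :=
  ∀ M ∈ S, ∀ (p q : Pair n) (h : p.right = q.left), p ∈ M → q ∈ M →
    p.comp q h ∉ (M.erase p).erase q → insert (p.comp q h) ((M.erase p).erase q) ∈ S

/-- The span of the generators `e_M` with `M ∈ S` and `|M| = j`. -/
def spanDeg (S : Set (Finset (Pair n))) (j : ℤ) : Submodule ℤ (ExtNil n) :=
  Submodule.span ℤ (wedge n '' {M | M ∈ S ∧ (M.card : ℤ) = j})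

theorem bd_mem_spanDeg {S : Set (Finset (Pair n))} (hS : ClosedUnderBoundary S) {i j : ℤ}
    (hij : j + 1 = i) : ∀ x ∈ spanDeg S i, bd n x ∈ spanDeg S j := by
  intro x hx
  change x ∈ (spanDeg S j).comap (bd n)
  refine Submodule.span_le.mpr ?_ hx
  rintro _ ⟨M, ⟨hM, hc⟩, rfl⟩
  change bd n (wedge n M) ∈ spanDeg S j
  rw [wedge_eq]
  refine bd_listWedge_mem _ (M.sort (· ≤ ·)) fun p q h l' hl => ?_
  by_cases hnd : (p.comp q h :: l').Nodup
  · have hnd2 : (p :: q :: l').Nodup := hl.nodup_iff.mp (Finset.sort_nodup _ _)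
    have hmem : ∀ r, r ∈ M ↔ r ∈ p :: q :: l' := fun r => by
      rw [← hl.mem_iff, Finset.mem_sort]
    have hmem' : ∀ r, r ∈ (M.erase p).erase q ↔ r ∈ l' := by
      intro r
      simp only [Finset.mem_erase, hmem, List.mem_cons]
      simp only [List.nodup_cons, List.mem_cons, not_or] at hnd2
      constructor
      · tauto
      · intro hr
        refine ⟨?_, ?_, Or.inr (Or.inr hr)⟩
        · rintro rfl
          exact hnd2.2.1 hr
        · rintro rfl
          exact hnd2.1.2 hr
    have hset : (p.comp q h :: l').toFinset = insert (p.comp q h) ((M.erase p).erase q) := by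
      ext r
      simp only [List.toFinset_cons, Finset.mem_insert, List.mem_toFinset, hmem']
    have hcard : ((p.comp q h :: l').toFinset.card : ℤ) = j := by
      have h1 := List.toFinset_card_of_nodup hnd
      have h2 := hl.length_eq
      rw [Finset.length_sort] at h2
      simp only [List.length_cons] at h1 h2
      omega
    have hw : wedge n (p.comp q h :: l').toFinset ∈ spanDeg S j := by
      refine Submodule.subset_span ⟨_, ⟨?_, hcard⟩, rfl⟩
      rw [hset]
      exact hS M hM p q h ((hmem p).mpr (by simp)) ((hmem q).mpr (by simp))
        (by rw [hmem']; exact (List.nodup_cons.mp hnd).1)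
    rcases listWedge_of_nodup hnd with h' | h' <;> rw [h']
    · exact hw
    · exact Submodule.neg_mem _ hw
  · rw [listWedge_of_not_nodup hnd]
    exact Submodule.zero_mem _

open CategoryTheory in
/-- The subcomplex of the exterior algebra spanned by the generators `e_M`, `M ∈ S`,
graded by `|M|`. -/
def subcomplex (S : Set (Finset (Pair n))) (hS : ClosedUnderBoundary S) :
    ChainComplex (ModuleCat ℤ) ℤ where
  X j := ModuleCat.of ℤ (spanDeg S j)
  d i j := if h : j + 1 = i then ModuleCat.ofHom ((bd n).restrict (bd_mem_spanDeg hS h)) else 0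
  shape i j h := dif_neg h
  d_comp_d' i j l hij hjl := by
    have hij' : j + 1 = i := hij
    have hjl' : l + 1 = j := hjl
    rw [dif_pos hij', dif_pos hjl']
    ext x
    exact congrArg Subtype.val (a₂ := (0 : spanDeg S l))
      (Subtype.ext (boundary_boundary (x : ExtNil n)) :
        (bd n).restrict (bd_mem_spanDeg hS hjl') ((bd n).restrict (bd_mem_spanDeg hS hij') x) = 0)

/-- The `i`-th entry of the modified weight of `e_M`: the number `i`, minus the number of times `i`
appears on the right in `e_M`, plus the number of times `i` appears on the left. -/
def weight (M : Finset (Pair n)) (i : ℕ) : ℤ :=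
  i - (((M.filter fun p => p.right = i).card : ℤ) - ((M.filter fun p => p.left = i).card : ℤ))

theorem weight_insert (M : Finset (Pair n)) (p q : Pair n) (h : p.right = q.left) (hp : p ∈ M)
    (hq : q ∈ M) (hpq : p.comp q h ∉ (M.erase p).erase q) (i : ℕ) :
    weight (insert (p.comp q h) ((M.erase p).erase q)) i = weight M i := by
  have hne : q ≠ p := by
    rintro rfl
    exact absurd h q.left_lt_right.ne'
  have key : ∀ N : Finset (Pair n), weight N i =
      i - ∑ r ∈ N, ((if r.right = i then (1 : ℤ) else 0) - (if r.left = i then (1 : ℤ) else 0)) := by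
    intro N
    simp [weight, Finset.sum_sub_distrib]
  rw [key, key, Finset.sum_insert hpq, ← Finset.add_sum_erase _ _ hp,
    ← Finset.add_sum_erase _ _ (Finset.mem_erase.mpr ⟨hne, hq⟩)]
  have h1 : (p.comp q h).left = p.left := rfl
  have h2 : (p.comp q h).right = q.right := rfl
  rw [h1, h2, h]
  ring

/-- The sets `M` with `e_M ∈ ⟦w₁, …, wₙ⟧`, i.e. `e_M` has modified weight `(w₁, …, wₙ)`. Only the
values `w i` with `1 ≤ i ≤ n` matter. -/
def gens (n : ℕ) (w : ℕ → ℤ) : Set (Finset (Pair n)) :=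
  {M | ∀ i ∈ Finset.Icc 1 n, weight M i = w i}

theorem gens_closed (n : ℕ) (w : ℕ → ℤ) : ClosedUnderBoundary (gens n w) := by
  intro M hM p q h hp hq hpq i hi
  rw [weight_insert M p q h hp hq hpq, hM i hi]

/-- The complex `⟦w₁, …, wₙ⟧`. -/
def bracket (n : ℕ) (w : ℕ → ℤ) : ChainComplex (ModuleCat ℤ) ℤ :=
  subcomplex (gens n w) (gens_closed n w)

/-- The sets `M` with `e_M ∈ ⟦w₁, …, wₙ⟧` such that some `e_{1i}` with `i ≥ k` occurs in `e_M`. -/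
def filtGens (n : ℕ) (w : ℕ → ℤ) (k : ℕ) : Set (Finset (Pair n)) :=
  {M | M ∈ gens n w ∧ ∃ p ∈ M, p.left = 1 ∧ k ≤ p.right}

theorem filtGens_closed (n : ℕ) (w : ℕ → ℤ) (k : ℕ) :
    ClosedUnderBoundary (filtGens n w k) := by
  rintro M ⟨hM, r, hr, hr1, hrk⟩ p q h hp hq hpq
  refine ⟨gens_closed n w M hM p q h hp hq hpq, ?_⟩
  have hp1 := p.left_pos
  have hp2 := p.left_lt_right
  have hq2 := q.left_lt_right
  by_cases hrp : r = p
  · subst hrp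
    exact ⟨r.comp q h, Finset.mem_insert_self _ _, hr1, hrk.trans (h.trans_lt hq2).le⟩
  · refine ⟨r, Finset.mem_insert_of_mem (Finset.mem_erase.mpr ⟨?_, Finset.mem_erase.mpr ⟨hrp, hr⟩⟩),
      hr1, hrk⟩
    rintro rfl
    omega

/-- The subcomplex `F_k^w` of `⟦w⟧`, spanned by the generators `e_{1i} e_M` with `i ≥ k`. -/
def filtration (n : ℕ) (w : ℕ → ℤ) (k : ℕ) : ChainComplex (ModuleCat ℤ) ℤ :=
  subcomplex (filtGens n w k) (filtGens_closed n w k)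

open CategoryTheory in
/-- The complex `K` shifted by `m`: its degree `j` part is the degree `j - m` part of `K`. -/
def shift (K : ChainComplex (ModuleCat ℤ) ℤ) (m : ℤ) : ChainComplex (ModuleCat ℤ) ℤ where
  X j := K.X (j - m)
  d i j := K.d (i - m) (j - m)
  shape i j h := K.shape _ _ fun h' => h (by
    have h2 : j - m + 1 = i - m := h'
    change j + 1 = i
    omega)
  d_comp_d' _ _ _ _ _ := K.d_comp_d _ _ _

/-- The sequence `(w₂ - 1, …, w_{n-2} - 1, 1, wₙ)` of length `n - 1`. -/
def reducedSeq (n : ℕ) (w : ℕ → ℤ) (i : ℕ) : ℤ :=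
  if i = n - 1 then w n else if i = n - 2 then 1 else w (i + 1) - 1

/-- The weights of the digraph of `⟦w⟧`, whose vertices are the generators `e_M`: the weight of
`e_M → e_N` is the coefficient of `e_N` in `∂ e_M`. -/
def digraph (n : ℕ) (w : ℕ → ℤ) (M N : gens n w) : ℤ :=
  (wedge n).repr (bd n (wedge n M)) N

/-- The degree `|M|` of the generator `e_M` of `⟦w⟧`. -/
def degree (n : ℕ) (w : ℕ → ℤ) (M : gens n w) : ℕ := M.1.card

/-- The inclusion of the free module on a set `C` of generators of `⟦w⟧` in the exterior algebra. -/
def incl {w : ℕ → ℤ} (C : Set (gens n w)) : (C →₀ ℤ) →ₗ[ℤ] ExtNil n :=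
  Finsupp.linearCombination ℤ fun M => wedge n M.1.1

/-- `(a, b) ∈ M`, for numbers `a` and `b`. -/
abbrev HasPair (M : Finset (Pair n)) (a b : ℕ) : Prop := ∃ p ∈ M, p.left = a ∧ p.right = b

/-- The wedge `e_{{s, …, k-1} × {k}} = e_{sk} e_{s+1,k} ⋯ e_{k-1,k}`. -/
def col (n s k : ℕ) : ExtNil n := ((List.Ico s k).map fun i => e n i k).prod

/-- The set `{1, …, k-1} × {k} ∪ {(k, a)}`. -/
def pairsA (n k a : ℕ) : Finset (Pair n) :=
  Finset.univ.filter fun p => p.right = k ∨ (p.left = k ∧ p.right = a)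

/-- The set `{(1, a)} ∪ {2, …, k-1} × {k}`. -/
def pairsB (n k a : ℕ) : Finset (Pair n) :=
  Finset.univ.filter fun p => (p.left = 1 ∧ p.right = a) ∨ (2 ≤ p.left ∧ p.right = k)

/-- `e_{{1, …, k-1} × {k}} e_{ka} e_M` is, up to sign, a generator of `⟦w⟧`. -/
def IsTypeA (n : ℕ) (w : ℕ → ℤ) (k a : ℕ) (M : Finset (Pair n)) : Prop :=
  k < a ∧ a ≤ n ∧ Disjoint (pairsA n k a) M ∧ pairsA n k a ∪ M ∈ gens n w

/-- `e_{1a} e_{{2, …, k-1} × {k}} e_M` is, up to sign, a generator of `⟦w⟧`, and `a > k`. -/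
def IsTypeB (n : ℕ) (w : ℕ → ℤ) (k a : ℕ) (M : Finset (Pair n)) : Prop :=
  k < a ∧ a ≤ n ∧ Disjoint (pairsB n k a) M ∧ pairsB n k a ∪ M ∈ gens n w

/-- The set `A` of generators of `⟦w⟧` (as sets of pairs, so up to sign). -/
def setA (n : ℕ) (w : ℕ → ℤ) (k : ℕ) : Set (Finset (Pair n)) :=
  {N | ∃ a M, IsTypeA n w k a M ∧ N = pairsA n k a ∪ M}

/-- The set `B` of generators of `⟦w⟧` (as sets of pairs, so up to sign). -/
def setB (n : ℕ) (w : ℕ → ℤ) (k : ℕ) : Set (Finset (Pair n)) :=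
  {N | ∃ a M, IsTypeB n w k a M ∧ N = pairsB n k a ∪ M}

/-- The number `n_M` of all `b ∈ {1, …, k-1}` with `(b, a) ∉ M`. -/
def numMissing (k a : ℕ) (M : Finset (Pair n)) : ℤ :=
  ((Finset.Ico 1 k).filter fun b => ¬ HasPair M b a).card

/-- The set `X` of all `(b, c) ∈ M` with `b < k < c` and `(b, a) ∉ M`. -/
def setX (k a : ℕ) (M : Finset (Pair n)) : Finset (Pair n) :=
  M.filter fun p => p.left < k ∧ k < p.right ∧ ¬ HasPair M p.left a

/-- The position (counted from `1`) of `p` in `M`, in lexicographic order. -/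
def position (p : Pair n) (M : Finset (Pair n)) : ℕ := (M.filter fun q => q ≤ p).card

end NilTorsion

end

open NilTorsion AlgMorse

/-! Since `w 1 = 2`, every generator of ⟦w⟧ contains exactly one `e_{1a}`. Since `w k = 2`, either
row `k` is empty and column `k` lacks exactly one entry, or row `k` has one entry and column `k` is
full. Let V denote sets without rows 1 and `k` that contain all (b,k) with 2 ≤ b < k. Then there are
four types of generators (`gens_subset`): A: `e_{1k} e_{ka} e_V`; B: `e_{1a} e_V` with a > k; U:
`e_{1a} e_V` with a < k; D: `e_{1k} e_{V∖(b,k)}`. The bracket `[e_{1b}, e_{bk}] = e_{1k}` pairs U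
with D with coefficients ±1, and all other components of the boundary of a U-generator have type U
or B. Cancelling U against D leaves A ∪ B. Here B spans F = F_{k+1}, and A is a copy of B one degree
higher via `e_{1k} e_{ka} ↔ e_{1a}`.

Two operators make this explicit. The operator h = `contraction` inverts the part of ∂ from U to D.
The operator τ = `tau` sends `e_{1a}`, a > k, to the sum of `e_{1b} e_{ba}` over 2 ≤ b ≤ k: the
summand b = k is the generator of type A, the others are corrections of type U. The key computation
`bd_tau_add_tau_bd` evaluates φ = ∂τ + τ∂ on B and shows that φ preserves F.

Homology: r = 1 - ∂h - h∂ vanishes on U, is the identity on B and on τ(B), and maps D into B. So ⟦w⟧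
retracts, up to homotopy, onto τ(F) + F. As τ is a null homotopy of φ followed by the inclusion, (x,
y) ↦ τx + y is a chain map from Cone φ; it is injective and has this image
(`nonempty_homology_iso_cone`). If k = n-1, then F is `e_{1n}` times a complex of smaller matrices,
and counting entries of column n shows that φ is multiplication by -(w n - 1).

Morse theory: acyclicity follows from a potential (`potential_lt`). A zigzag path between critical
generators of adjacent degrees uses at most one matching edge, because the boundary of a U-generator
meets D only in its partner. Hence the Morse boundary of a critical generator is the critical part
of ∂u, where u is that generator plus U-terms chosen such that ∂u has no D-part
(`incl_morseBoundary`). On B no correction is needed. On A one takes u = ±τ(e_{1a} v) and reads off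
∂τ = φ - τ∂: the A-part comes from τ∂, while φ gives the coefficient n_M and the sum over X. -/

namespace NilTorsion

open ChevalleyEilenberg

attribute [local instance] LieRing.ofAssociativeRing

/-! ### Wedges of matrix units up to sign, and spans of sets of generators. -/

section Wedges

variable {n : ℕ}

theorem wedge_empty : wedge n ∅ = 1 := by
  simp [wedge_eq]

theorem e_mul_self (a b : ℕ) : e n a b * e n a b = 0 := ExteriorAlgebra.ι_sq_zero _

theorem e_mul_comm (a b c d : ℕ) : e n a b * e n c d = -(e n c d * e n a b) :=
  eq_neg_of_add_eq_zero_left (ExteriorAlgebra.ι_add_mul_swap _ _)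

theorem e_mul_left_comm (a b c d : ℕ) (u : ExtNil n) :
    e n a b * (e n c d * u) = -(e n c d * (e n a b * u)) := by
  rw [← mul_assoc, e_mul_comm, neg_mul, mul_assoc]

theorem e_mul_e_mul_self (a b : ℕ) (u : ExtNil n) : e n a b * (e n a b * u) = 0 := by
  rw [← mul_assoc, e_mul_self, zero_mul]

theorem wedge_insert_of_lt {p : Pair n} {M : Finset (Pair n)} (h : ∀ q ∈ M, p < q) :
    wedge n (insert p M) = e n p.left p.right * wedge n M := by
  have hp : p ∉ M := fun hp => lt_irrefl _ (h p hp)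
  rw [wedge_eq, wedge_eq, Finset.sort_insert _ (fun q hq => (h q hq).le) hp, List.map_cons,
    List.prod_cons]

theorem e_mul_wedge_of_mem {p : Pair n} {M : Finset (Pair n)} (h : p ∈ M) :
    e n p.left p.right * wedge n M = 0 := by
  have h1 : listWedge (p :: M.sort (· ≤ ·)) = 0 :=
    listWedge_of_not_nodup fun h' => (List.nodup_cons.mp h').1 ((Finset.mem_sort _).mpr h)
  rw [wedge_eq]
  exact h1

theorem e_mul_wedge_of_notMem {p : Pair n} {M : Finset (Pair n)} (h : p ∉ M) :
    e n p.left p.right * wedge n M = wedge n (insert p M) ∨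
      e n p.left p.right * wedge n M = -wedge n (insert p M) := by
  have h1 := listWedge_of_nodup (l := p :: M.sort (· ≤ ·))
    (List.nodup_cons.mpr ⟨fun h' => h ((Finset.mem_sort _).mp h'), Finset.sort_nodup _ _⟩)
  have h2 : (p :: M.sort (· ≤ ·)).toFinset = insert p M := by
    ext
    simp
  rw [h2] at h1
  rw [wedge_eq M]
  exact h1

theorem e_mul_wedge_of_hasPair {M : Finset (Pair n)} {a b : ℕ} (h : HasPair M a b) :
    e n a b * wedge n M = 0 := by
  obtain ⟨p, hp, rfl, rfl⟩ := h
  exact e_mul_wedge_of_mem hp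

/-- The span of the generators `e_M` with `M ∈ S`. -/
def wedgeSpan (S : Set (Finset (Pair n))) : Submodule ℤ (ExtNil n) :=
  Submodule.span ℤ (wedge n '' S)

theorem wedge_mem_wedgeSpan {S : Set (Finset (Pair n))} {M : Finset (Pair n)} (h : M ∈ S) :
    wedge n M ∈ wedgeSpan S :=
  Submodule.subset_span ⟨M, h, rfl⟩

theorem mem_wedgeSpan {S : Set (Finset (Pair n))} {x : ExtNil n} :
    x ∈ wedgeSpan S ↔ ∀ M, (wedge n).repr x M ≠ 0 → M ∈ S := by
  rw [wedgeSpan, Module.Basis.mem_span_image]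
  simp [Set.subset_def]

theorem repr_eq_zero_of_mem_wedgeSpan {S : Set (Finset (Pair n))} {x : ExtNil n}
    (hx : x ∈ wedgeSpan S) {M : Finset (Pair n)} (hM : M ∉ S) : (wedge n).repr x M = 0 := by
  by_contra h
  exact hM (mem_wedgeSpan.mp hx M h)

theorem wedgeSpan_mono {S T : Set (Finset (Pair n))} (h : S ⊆ T) : wedgeSpan S ≤ wedgeSpan T :=
  Submodule.span_mono (Set.image_mono h)

theorem mem_wedgeSpan_inter {S T : Set (Finset (Pair n))} {x : ExtNil n} :
    x ∈ wedgeSpan (S ∩ T) ↔ x ∈ wedgeSpan S ∧ x ∈ wedgeSpan T := by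
  simp only [mem_wedgeSpan, Set.mem_inter_iff]
  exact ⟨fun h => ⟨fun M hM => (h M hM).1, fun M hM => (h M hM).2⟩,
    fun h M hM => ⟨h.1 M hM, h.2 M hM⟩⟩

theorem spanDeg_eq (S : Set (Finset (Pair n))) (j : ℤ) :
    spanDeg S j = wedgeSpan (S ∩ {M | (M.card : ℤ) = j}) := rfl

theorem wedgeSpan_le {S : Set (Finset (Pair n))} {P : Submodule ℤ (ExtNil n)}
    (h : ∀ M ∈ S, wedge n M ∈ P) : wedgeSpan S ≤ P := by
  refine Submodule.span_le.mpr ?_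
  rintro _ ⟨M, hM, rfl⟩
  exact h M hM

theorem eqOn_wedgeSpan {S : Set (Finset (Pair n))} {N : Type*} [AddCommGroup N]
    {f g : ExtNil n →ₗ[ℤ] N} (h : ∀ M ∈ S, f (wedge n M) = g (wedge n M)) {x : ExtNil n}
    (hx : x ∈ wedgeSpan S) : f x = g x := by
  have h2 : wedgeSpan S ≤ LinearMap.eqLocus f g := wedgeSpan_le fun M hM => h M hM
  exact h2 hx

/-- If the pair already occurs in `M`, the product vanishes, so `T` is only tested on genuine
insertions. -/
theorem e_mul_mem_wedgeSpan {S T : Set (Finset (Pair n))} {a b : ℕ}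
    (h : ∀ M ∈ S, ∀ p : Pair n, p.left = a → p.right = b → p ∉ M → insert p M ∈ T)
    (h1 : 1 ≤ a) (h2 : a < b) (h3 : b ≤ n)
    {x : ExtNil n} (hx : x ∈ wedgeSpan S) : e n a b * x ∈ wedgeSpan T := by
  have h4 : wedgeSpan S ≤ (wedgeSpan T).comap (LinearMap.mulLeft ℤ (e n a b)) := by
    refine wedgeSpan_le fun M hM => ?_
    obtain ⟨p, rfl, rfl⟩ := Pair.exists_mk h1 h2 h3
    change e n p.left p.right * wedge n M ∈ wedgeSpan T
    by_cases hp : p ∈ M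
    · rw [e_mul_wedge_of_mem hp]
      exact Submodule.zero_mem _
    · have h5 := wedge_mem_wedgeSpan (h M hM p rfl rfl hp)
      rcases e_mul_wedge_of_notMem hp with h6 | h6 <;> rw [h6]
      · exact h5
      · exact Submodule.neg_mem _ h5
  exact h4 hx

theorem bd_mem_wedgeSpan {S : Set (Finset (Pair n))} (hS : ClosedUnderBoundary S) {x : ExtNil n}
    (hx : x ∈ wedgeSpan S) : bd n x ∈ wedgeSpan S := by
  have h4 : wedgeSpan S ≤ (wedgeSpan S).comap (bd n) := by
    refine wedgeSpan_le fun M hM => ?_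
    have h1 := bd_mem_spanDeg hS (i := M.card) (j := M.card - 1) (by ring) (wedge n M)
      (wedge_mem_wedgeSpan ⟨hM, rfl⟩)
    exact wedgeSpan_mono Set.inter_subset_left h1
  exact h4 hx

end Wedges

/-! ### Contractions, and the boundary expressed through them. -/

section Contraction

variable {n : ℕ}

variable (n) in
/-- The entry of a strictly upper triangular matrix in position `(a, b)`. -/
noncomputable def entry (a b : ℕ) : Module.Dual ℤ (nil n) :=
  if h : a ∈ Finset.Icc 1 n ∧ b ∈ Finset.Icc 1 n then
    { toFun := fun A => A.1 ⟨a, h.1⟩ ⟨b, h.2⟩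
      map_add' := fun _ _ => rfl
      map_smul' := fun _ _ => rfl }
  else 0

theorem entry_matUnit (a b c d : ℕ) : entry n a b (matUnit n c d) =
    if a = c ∧ b = d ∧ 1 ≤ a ∧ a < b ∧ b ≤ n then 1 else 0 := by
  unfold entry
  split_ifs with h1 h2 h2
  · change (matUnit n c d).1 _ _ = _
    rw [matUnit_apply, if_pos]
    exact ⟨h2.2.2.2.1, h2.1, h2.2.1⟩
  · change (matUnit n c d).1 _ _ = _
    rw [matUnit_apply, if_neg]
    rintro ⟨h3, h4, h5⟩
    have h6 := Finset.mem_Icc.mp h1.1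
    have h7 := Finset.mem_Icc.mp h1.2
    exact h2 ⟨h4, h5, h6.1, h3, h7.2⟩
  · exfalso
    apply h1
    simp only [Finset.mem_Icc]
    omega
  · rfl

variable (n) in
/-- Contraction with the dual of `e_{ab}`. -/
noncomputable def ctr (a b : ℕ) : ExtNil n →ₗ[ℤ] ExtNil n :=
  CliffordAlgebra.contractLeft (Q := (0 : QuadraticForm ℤ (nil n))) (entry n a b)

theorem ctr_one (a b : ℕ) : ctr n a b 1 = 0 := CliffordAlgebra.contractLeft_one _ _

theorem ctr_ι_mul (a b : ℕ) (m : nil n) (u : ExtNil n) :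
    ctr n a b (ExteriorAlgebra.ι ℤ m * u) =
      entry n a b m • u - ExteriorAlgebra.ι ℤ m * ctr n a b u :=
  CliffordAlgebra.contractLeft_ι_mul _ _ _

theorem ctr_e_mul (a b c d : ℕ) (u : ExtNil n) : ctr n a b (e n c d * u) =
    (if a = c ∧ b = d ∧ 1 ≤ a ∧ a < b ∧ b ≤ n then u else 0) - e n c d * ctr n a b u := by
  rw [e, ctr_ι_mul, entry_matUnit]
  split_ifs <;> simp

theorem ctr_e_mul_of_ne {a b c d : ℕ} (h : a ≠ c ∨ b ≠ d) (u : ExtNil n) :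
    ctr n a b (e n c d * u) = -(e n c d * ctr n a b u) := by
  rw [ctr_e_mul, if_neg (by tauto), zero_sub]

theorem ctr_e_mul_self {a b : ℕ} (h1 : 1 ≤ a) (h2 : a < b) (h3 : b ≤ n) (u : ExtNil n) :
    ctr n a b (e n a b * u) = u - e n a b * ctr n a b u := by
  rw [ctr_e_mul, if_pos ⟨rfl, rfl, h1, h2, h3⟩]

theorem ctr_wedge_of_not_hasPair {a b : ℕ} {M : Finset (Pair n)} (h : ¬HasPair M a b) :
    ctr n a b (wedge n M) = 0 := by
  induction M using Finset.induction_on_min with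
  | empty => rw [wedge_empty, ctr_one]
  | insert p M hp ih =>
    rw [wedge_insert_of_lt hp, ctr_e_mul_of_ne, ih, mul_zero, neg_zero]
    · rintro ⟨q, hq, h1⟩
      exact h ⟨q, Finset.mem_insert_of_mem hq, h1⟩
    · by_contra h'
      push Not at h'
      exact h ⟨p, Finset.mem_insert_self _ _, h'.1.symm, h'.2.symm⟩

/-- Bringing the factor of `p` to the front passes `position p M - 1` factors; the exponent
`position p M + 1` has the same parity and avoids a subtraction. -/
theorem ctr_wedge_of_mem {p : Pair n} {M : Finset (Pair n)} (h : p ∈ M) :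
    ctr n p.left p.right (wedge n M) = (-1 : ℤ) ^ (position p M + 1) • wedge n (M.erase p) := by
  induction M using Finset.induction_on_min with
  | empty => simp at h
  | insert q M hq ih =>
    have hqM : q ∉ M := fun hp => lt_irrefl _ (hq q hp)
    rw [wedge_insert_of_lt hq]
    by_cases hpq : p = q
    · subst hpq
      have h1 : position p (insert p M) = 1 := by
        rw [position, Finset.filter_insert, if_pos le_rfl, Finset.filter_false_of_mem]
        · simp
        · exact fun r hr => not_le.mpr (hq r hr)
      rw [ctr_e_mul_self p.left_pos p.left_lt_right p.right_le, ctr_wedge_of_not_hasPair, h1,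
        Finset.erase_insert hqM]
      · simp
      · rintro ⟨r, hr, h2⟩
        exact hqM (Pair.ext_iff'.mpr h2 ▸ hr)
    · have hpM : p ∈ M := (Finset.mem_insert.mp h).resolve_left hpq
      have h1 : position p (insert q M) = position p M + 1 := by
        rw [position, Finset.filter_insert, if_pos (hq p hpM).le, Finset.card_insert_of_notMem]
        · rfl
        · simp [hqM]
      have h2 : p.left ≠ q.left ∨ p.right ≠ q.right := by
        by_contra h'
        push Not at h'
        exact hpq (Pair.ext_iff'.mpr h')
      rw [ctr_e_mul_of_ne h2, ih hpM, h1, Finset.erase_insert_of_ne (Ne.symm hpq),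
        wedge_insert_of_lt fun r hr => hq r (Finset.mem_of_mem_erase hr), pow_succ _ (_ + 1),
        mul_smul_comm, mul_neg_one, neg_smul]

theorem ctr_wedge_eq_or {p : Pair n} {M : Finset (Pair n)} (h : p ∈ M) :
    ctr n p.left p.right (wedge n M) = wedge n (M.erase p) ∨
      ctr n p.left p.right (wedge n M) = -wedge n (M.erase p) := by
  rw [ctr_wedge_of_mem h]
  rcases neg_one_pow_eq_or ℤ (position p M + 1) with h | h <;> simp [h]

theorem e_mul_ctr_wedge {a b : ℕ} {M : Finset (Pair n)} (h : HasPair M a b) :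
    e n a b * ctr n a b (wedge n M) = wedge n M := by
  obtain ⟨p, hp, rfl, rfl⟩ := h
  have h1 := ctr_e_mul_self p.left_pos p.left_lt_right p.right_le (wedge n M)
  rw [e_mul_wedge_of_mem hp, map_zero] at h1
  exact (sub_eq_zero.mp h1.symm).symm

theorem ctr_mem_wedgeSpan {S T : Set (Finset (Pair n))} {a b : ℕ}
    (h : ∀ M ∈ S, ∀ p ∈ M, p.left = a → p.right = b → M.erase p ∈ T)
    {x : ExtNil n} (hx : x ∈ wedgeSpan S) : ctr n a b x ∈ wedgeSpan T := by
  have h4 : wedgeSpan S ≤ (wedgeSpan T).comap (ctr n a b) := by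
    refine wedgeSpan_le fun M hM => ?_
    change ctr n a b (wedge n M) ∈ wedgeSpan T
    by_cases hp : HasPair M a b
    · obtain ⟨p, hp, rfl, rfl⟩ := hp
      have h5 := wedge_mem_wedgeSpan (h M hM p hp rfl rfl)
      rcases ctr_wedge_eq_or hp with h6 | h6 <;> rw [h6]
      · exact h5
      · exact Submodule.neg_mem _ h5
    · rw [ctr_wedge_of_not_hasPair hp]
      exact Submodule.zero_mem _
  exact h4 hx

theorem ctr_eq_zero_of_mem_wedgeSpan {S : Set (Finset (Pair n))} {a b : ℕ}
    (h : ∀ M ∈ S, ¬HasPair M a b) {x : ExtNil n} (hx : x ∈ wedgeSpan S) : ctr n a b x = 0 :=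
  eqOn_wedgeSpan (f := ctr n a b) (g := 0) (fun M hM => ctr_wedge_of_not_hasPair (h M hM)) hx

/-- Both sides are linear in `m`. On basis elements, `e_{bc}` contributes `e_{ac}` and `e_{xa}`
contributes `-e_{xb}`. -/
theorem lie_matUnit {a b : ℕ} (h1 : 1 ≤ a) (h2 : a < b) (h3 : b ≤ n) (m : nil n) :
    ⁅matUnit n a b, m⁆ = ∑ c ∈ Finset.Ioc b n, entry n b c m • matUnit n a c -
      ∑ x ∈ Finset.Ico 1 a, entry n x a m • matUnit n x b := by
  obtain ⟨p, rfl, rfl⟩ := Pair.exists_mk h1 h2 h3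
  have key : (LieModule.toEnd ℤ (nil n) (nil n) (matUnit n p.left p.right)) =
      ∑ c ∈ Finset.Ioc p.right n,
        (entry n p.right c).smulRight (matUnit n p.left c) -
      ∑ x ∈ Finset.Ico 1 p.left, (entry n x p.left).smulRight (matUnit n x p.right) := by
    refine (nilBasis n).ext fun q => ?_
    have hq1 := q.left_pos
    have hq2 := q.left_lt_right
    have hq3 := q.right_le
    rw [nilBasis_apply]
    simp only [LieModule.toEnd_apply_apply, LinearMap.sub_apply, LinearMap.sum_apply,
      LinearMap.smulRight_apply, entry_matUnit, matUnit_lie, ite_smul, one_smul, zero_smul]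
    split_ifs with h4 h5
    · rw [Finset.sum_eq_single q.right, Finset.sum_eq_zero, if_pos, sub_zero]
      · rfl
      · omega
      · intro x hx
        rw [if_neg]
        omega
      · intro x hx hx'
        rw [if_neg]
        omega
      · simp only [Finset.mem_Ioc]
        omega
    · rw [Finset.sum_eq_zero, Finset.sum_eq_single q.left, if_pos, zero_sub]
      · rfl
      · omega
      · intro x hx hx'
        rw [if_neg]
        omega
      · simp only [Finset.mem_Ico]
        omega
      · intro x hx
        rw [if_neg]
        omega
    · rw [Finset.sum_eq_zero, Finset.sum_eq_zero, sub_zero]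
      · intro x hx
        rw [if_neg]
        omega
      · intro x hx
        rw [if_neg]
        omega
  have h4 := LinearMap.congr_fun key m
  simpa only [LieModule.toEnd_apply_apply, LinearMap.sub_apply, LinearMap.sum_apply,
      LinearMap.smulRight_apply] using h4

/-- A contraction followed by multiplication with a vector is a derivation, as is the Lie action; so
the two sides agree because they agree on vectors, by `lie_matUnit`. -/
theorem lieAction_matUnit {a b : ℕ} (h1 : 1 ≤ a) (h2 : a < b) (h3 : b ≤ n) (u : ExtNil n) :
    lieAction ℤ (nil n) u (matUnit n a b) =
      ∑ c ∈ Finset.Ioc b n, e n a c * ctr n b c u -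
        ∑ x ∈ Finset.Ico 1 a, e n x b * ctr n x a u := by
  induction u using CliffordAlgebra.left_induction with
  | algebraMap r =>
    rw [Algebra.algebraMap_eq_smul_one]
    have h := fun x => lieAction_one (R := ℤ) (L := nil n) x
    have h' : ∀ a b, ctr n a b (r • (1 : ExtNil n)) = 0 := fun a b => by
      rw [map_smul, ctr_one, smul_zero]
    have h0 : lieAction ℤ (nil n) (r • (1 : ExtNil n)) (matUnit n a b) = 0 := by
      rw [map_smul, LinearMap.smul_apply, h, smul_zero]
    refine h0.trans ?_
    symm
    change ∑ c ∈ Finset.Ioc b n, e n a c * ctr n b c (r • (1 : ExtNil n)) -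
        ∑ x ∈ Finset.Ico 1 a, e n x b * ctr n x a (r • (1 : ExtNil n)) = 0
    simp only [h', mul_zero, Finset.sum_const_zero, sub_zero]
  | add u v hu hv =>
    rw [map_add, LinearMap.add_apply, hu, hv]
    simp only [map_add, mul_add, Finset.sum_add_distrib]
    abel
  | ι_mul u m hu =>
    refine (lieAction_ι_mul _ _ _).trans ?_
    rw [hu, lie_matUnit h1 h2 h3]
    have h4 : ∀ a b c d, e n a b * ctr n c d (ExteriorAlgebra.ι ℤ m * u) =
        entry n c d m • (e n a b * u) + ExteriorAlgebra.ι ℤ m * (e n a b * ctr n c d u) := by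
      intro a b c d
      have h5 : e n a b * ExteriorAlgebra.ι ℤ m = -(ExteriorAlgebra.ι ℤ m * e n a b) :=
        eq_neg_of_add_eq_zero_left (ExteriorAlgebra.ι_add_mul_swap _ _)
      rw [ctr_ι_mul, mul_sub, ← mul_assoc, h5, mul_smul_comm, neg_mul, sub_neg_eq_add, mul_assoc]
    have h5 : ∀ a b c d, e n a b * ctr n c d (CliffordAlgebra.ι 0 m * u) =
      _ := h4
    simp only [h5, Finset.sum_add_distrib, mul_sub, Finset.mul_sum, map_sub, map_sum, map_smul,
      sub_mul, Finset.sum_mul, smul_mul_assoc]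
    simp only [e]
    abel

/-- The basic tool of all boundary computations below: the brackets of the first factor with the
others are listed by contractions. -/
theorem bd_e_mul {a b : ℕ} (h1 : 1 ≤ a) (h2 : a < b) (h3 : b ≤ n) (u : ExtNil n) :
    bd n (e n a b * u) = -∑ c ∈ Finset.Ioc b n, e n a c * ctr n b c u +
        ∑ x ∈ Finset.Ico 1 a, e n x b * ctr n x a u - e n a b * bd n u := by
  rw [bd, e, boundary_ι_mul, lieAction_matUnit h1 h2 h3]
  abel

end Contraction

end NilTorsion

namespace NilTorsion

/-! ### The splitting operators and the closed form of ∂τ + τ∂. -/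

section Splitting

variable {n : ℕ}

variable (n) in
/-- The operator replacing `e_{ac}` by `e_{ab} e_{bc}`. -/
noncomputable def splitOp (a b c : ℕ) : ExtNil n →ₗ[ℤ] ExtNil n :=
  LinearMap.mulLeft ℤ (e n a b) ∘ₗ LinearMap.mulLeft ℤ (e n b c) ∘ₗ ctr n a c

theorem splitOp_apply (a b c : ℕ) (u : ExtNil n) :
    splitOp n a b c u = e n a b * (e n b c * ctr n a c u) := rfl

/-- Splitting reverses a bracket: it preserves the weight and adds one factor, unless one of the new
factors is already present and the result is zero. -/
theorem splitOp_mem_spanDeg {w : ℕ → ℤ} {a b c : ℕ} (h1 : 1 ≤ a) (hab : a < b) (hbc : b < c)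
    (hc : c ≤ n) {j : ℤ} {x : ExtNil n} (hx : x ∈ spanDeg (gens n w) j) :
    splitOp n a b c x ∈ spanDeg (gens n w) (j + 1) := by
  have h4 : spanDeg (gens n w) j ≤ (spanDeg (gens n w) (j + 1)).comap (splitOp n a b c) := by
    refine wedgeSpan_le ?_
    rintro M ⟨hM, hMj⟩
    change e n a b * (e n b c * ctr n a c (wedge n M)) ∈ spanDeg (gens n w) (j + 1)
    by_cases hac : HasPair M a c
    swap
    · rw [ctr_wedge_of_not_hasPair hac, mul_zero, mul_zero]
      exact Submodule.zero_mem _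
    obtain ⟨r, hr, rfl, rfl⟩ := hac
    obtain ⟨p, hp1, hp2⟩ := Pair.exists_mk (n := n) h1 hab (hbc.le.trans hc)
    obtain ⟨q, hq1, hq2⟩ := Pair.exists_mk (n := n) (h1.trans hab.le) hbc hc
    have h : p.right = q.left := by omega
    have hcomp : p.comp q h = r := Pair.ext_iff'.mpr ⟨hp1, hq2⟩
    have hpq : p ≠ q := by
      rintro rfl
      omega
    rw [← hp1, ← hp2, h, hq1, ← hq1, ← h, ← hq2]
    suffices h5 : e n p.left p.right * (e n q.left q.right * wedge n (M.erase r)) ∈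
        spanDeg (gens n w) (j + 1) by
      rw [h, hp1, hq2] at *
      rcases ctr_wedge_eq_or hr with h6 | h6 <;> rw [h6]
      · exact h5
      · rw [mul_neg, mul_neg]
        exact Submodule.neg_mem _ h5
    by_cases hq : q ∈ M.erase r
    · rw [e_mul_wedge_of_mem hq, mul_zero]
      exact Submodule.zero_mem _
    by_cases hp : p ∈ M.erase r
    · rcases e_mul_wedge_of_notMem hq with h6 | h6 <;> rw [h6]
      · rw [e_mul_wedge_of_mem (Finset.mem_insert_of_mem hp)]
        exact Submodule.zero_mem _
      · rw [mul_neg, e_mul_wedge_of_mem (Finset.mem_insert_of_mem hp), neg_zero]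
        exact Submodule.zero_mem _
    have hp' : p ∉ insert q (M.erase r) := by
      rw [Finset.mem_insert, not_or]
      exact ⟨hpq, hp⟩
    have h7 : wedge n (insert p (insert q (M.erase r))) ∈ spanDeg (gens n w) (j + 1) := by
      refine wedge_mem_wedgeSpan ⟨?_, ?_⟩
      · intro i hi
        have h8 : ((insert p (insert q (M.erase r))).erase p).erase q = M.erase r := by
          rw [Finset.erase_insert hp', Finset.erase_insert hq]
        -- Merging `p` and `q` in the split set gives back `M`, so invariance of the weight under
        -- merging applies in reverse.
        have h9 := weight_insert (insert p (insert q (M.erase r))) p q h (by simp) (by simp)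
          (by rw [h8, hcomp]; simp) i
        rw [h8, hcomp, Finset.insert_erase hr] at h9
        rw [← h9]
        exact hM i hi
      · have h8 : (M.card : ℤ) = j := hMj
        have h9 := Finset.card_erase_add_one hr
        change ((insert p (insert q (M.erase r))).card : ℤ) = j + 1
        rw [Finset.card_insert_of_notMem hp', Finset.card_insert_of_notMem hq, h9, ← h8]
        push_cast
        ring
    rcases e_mul_wedge_of_notMem hq with h6 | h6 <;>
      rcases e_mul_wedge_of_notMem hp' with h9 | h9 <;> simp only [h6, h9, mul_neg, neg_neg]
    · exact h7
    · exact Submodule.neg_mem _ h7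
    · exact Submodule.neg_mem _ h7
    · exact h7
  exact h4 hx

/-- The sets of pairs `(a, b)` with `a ≠ r`. -/
def noRow (n r : ℕ) : Set (Finset (Pair n)) := {M | ∀ p ∈ M, p.left ≠ r}

theorem noRow_closed (r : ℕ) : ClosedUnderBoundary (noRow n r) := by
  intro M hM p q h hp hq _ x hx
  simp only [Finset.mem_insert, Finset.mem_erase] at hx
  rcases hx with rfl | hx
  · exact hM p hp
  · exact hM x hx.2.2

theorem ctr_eq_zero_of_noRow {r c : ℕ} {u : ExtNil n} (hu : u ∈ wedgeSpan (noRow n r)) :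
    ctr n r c u = 0 := by
  refine ctr_eq_zero_of_mem_wedgeSpan ?_ hu
  rintro M hM ⟨p, hp, h, -⟩
  exact hM p hp h

theorem ctr_mem_noRow {r a b : ℕ} {u : ExtNil n} (hu : u ∈ wedgeSpan (noRow n r)) :
    ctr n a b u ∈ wedgeSpan (noRow n r) :=
  ctr_mem_wedgeSpan (S := noRow n r) (T := noRow n r)
    (fun _ hM _ _ _ _ q hq => hM q (Finset.mem_of_mem_erase hq)) hu

theorem e_mul_mem_noRow {r a b : ℕ} (h : a ≠ r) (h1 : 1 ≤ a) (h2 : a < b) (h3 : b ≤ n)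
    {u : ExtNil n} (hu : u ∈ wedgeSpan (noRow n r)) : e n a b * u ∈ wedgeSpan (noRow n r) := by
  refine e_mul_mem_wedgeSpan (S := noRow n r) (T := noRow n r) ?_ h1 h2 h3 hu
  intro M hM p hp _ _ q hq
  rcases Finset.mem_insert.mp hq with rfl | hq
  · omega
  · exact hM q hq

theorem bd_mem_noRow {r : ℕ} {u : ExtNil n} (hu : u ∈ wedgeSpan (noRow n r)) :
    bd n u ∈ wedgeSpan (noRow n r) :=
  bd_mem_wedgeSpan (noRow_closed r) hu

theorem bd_e_one_mul {a : ℕ} (h2 : 1 < a) (h3 : a ≤ n) (u : ExtNil n) :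
    bd n (e n 1 a * u) = -∑ c ∈ Finset.Ioc a n, e n 1 c * ctr n a c u - e n 1 a * bd n u := by
  rw [bd_e_mul le_rfl h2 h3]
  simp

variable (n) in
/-- The operator replacing each `e_{1c}` with `c > k` by the sum of all `e_{1b} e_{bc}` with
`2 ≤ b ≤ k`. -/
noncomputable def tau (k : ℕ) : ExtNil n →ₗ[ℤ] ExtNil n :=
  ∑ c ∈ Finset.Ioc k n, ∑ b ∈ Finset.Icc 2 k, splitOp n 1 b c

variable (n) in
/-- The operator replacing `e_{1k}` by minus the sum of all `e_{1b} e_{bk}` with `2 ≤ b < k`. -/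
noncomputable def contraction (k : ℕ) : ExtNil n →ₗ[ℤ] ExtNil n :=
  -∑ b ∈ Finset.Ico 2 k, splitOp n 1 b k

variable (n) in
/-- The operator replacing `e_{1k} e_{kc}` by `e_{1c}`. -/
noncomputable def mergeOp (k : ℕ) : ExtNil n →ₗ[ℤ] ExtNil n :=
  ∑ c ∈ Finset.Ioc k n, LinearMap.mulLeft ℤ (e n 1 c) ∘ₗ ctr n k c ∘ₗ ctr n 1 k

theorem tau_apply (k : ℕ) (u : ExtNil n) : tau n k u =
    ∑ c ∈ Finset.Ioc k n, ∑ b ∈ Finset.Icc 2 k, e n 1 b * (e n b c * ctr n 1 c u) := by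
  simp only [tau, LinearMap.sum_apply, splitOp_apply]

theorem contraction_apply (k : ℕ) (u : ExtNil n) : contraction n k u =
    -∑ b ∈ Finset.Ico 2 k, e n 1 b * (e n b k * ctr n 1 k u) := by
  simp only [contraction, LinearMap.neg_apply, LinearMap.sum_apply, splitOp_apply]

theorem mergeOp_apply (k : ℕ) (u : ExtNil n) : mergeOp n k u =
    ∑ c ∈ Finset.Ioc k n, e n 1 c * ctr n k c (ctr n 1 k u) := by
  simp only [mergeOp, LinearMap.sum_apply, LinearMap.comp_apply, LinearMap.mulLeft_apply]

theorem ctr_one_e_one_mul {a c : ℕ} (h1 : 1 < c) (h2 : c ≤ n) {v : ExtNil n}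
    (hv : v ∈ wedgeSpan (noRow n 1)) : ctr n 1 c (e n 1 a * v) = if a = c then v else 0 := by
  rw [ctr_e_mul, ctr_eq_zero_of_noRow hv, mul_zero, sub_zero]
  refine if_congr ?_ rfl rfl
  omega

theorem tau_e_one_mul {k a : ℕ} (hk : 2 ≤ k) {v : ExtNil n}
    (hv : v ∈ wedgeSpan (noRow n 1)) (ha : a ∈ Finset.Ioc k n) :
    tau n k (e n 1 a * v) = ∑ b ∈ Finset.Icc 2 k, e n 1 b * (e n b a * v) := by
  rw [tau_apply, Finset.sum_eq_single a]
  · have h := Finset.mem_Ioc.mp ha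
    rw [ctr_one_e_one_mul (by omega) h.2 hv, if_pos rfl]
  · intro c hc hca
    have h := Finset.mem_Ioc.mp hc
    rw [ctr_one_e_one_mul (by omega) h.2 hv, if_neg hca.symm]
    simp
  · exact fun h => absurd ha h

theorem contraction_e_one_mul {k a : ℕ} (hk : 2 ≤ k) (hkn : k ≤ n) {v : ExtNil n}
    (hv : v ∈ wedgeSpan (noRow n 1)) : contraction n k (e n 1 a * v) =
      if a = k then -∑ b ∈ Finset.Ico 2 k, e n 1 b * (e n b k * v) else 0 := by
  rw [contraction_apply, ctr_one_e_one_mul (by omega) hkn hv]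
  split_ifs <;> simp

/-- The operator `∂τ + τ∂`, on elements `e_{1a} v` where the rows `1` and `k` do not occur
in `v`, in closed form. -/
theorem bd_tau_add_tau_bd {k a : ℕ} (hk : 2 ≤ k) {v : ExtNil n}
    (hv : v ∈ wedgeSpan (noRow n 1)) (hv' : v ∈ wedgeSpan (noRow n k))
    (ha : a ∈ Finset.Ioc k n) :
    bd n (tau n k (e n 1 a * v)) + tau n k (bd n (e n 1 a * v)) =
      -((k - 1 : ℤ) • (e n 1 a * v)) -
        ∑ b ∈ Finset.Ico 2 k, ∑ c ∈ Finset.Ioc k n, e n b a * (e n 1 c * ctr n b c v) := by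
  obtain ⟨hka, han⟩ := Finset.mem_Ioc.mp ha
  have h1 : tau n k (bd n (e n 1 a * v)) =
      -∑ b ∈ Finset.Icc 2 k, ∑ c ∈ Finset.Ioc a n, e n 1 b * (e n b c * ctr n a c v) -
        ∑ b ∈ Finset.Icc 2 k, e n 1 b * (e n b a * bd n v) := by
    rw [bd_e_one_mul (by omega) han, map_sub, map_neg, map_sum,
      tau_e_one_mul hk (bd_mem_noRow hv) ha, Finset.sum_comm]
    congr 2
    refine Finset.sum_congr rfl fun c hc => ?_
    refine tau_e_one_mul hk (ctr_mem_noRow hv) ?_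
    have := Finset.mem_Ioc.mp hc
    exact Finset.mem_Ioc.mpr ⟨by omega, by omega⟩
  -- The term `-e_{1a} v` comes from `[e_{1b}, e_{ba}]`. The sum over c > a and the term with `bd n
  -- v` will cancel against the two sums in `h1`.
  have h2 : ∀ b ∈ Finset.Icc 2 k, bd n (e n 1 b * (e n b a * v)) =
      -(e n 1 a * v) + ∑ c ∈ Finset.Ioc b n, e n 1 c * (e n b a * ctr n b c v) +
        (∑ c ∈ Finset.Ioc a n, e n 1 b * (e n b c * ctr n a c v) -
          ∑ x ∈ Finset.Ico 2 b, e n 1 b * (e n x a * ctr n x b v) +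
          e n 1 b * (e n b a * bd n v)) := by
    intro b hb
    obtain ⟨hb2, hbk⟩ := Finset.mem_Icc.mp hb
    rw [bd_e_one_mul (by omega) (by omega), bd_e_mul (by omega) (by omega) han]
    have h3 : ∑ c ∈ Finset.Ioc b n, e n 1 c * ctr n b c (e n b a * v) =
        e n 1 a * v - ∑ c ∈ Finset.Ioc b n, e n 1 c * (e n b a * ctr n b c v) := by
      have h4 : e n 1 a * v = ∑ c ∈ Finset.Ioc b n, if c = a then e n 1 a * v else 0 := by
        rw [Finset.sum_ite_eq', if_pos]
        exact Finset.mem_Ioc.mpr ⟨by omega, han⟩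
      rw [h4, ← Finset.sum_sub_distrib]
      refine Finset.sum_congr rfl fun c hc => ?_
      obtain ⟨hbc, hcn⟩ := Finset.mem_Ioc.mp hc
      by_cases hca : c = a
      · subst hca
        rw [ctr_e_mul_self (by omega) hbc hcn, if_pos rfl, mul_sub]
      · rw [ctr_e_mul_of_ne (Or.inr hca), if_neg hca, mul_neg, zero_sub]
    have h4 : ∑ x ∈ Finset.Ico 1 b, e n x a * ctr n x b v =
        ∑ x ∈ Finset.Ico 2 b, e n x a * ctr n x b v := by
      rw [Finset.sum_eq_sum_Ico_succ_bot (by omega), ctr_eq_zero_of_noRow hv, mul_zero, zero_add]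
    rw [h3, h4]
    simp only [mul_add, mul_sub, mul_neg, Finset.mul_sum]
    abel
  -- After renaming (b,c) to (x,b), the terms with c ≤ k are the first sum on the right, which the
  -- x-sums of `h2` cancel. Only c > k survives.
  have h5 : ∑ b ∈ Finset.Icc 2 k, ∑ c ∈ Finset.Ioc b n, e n 1 c * (e n b a * ctr n b c v) =
      ∑ b ∈ Finset.Icc 2 k, ∑ x ∈ Finset.Ico 2 b, e n 1 b * (e n x a * ctr n x b v) -
      ∑ b ∈ Finset.Ico 2 k, ∑ c ∈ Finset.Ioc k n, e n b a * (e n 1 c * ctr n b c v) := by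
    have h6 : ∑ b ∈ Finset.Icc 2 k, ∑ x ∈ Finset.Ico 2 b, e n 1 b * (e n x a * ctr n x b v) =
        ∑ x ∈ Finset.Ico 2 k, ∑ b ∈ Finset.Ioc x k, e n 1 b * (e n x a * ctr n x b v) := by
      refine Finset.sum_comm' ?_
      intro x y
      simp only [Finset.mem_Icc, Finset.mem_Ico, Finset.mem_Ioc]
      omega
    -- Row `k` does not occur in `v`, which is why b stops before `k` in the final sum.
    have h7 : ∑ c ∈ Finset.Ioc k n, e n 1 c * (e n k a * ctr n k c v) = 0 :=
      Finset.sum_eq_zero fun c _ => by rw [ctr_eq_zero_of_noRow hv', mul_zero, mul_zero]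
    rw [h6, ← Finset.Ico_insert_right hk, Finset.sum_insert (by simp), h7, zero_add,
      ← Finset.sum_sub_distrib]
    refine Finset.sum_congr rfl fun b hb => ?_
    obtain ⟨hb2, hbk⟩ := Finset.mem_Ico.mp hb
    have h8 : Finset.Ioc b n = Finset.Ioc b k ∪ Finset.Ioc k n := by
      rw [Finset.Ioc_union_Ioc_eq_Ioc hbk.le (by omega)]
    rw [h8, Finset.sum_union (Finset.Ioc_disjoint_Ioc_of_le le_rfl), sub_eq_add_neg,
      ← Finset.sum_neg_distrib]
    congr 1
    exact Finset.sum_congr rfl fun c _ => e_mul_left_comm _ _ _ _ _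
  rw [h1, tau_e_one_mul hk hv ha, map_sum, Finset.sum_congr rfl h2]
  simp only [Finset.sum_add_distrib, Finset.sum_sub_distrib]
  rw [h5, Finset.sum_const, Nat.card_Icc]
  -- One copy of `-e_{1a} v` for each b in {2, …, k}.
  have h9 : (k + 1 - 2) • -(e n 1 a * v) = -((k - 1 : ℤ) • (e n 1 a * v)) := by
    rw [smul_neg, ← natCast_zsmul]
    congr 2
    omega
  rw [h9]
  abel

end Splitting

end NilTorsion

namespace NilTorsion

/-! ### The four types A, B, U, D, and the effect of ∂, h and τ on them. -/

section Types

variable {n : ℕ}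

/-- The sets of pairs in which the rows `1` and `k` do not occur, and which contain all `(b, k)`
with `2 ≤ b < k`. -/
def baseSet (n k : ℕ) : Set (Finset (Pair n)) :=
  {V | (∀ p ∈ V, p.left ≠ 1 ∧ p.left ≠ k) ∧ ∀ b ∈ Finset.Ico 2 k, HasPair V b k}

/-- The sets consisting of a pair `(1, a)` with `k < a` and a set in `baseSet n k`. -/
def typeB (n k : ℕ) : Set (Finset (Pair n)) :=
  {M | ∃ p : Pair n, ∃ V ∈ baseSet n k, p.left = 1 ∧ k < p.right ∧ M = insert p V}

/-- The sets consisting of a pair `(1, a)` with `a < k` and a set in `baseSet n k`. -/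
def typeU (n k : ℕ) : Set (Finset (Pair n)) :=
  {M | ∃ p : Pair n, ∃ V ∈ baseSet n k, p.left = 1 ∧ p.right < k ∧ M = insert p V}

/-- The sets consisting of the pair `(1, k)` and a set in `baseSet n k` with one pair `(b, k)`
removed. -/
def typeD (n k : ℕ) : Set (Finset (Pair n)) :=
  {M | ∃ p : Pair n, ∃ V ∈ baseSet n k, ∃ q ∈ V, p.left = 1 ∧ p.right = k ∧ q.right = k ∧
    M = insert p (V.erase q)}

/-- The sets consisting of the pairs `(1, k)` and `(k, a)` and a set in `baseSet n k`. -/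
def typeA (n k : ℕ) : Set (Finset (Pair n)) :=
  {M | ∃ p q : Pair n, ∃ V ∈ baseSet n k, p.left = 1 ∧ p.right = k ∧ q.left = k ∧
    M = insert p (insert q V)}

theorem Pair.lt_of_left_lt {p q : Pair n} (h : p.left < q.left) : p < q := by
  change p.1 < q.1
  exact Prod.Lex.lt_iff.mpr (Or.inl h)

theorem baseSet_subset_noRow_one {k : ℕ} : baseSet n k ⊆ noRow n 1 :=
  fun _ hV p hp => (hV.1 p hp).1

theorem baseSet_subset_noRow {k : ℕ} : baseSet n k ⊆ noRow n k :=
  fun _ hV p hp => (hV.1 p hp).2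

theorem wedge_insert_one {p : Pair n} (hp : p.left = 1) {V : Finset (Pair n)}
    (hV : V ∈ noRow n 1) : wedge n (insert p V) = e n 1 p.right * wedge n V := by
  rw [wedge_insert_of_lt, hp]
  intro q hq
  refine Pair.lt_of_left_lt ?_
  have h1 := hV q hq
  have h2 := q.left_pos
  omega

/-- A bracket cannot consume a required pair (b,k). As the left factor it would need a partner in
row `k`, which is absent. As the right factor it would yield (c,k) with 2 ≤ c < k, which is already
present, so that term is zero. -/
theorem baseSet_closed {k : ℕ} : ClosedUnderBoundary (baseSet n k) := by
  intro M hM p q h hp hq hpq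
  have hpq1 : (p.comp q h).left = p.left := rfl
  have hpq2 : (p.comp q h).right = q.right := rfl
  have hp2 := p.left_lt_right
  have hq2 := q.left_lt_right
  refine ⟨?_, ?_⟩
  · intro x hx
    simp only [Finset.mem_insert, Finset.mem_erase] at hx
    rcases hx with rfl | hx
    · exact hM.1 p hp
    · exact hM.1 x hx.2.2
  · intro b hb
    have hb' := Finset.mem_Ico.mp hb
    obtain ⟨x, hx, hx1, hx2⟩ := hM.2 b hb
    refine ⟨x, ?_, hx1, hx2⟩
    simp only [Finset.mem_insert, Finset.mem_erase]
    refine Or.inr ⟨?_, ?_, hx⟩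
    · rintro rfl
      obtain ⟨y, hy, hy1, hy2⟩ := hM.2 p.left (Finset.mem_Ico.mpr
        ⟨by have := p.left_pos; have := (hM.1 p hp).1; omega, by omega⟩)
      apply hpq
      have h1 : p.comp x h = y := Pair.ext_iff'.mpr ⟨hy1.symm, hx2.trans hy2.symm⟩
      rw [h1]
      simp only [Finset.mem_erase]
      refine ⟨?_, ?_, hy⟩
      · rintro rfl
        omega
      · rintro rfl
        omega
    · rintro rfl
      exact (hM.1 q hq).2 (h.symm.trans hx2)

theorem e_mul_wedge_baseSet {k b : ℕ} {V : Finset (Pair n)} (hV : V ∈ baseSet n k)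
    (hb : b ∈ Finset.Ico 2 k) : e n b k * wedge n V = 0 :=
  e_mul_wedge_of_hasPair (hV.2 b hb)

theorem e_mul_mem_baseSet {k a b : ℕ} (h : a ≠ 1) (h' : a ≠ k) (h1 : 1 ≤ a) (h2 : a < b)
    (h3 : b ≤ n) {u : ExtNil n} (hu : u ∈ wedgeSpan (baseSet n k)) :
    e n a b * u ∈ wedgeSpan (baseSet n k) := by
  refine e_mul_mem_wedgeSpan (S := baseSet n k) (T := baseSet n k) ?_ h1 h2 h3 hu
  intro M hM p hp _ _
  refine ⟨?_, ?_⟩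
  · intro q hq
    rcases Finset.mem_insert.mp hq with rfl | hq
    · omega
    · exact hM.1 q hq
  · intro b hb
    obtain ⟨x, hx, h⟩ := hM.2 b hb
    exact ⟨x, Finset.mem_insert_of_mem hx, h⟩

theorem ctr_mem_baseSet {k a b : ℕ} (h : b ≠ k) {u : ExtNil n}
    (hu : u ∈ wedgeSpan (baseSet n k)) : ctr n a b u ∈ wedgeSpan (baseSet n k) := by
  refine ctr_mem_wedgeSpan (S := baseSet n k) (T := baseSet n k) ?_ hu
  intro M hM p _ _ hp
  refine ⟨fun q hq => hM.1 q (Finset.mem_of_mem_erase hq), ?_⟩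
  intro b hb
  obtain ⟨x, hx, hx1, hx2⟩ := hM.2 b hb
  refine ⟨x, Finset.mem_erase.mpr ⟨?_, hx⟩, hx1, hx2⟩
  rintro rfl
  omega

theorem e_one_mul_mem_typeB {k a : ℕ} (hk : 2 ≤ k) (ha : a ∈ Finset.Ioc k n) {u : ExtNil n}
    (hu : u ∈ wedgeSpan (baseSet n k)) : e n 1 a * u ∈ wedgeSpan (typeB n k) := by
  obtain ⟨h1, h2⟩ := Finset.mem_Ioc.mp ha
  refine e_mul_mem_wedgeSpan (S := baseSet n k) (T := typeB n k) ?_ le_rfl (by omega) h2 hu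
  intro M hM p hp1 hp2 _
  exact ⟨p, M, hM, hp1, by omega, rfl⟩

theorem e_one_mul_mem_typeU {k a : ℕ} (hkn : k ≤ n) (ha : a ∈ Finset.Ico 2 k) {u : ExtNil n}
    (hu : u ∈ wedgeSpan (baseSet n k)) : e n 1 a * u ∈ wedgeSpan (typeU n k) := by
  obtain ⟨h1, h2⟩ := Finset.mem_Ico.mp ha
  refine e_mul_mem_wedgeSpan (S := baseSet n k) (T := typeU n k) ?_ le_rfl (by omega)
    (by omega) hu
  intro M hM p hp1 hp2 _
  exact ⟨p, M, hM, hp1, by omega, rfl⟩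

theorem wedgeSpan_typeB_le {k : ℕ} {P : Submodule ℤ (ExtNil n)}
    (h : ∀ a ∈ Finset.Ioc k n, ∀ V ∈ baseSet n k, e n 1 a * wedge n V ∈ P) :
    wedgeSpan (typeB n k) ≤ P := by
  refine wedgeSpan_le ?_
  rintro _ ⟨p, V, hV, hp1, hp2, rfl⟩
  rw [wedge_insert_one hp1 (baseSet_subset_noRow_one hV)]
  exact h _ (Finset.mem_Ioc.mpr ⟨hp2, p.right_le⟩) V hV

theorem wedgeSpan_typeU_le {k : ℕ} {P : Submodule ℤ (ExtNil n)}
    (h : ∀ a ∈ Finset.Ico 2 k, ∀ V ∈ baseSet n k, e n 1 a * wedge n V ∈ P) :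
    wedgeSpan (typeU n k) ≤ P := by
  refine wedgeSpan_le ?_
  rintro _ ⟨p, V, hV, hp1, hp2, rfl⟩
  rw [wedge_insert_one hp1 (baseSet_subset_noRow_one hV)]
  have := p.left_lt_right
  exact h _ (Finset.mem_Ico.mpr ⟨by omega, hp2⟩) V hV

theorem e_one_mul_mem_typeU_union_typeB {k a : ℕ} (hk : 2 ≤ k) (hkn : k ≤ n) (ha : 1 < a)
    (hak : a ≠ k) (han : a ≤ n) {u : ExtNil n} (hu : u ∈ wedgeSpan (baseSet n k)) :
    e n 1 a * u ∈ wedgeSpan (typeU n k) ⊔ wedgeSpan (typeB n k) := by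
  rcases lt_or_gt_of_ne hak with h | h
  · exact Submodule.mem_sup_left (e_one_mul_mem_typeU hkn (Finset.mem_Ico.mpr ⟨ha, h⟩) hu)
  · exact Submodule.mem_sup_right (e_one_mul_mem_typeB hk (Finset.mem_Ioc.mpr ⟨h, han⟩) hu)

/-- Brackets with `e_{1a}` only produce `e_{1c}` with c > a > k and remove a pair outside column
`k`. -/
theorem bd_mem_typeB {k : ℕ} (hk : 2 ≤ k) {x : ExtNil n} (hx : x ∈ wedgeSpan (typeB n k)) :
    bd n x ∈ wedgeSpan (typeB n k) := by
  have h : wedgeSpan (typeB n k) ≤ (wedgeSpan (typeB n k)).comap (bd n) := by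
    refine wedgeSpan_typeB_le fun a ha V hV => ?_
    obtain ⟨h1, h2⟩ := Finset.mem_Ioc.mp ha
    have hV' := wedge_mem_wedgeSpan hV
    rw [Submodule.mem_comap, bd_e_one_mul (by omega) h2]
    refine Submodule.sub_mem _ (Submodule.neg_mem _ (Submodule.sum_mem _ fun c hc => ?_)) ?_
    · obtain ⟨h3, h4⟩ := Finset.mem_Ioc.mp hc
      exact e_one_mul_mem_typeB hk (Finset.mem_Ioc.mpr ⟨by omega, h4⟩)
        (ctr_mem_baseSet (by omega) hV')
    · exact e_one_mul_mem_typeB hk ha (bd_mem_wedgeSpan baseSet_closed hV')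
  exact h hx

/-- The only part of the boundary of a generator of type `U` outside the types `U` and `B`. -/
theorem bd_typeU {k b : ℕ} (hk : 2 ≤ k) (hkn : k ≤ n) (hb : b ∈ Finset.Ico 2 k) {v : ExtNil n}
    (hv : v ∈ wedgeSpan (baseSet n k)) :
    bd n (e n 1 b * v) + e n 1 k * ctr n b k v ∈
      wedgeSpan (typeU n k) ⊔ wedgeSpan (typeB n k) := by
  obtain ⟨h1, h2⟩ := Finset.mem_Ico.mp hb
  have hk' : k ∈ Finset.Ioc b n := Finset.mem_Ioc.mpr ⟨h2, hkn⟩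
  rw [bd_e_one_mul (by omega) (by omega), ← Finset.add_sum_erase _ _ hk']
  have h3 : e n 1 b * bd n v ∈ wedgeSpan (typeU n k) ⊔ wedgeSpan (typeB n k) :=
    Submodule.mem_sup_left (e_one_mul_mem_typeU hkn hb (bd_mem_wedgeSpan baseSet_closed hv))
  have h4 : ∑ c ∈ (Finset.Ioc b n).erase k, e n 1 c * ctr n b c v ∈
      wedgeSpan (typeU n k) ⊔ wedgeSpan (typeB n k) := by
    refine Submodule.sum_mem _ fun c hc => ?_
    obtain ⟨h5, h6⟩ := Finset.mem_erase.mp hc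
    obtain ⟨h7, h8⟩ := Finset.mem_Ioc.mp h6
    exact e_one_mul_mem_typeU_union_typeB hk hkn (by omega) h5 h8 (ctr_mem_baseSet h5 hv)
  have h5 := Submodule.sub_mem _ (Submodule.neg_mem _ h4) h3
  convert h5 using 1
  abel

/-- The subtracted product is the summand b = k of τ, of type A; the summands with b < k have type
U. -/
theorem tau_mem {k : ℕ} (hk : 2 ≤ k) (hkn : k ≤ n) {a : ℕ} (ha : a ∈ Finset.Ioc k n)
    {v : ExtNil n} (hv : v ∈ wedgeSpan (baseSet n k)) :
    tau n k (e n 1 a * v) - e n 1 k * (e n k a * v) ∈ wedgeSpan (typeU n k) := by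
  obtain ⟨h1, h2⟩ := Finset.mem_Ioc.mp ha
  rw [tau_e_one_mul hk (wedgeSpan_mono baseSet_subset_noRow_one hv) ha,
    ← Finset.Ico_insert_right hk, Finset.sum_insert (by simp), add_sub_cancel_left]
  refine Submodule.sum_mem _ fun b hb => e_one_mul_mem_typeU hkn hb ?_
  obtain ⟨h3, h4⟩ := Finset.mem_Ico.mp hb
  exact e_mul_mem_baseSet (by omega) (by omega) (by omega) (by omega) h2 hv

theorem contraction_eq_zero_of_typeB {k : ℕ} (hk : 2 ≤ k) (hkn : k ≤ n) {x : ExtNil n}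
    (hx : x ∈ wedgeSpan (typeB n k)) : contraction n k x = 0 := by
  have h : wedgeSpan (typeB n k) ≤ LinearMap.ker (contraction n k) := by
    refine wedgeSpan_typeB_le fun a ha V hV => ?_
    have h1 := Finset.mem_Ioc.mp ha
    rw [LinearMap.mem_ker, contraction_e_one_mul hk hkn
      (wedge_mem_wedgeSpan (baseSet_subset_noRow_one hV)), if_neg (by omega)]
  exact h hx

theorem contraction_eq_zero_of_typeU {k : ℕ} (hk : 2 ≤ k) (hkn : k ≤ n) {x : ExtNil n}
    (hx : x ∈ wedgeSpan (typeU n k)) : contraction n k x = 0 := by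
  have h : wedgeSpan (typeU n k) ≤ LinearMap.ker (contraction n k) := by
    refine wedgeSpan_typeU_le fun a ha V hV => ?_
    have h1 := Finset.mem_Ico.mp ha
    rw [LinearMap.mem_ker, contraction_e_one_mul hk hkn
      (wedge_mem_wedgeSpan (baseSet_subset_noRow_one hV)), if_neg (by omega)]
  exact h hx

/-- The U-part of τ is killed by h. On the part `e_{1k} e_{ka} e_V`, h multiplies by some `e_{bk}`
that already divides `e_V`. -/
theorem contraction_tau {k : ℕ} (hk : 2 ≤ k) (hkn : k ≤ n) {x : ExtNil n}
    (hx : x ∈ wedgeSpan (typeB n k)) : contraction n k (tau n k x) = 0 := by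
  have h : wedgeSpan (typeB n k) ≤ LinearMap.ker (contraction n k ∘ₗ tau n k) := by
    refine wedgeSpan_typeB_le fun a ha V hV => ?_
    obtain ⟨h1, h2⟩ := Finset.mem_Ioc.mp ha
    have hV' := wedge_mem_wedgeSpan hV
    have h3 := wedge_mem_wedgeSpan (baseSet_subset_noRow_one hV)
    have h4 := contraction_eq_zero_of_typeU hk hkn (tau_mem hk hkn ha hV')
    rw [map_sub, sub_eq_zero] at h4
    rw [LinearMap.mem_ker, LinearMap.comp_apply, h4, contraction_e_one_mul hk hkn
      (e_mul_mem_noRow (by omega) (by omega) h1 h2 h3), if_pos rfl, neg_eq_zero]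
    refine Finset.sum_eq_zero fun b hb => ?_
    rw [e_mul_left_comm b k k a, e_mul_wedge_baseSet hV hb]
    simp
  exact h hx

theorem mergeOp_eq_zero_of_typeB {k : ℕ} (hk : 2 ≤ k) (hkn : k ≤ n) {x : ExtNil n}
    (hx : x ∈ wedgeSpan (typeB n k)) : mergeOp n k x = 0 := by
  have h : wedgeSpan (typeB n k) ≤ LinearMap.ker (mergeOp n k) := by
    refine wedgeSpan_typeB_le fun a ha V hV => ?_
    have h1 := Finset.mem_Ioc.mp ha
    rw [LinearMap.mem_ker, mergeOp_apply, ctr_one_e_one_mul (by omega) hkn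
      (wedge_mem_wedgeSpan (baseSet_subset_noRow_one hV)), if_neg (by omega)]
    simp
  exact h hx

theorem mergeOp_eq_zero_of_typeU {k : ℕ} (hk : 2 ≤ k) (hkn : k ≤ n) {x : ExtNil n}
    (hx : x ∈ wedgeSpan (typeU n k)) : mergeOp n k x = 0 := by
  have h : wedgeSpan (typeU n k) ≤ LinearMap.ker (mergeOp n k) := by
    refine wedgeSpan_typeU_le fun a ha V hV => ?_
    have h1 := Finset.mem_Ico.mp ha
    rw [LinearMap.mem_ker, mergeOp_apply, ctr_one_e_one_mul (by omega) hkn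
      (wedge_mem_wedgeSpan (baseSet_subset_noRow_one hV)), if_neg (by omega)]
    simp
  exact h hx

/-- Only the A-part of τ contains `e_{1k}`, and merging `e_{1k} e_{ka}` undoes it. As `mergeOp`
vanishes on B, this makes τ injective on B and the sum τ(B) + B direct. -/
theorem mergeOp_tau {k : ℕ} (hk : 2 ≤ k) (hkn : k ≤ n) {x : ExtNil n}
    (hx : x ∈ wedgeSpan (typeB n k)) : mergeOp n k (tau n k x) = x := by
  have h : wedgeSpan (typeB n k) ≤ LinearMap.eqLocus (mergeOp n k ∘ₗ tau n k) LinearMap.id := by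
    refine wedgeSpan_typeB_le fun a ha V hV => ?_
    obtain ⟨h1, h2⟩ := Finset.mem_Ioc.mp ha
    have hV' := wedge_mem_wedgeSpan hV
    have h3 := wedge_mem_wedgeSpan (baseSet_subset_noRow_one hV)
    have h4 := mergeOp_eq_zero_of_typeU hk hkn (tau_mem hk hkn ha hV')
    rw [map_sub, sub_eq_zero] at h4
    have h6 : ∀ c, ctr n k c (wedge n V) = 0 := fun c =>
      ctr_eq_zero_of_noRow (wedge_mem_wedgeSpan (baseSet_subset_noRow hV))
    rw [LinearMap.mem_eqLocus, LinearMap.comp_apply, LinearMap.id_apply, h4, mergeOp_apply,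
      ctr_one_e_one_mul (by omega) hkn (e_mul_mem_noRow (by omega) (by omega) h1 h2 h3),
      if_pos rfl, Finset.sum_eq_single a]
    · rw [ctr_e_mul_self (by omega) h1 h2, h6, mul_zero, sub_zero]
    · intro c hc hca
      rw [ctr_e_mul_of_ne (Or.inr hca), h6]
      simp
    · exact fun h => absurd ha h
  exact h hx

/-- By `bd_typeU`, h sees only the D-part `-e_{1k} ctr_{ak} e_V`. Replacing `e_{1k}` by `-e_{1b}
e_{bk}` gives zero for b ≠ a, since (b,k) is still present, and restores the generator for b = a. -/
theorem contraction_bd_typeU {k : ℕ} (hk : 2 ≤ k) (hkn : k ≤ n) {x : ExtNil n}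
    (hx : x ∈ wedgeSpan (typeU n k)) : contraction n k (bd n x) = x := by
  have h : wedgeSpan (typeU n k) ≤
      LinearMap.eqLocus (contraction n k ∘ₗ bd n) LinearMap.id := by
    refine wedgeSpan_typeU_le fun a ha V hV => ?_
    obtain ⟨h1, h2⟩ := Finset.mem_Ico.mp ha
    have hV' := wedge_mem_wedgeSpan hV
    have h3 := wedge_mem_wedgeSpan (baseSet_subset_noRow_one hV)
    obtain ⟨y, hy, z, hz, hyz⟩ := Submodule.mem_sup.mp (bd_typeU hk hkn ha hV')
    have h4 : contraction n k (bd n (e n 1 a * wedge n V) +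
        e n 1 k * ctr n a k (wedge n V)) = 0 := by
      rw [← hyz, map_add, contraction_eq_zero_of_typeU hk hkn hy,
        contraction_eq_zero_of_typeB hk hkn hz, add_zero]
    rw [map_add, contraction_e_one_mul hk hkn (ctr_mem_noRow h3), if_pos rfl,
      Finset.sum_eq_single a, e_mul_ctr_wedge (hV.2 a ha), add_neg_eq_zero] at h4
    · exact h4
    · intro b hb hba
      -- Contracting the zero product `e_{bk} e_V` shows that `e_{bk}` also kills the contraction of
      -- `e_V` at (a,k).
      have h5 : ctr n a k (e n b k * wedge n V) = -(e n b k * ctr n a k (wedge n V)) :=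
        ctr_e_mul_of_ne (Or.inl hba.symm) _
      rw [e_mul_wedge_baseSet hV hb, map_zero] at h5
      rw [neg_eq_zero.mp h5.symm, mul_zero]
    · exact fun h => absurd ha h
  exact h hx

/-- Only the missing entry (b,k) contributes to h, which gives, up to sign, the U-partner; by
`bd_typeU`, the D-part of its boundary is the given element. -/
theorem typeD_sub_bd_contraction {k : ℕ} (hk : 2 ≤ k) (hkn : k ≤ n) {x : ExtNil n}
    (hx : x ∈ wedgeSpan (typeD n k)) :
    x - bd n (contraction n k x) ∈ wedgeSpan (typeU n k) ⊔ wedgeSpan (typeB n k) := by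
  have h : wedgeSpan (typeD n k) ≤ (wedgeSpan (typeU n k) ⊔ wedgeSpan (typeB n k)).comap
      (LinearMap.id - bd n ∘ₗ contraction n k) := by
    refine wedgeSpan_le ?_
    rintro _ ⟨p, V, hV, q, hq, hp1, hp2, hq2, rfl⟩
    have hVq : V.erase q ∈ noRow n 1 :=
      fun r hr => (hV.1 r (Finset.mem_of_mem_erase hr)).1
    have h3 := wedge_mem_wedgeSpan hVq
    have hq1 : q.left ∈ Finset.Ico 2 k := by
      have h4 := q.left_pos
      have h5 := (hV.1 q hq).1
      have h6 := q.left_lt_right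
      exact Finset.mem_Ico.mpr ⟨by omega, by omega⟩
    have hc : contraction n k (e n 1 k * wedge n (V.erase q)) =
        -(e n 1 q.left * (e n q.left k * wedge n (V.erase q))) := by
      rw [contraction_e_one_mul hk hkn h3, if_pos rfl, Finset.sum_eq_single q.left]
      · intro b hb hbq
        obtain ⟨r, hr, hr1, hr2⟩ := hV.2 b hb
        rw [e_mul_wedge_of_hasPair ⟨r, Finset.mem_erase.mpr ⟨?_, hr⟩, hr1, hr2⟩, mul_zero]
        rintro rfl
        exact hbq hr1.symm
      · exact fun h => absurd hq1 h
    have hv : e n q.left k * wedge n (V.erase q) ∈ wedgeSpan (baseSet n k) := by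
      have h4 := wedge_mem_wedgeSpan hV
      have h5 := e_mul_wedge_of_notMem (Finset.notMem_erase q V)
      rw [Finset.insert_erase hq, hq2] at h5
      rcases h5 with h5 | h5 <;> rw [h5]
      · exact h4
      · exact Submodule.neg_mem _ h4
    have h5 := bd_typeU hk hkn hq1 hv
    have h6 : ctr n q.left k (wedge n (V.erase q)) = 0 := by
      refine ctr_wedge_of_not_hasPair ?_
      rintro ⟨r, hr, hr1, hr2⟩
      exact Finset.ne_of_mem_erase hr (Pair.ext_iff'.mpr ⟨hr1, hr2.trans hq2.symm⟩)
    obtain ⟨h7, h8⟩ := Finset.mem_Ico.mp hq1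
    rw [ctr_e_mul_self (by omega) h8 hkn, h6, mul_zero, sub_zero] at h5
    rw [wedge_insert_one hp1 hVq, hp2, Submodule.mem_comap, LinearMap.sub_apply,
      LinearMap.comp_apply, LinearMap.id_apply, hc, map_neg, sub_neg_eq_add, add_comm]
    exact h5
  exact h hx

/-- Visible from the closed form: each term contains some `e_{1c}` with c > k, and column `k` stays
untouched. -/
theorem bd_tau_add_tau_bd_mem {k : ℕ} (hk : 2 ≤ k) {x : ExtNil n}
    (hx : x ∈ wedgeSpan (typeB n k)) :
    bd n (tau n k x) + tau n k (bd n x) ∈ wedgeSpan (typeB n k) := by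
  have h : wedgeSpan (typeB n k) ≤ (wedgeSpan (typeB n k)).comap
      (bd n ∘ₗ tau n k + tau n k ∘ₗ bd n) := by
    refine wedgeSpan_typeB_le fun a ha V hV => ?_
    obtain ⟨h1, h2⟩ := Finset.mem_Ioc.mp ha
    have hV' := wedge_mem_wedgeSpan hV
    have h3 := wedge_mem_wedgeSpan (baseSet_subset_noRow_one hV)
    rw [Submodule.mem_comap, LinearMap.add_apply, LinearMap.comp_apply, LinearMap.comp_apply,
      bd_tau_add_tau_bd hk h3 (wedge_mem_wedgeSpan (baseSet_subset_noRow hV)) ha]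
    refine Submodule.sub_mem _ (Submodule.neg_mem _ (Submodule.smul_mem _ _
      (e_one_mul_mem_typeB hk ha hV'))) (Submodule.sum_mem _ fun b hb =>
        Submodule.sum_mem _ fun c hc => ?_)
    obtain ⟨h3, h4⟩ := Finset.mem_Ico.mp hb
    have h5 := Finset.mem_Ioc.mp hc
    rw [e_mul_left_comm]
    exact Submodule.neg_mem _ (e_one_mul_mem_typeB hk hc (e_mul_mem_baseSet (by omega) (by omega)
      (by omega) (by omega) h2 (ctr_mem_baseSet (by omega) hV')))
  exact h hx

end Types

/-! ### Every generator has one of the four types. -/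

section Classification

variable {n : ℕ}

theorem card_filter_right (k : ℕ) (M : Finset (Pair n)) :
    (M.filter fun p => p.right = k).card =
      ((Finset.Ico 1 k).filter fun b => HasPair M b k).card := by
  refine Finset.card_bij (fun p _ => p.left) ?_ ?_ ?_
  · intro p hp
    obtain ⟨h1, h2⟩ := Finset.mem_filter.mp hp
    refine Finset.mem_filter.mpr ⟨Finset.mem_Ico.mpr ⟨p.left_pos, ?_⟩, p, h1, rfl, h2⟩
    exact h2 ▸ p.left_lt_right
  · intro p hp q hq h
    exact Pair.ext_iff'.mpr
      ⟨h, (Finset.mem_filter.mp hp).2.trans (Finset.mem_filter.mp hq).2.symm⟩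
  · intro b hb
    obtain ⟨p, hp, h1, h2⟩ := (Finset.mem_filter.mp hb).2
    exact ⟨p, Finset.mem_filter.mpr ⟨hp, h2⟩, h1⟩

theorem card_filter_right_add_card_filter_not_hasPair (k : ℕ) (M : Finset (Pair n)) :
    (M.filter fun p => p.right = k).card +
      ((Finset.Ico 1 k).filter fun b => ¬HasPair M b k).card = k - 1 := by
  rw [card_filter_right, Finset.card_filter_add_card_filter_not, Nat.card_Ico]

theorem weight_one (M : Finset (Pair n)) :
    weight M 1 = 1 + (M.filter fun p => p.left = 1).card := by
  rw [weight, Finset.card_eq_zero.mpr]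
  · push_cast
    ring
  · refine Finset.filter_eq_empty_iff.mpr fun p _ h => ?_
    have h1 := p.left_pos
    have h2 := p.left_lt_right
    omega

theorem gens_unique_one {w : ℕ → ℤ} (hn : 1 ≤ n) (hw1 : w 1 = 2) {M : Finset (Pair n)}
    (hM : M ∈ gens n w) : ∃ p ∈ M, p.left = 1 ∧ ∀ q ∈ M, q.left = 1 → q = p := by
  have h1 := hM 1 (Finset.mem_Icc.mpr ⟨le_rfl, hn⟩)
  rw [weight_one, hw1] at h1
  obtain ⟨p, hp⟩ := Finset.card_eq_one.mp (by omega : (M.filter fun p => p.left = 1).card = 1)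
  have h2 : ∀ q, q ∈ M ∧ q.left = 1 ↔ q = p := fun q => by
    simpa only [Finset.mem_filter, Finset.mem_singleton] using Finset.ext_iff.mp hp q
  exact ⟨p, ((h2 p).mpr rfl).1, ((h2 p).mpr rfl).2, fun q hq hq1 => (h2 q).mp ⟨hq, hq1⟩⟩

/-- The equation `w k = 2` says that the number of entries of row `k` plus the number of missing
entries of column `k` is one. -/
theorem gens_subset {w : ℕ → ℤ} {k : ℕ} (hk : 2 ≤ k) (hkn : k ≤ n) (hw1 : w 1 = 2)
    (hwk : w k = 2) : gens n w ⊆ (typeA n k ∪ typeB n k) ∪ (typeU n k ∪ typeD n k) := by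
  intro M hM
  obtain ⟨p, hp, hp1, hpu⟩ := gens_unique_one (by omega) hw1 hM
  have hpr := p.left_lt_right
  have h1 := hM k (Finset.mem_Icc.mpr ⟨by omega, hkn⟩)
  have h2 := card_filter_right_add_card_filter_not_hasPair k M
  rw [weight, hwk] at h1
  have hMp : insert p (M.erase p) = M := Finset.insert_erase hp
  have hrow1 : ∀ q ∈ M.erase p, q.left ≠ 1 := fun q hq hq1 =>
    Finset.ne_of_mem_erase hq (hpu q (Finset.mem_of_mem_erase hq) hq1)
  rcases Nat.eq_zero_or_pos (M.filter fun p => p.left = k).card with h3 | h3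
  · have hrowk : ∀ q ∈ M, q.left ≠ k := fun q hq hqk =>
      (Finset.filter_eq_empty_iff.mp (Finset.card_eq_zero.mp h3)) hq hqk
    obtain ⟨b, hb⟩ := Finset.card_eq_one.mp
      (by omega : ((Finset.Ico 1 k).filter fun b => ¬HasPair M b k).card = 1)
    have h4 : ∀ c, c ∈ Finset.Ico 1 k ∧ ¬HasPair M c k ↔ c = b := fun c => by
      simpa only [Finset.mem_filter, Finset.mem_singleton] using Finset.ext_iff.mp hb c
    obtain ⟨hb1, hb2⟩ := (h4 b).mpr rfl
    have hb1' := Finset.mem_Ico.mp hb1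
    have h5 : ∀ c ∈ Finset.Ico 1 k, c ≠ b → HasPair M c k := fun c hc hcb => by
      by_contra h
      exact hcb ((h4 c).mp ⟨hc, h⟩)
    -- Row `k` is empty and (b,k) is the missing entry. If b = 1, the entry of row 1 lies on either
    -- side of column `k`: types U and B. Otherwise (1,k) is present: type D.
    by_cases hb0 : b = 1
    · have hpk : p.right ≠ k := fun h => hb2 ⟨p, hp, hp1.trans hb0.symm, h⟩
      have hV : M.erase p ∈ baseSet n k := by
        refine ⟨fun q hq => ⟨hrow1 q hq, hrowk q (Finset.mem_of_mem_erase hq)⟩, fun c hc => ?_⟩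
        have hc' := Finset.mem_Ico.mp hc
        obtain ⟨q, hq, hq1, hq2⟩ := h5 c (Finset.mem_Ico.mpr ⟨by omega, by omega⟩) (by omega)
        refine ⟨q, Finset.mem_erase.mpr ⟨?_, hq⟩, hq1, hq2⟩
        rintro rfl
        omega
      rcases lt_or_gt_of_ne hpk with h | h
      · exact Or.inr (Or.inl ⟨p, _, hV, hp1, h, hMp.symm⟩)
      · exact Or.inl (Or.inr ⟨p, _, hV, hp1, h, hMp.symm⟩)
    · have hpk : p.right = k := by
        obtain ⟨q, hq, hq1, hq2⟩ := h5 1 (Finset.mem_Ico.mpr ⟨by omega, by omega⟩) (by omega)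
        rw [← hpu q hq hq1, hq2]
      obtain ⟨r, hr1, hr2⟩ := Pair.exists_mk (n := n) hb1'.1 hb1'.2 hkn
      have hr : r ∉ M.erase p := fun h => hb2 ⟨r, Finset.mem_of_mem_erase h, hr1, hr2⟩
      -- The set V of the definition of type D is obtained by restoring the missing pair `r` =
      -- (b,k).
      refine Or.inr (Or.inr ⟨p, insert r (M.erase p), ⟨?_, ?_⟩, r,
        Finset.mem_insert_self _ _, hp1, hpk, hr2, ?_⟩)
      · intro q hq
        rcases Finset.mem_insert.mp hq with rfl | hq
        · omega
        · exact ⟨hrow1 q hq, hrowk q (Finset.mem_of_mem_erase hq)⟩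
      · intro c hc
        have hc' := Finset.mem_Ico.mp hc
        by_cases hcb : c = b
        · exact ⟨r, Finset.mem_insert_self _ _, hr1.trans hcb.symm, hr2⟩
        · obtain ⟨q, hq, hq1, hq2⟩ := h5 c (Finset.mem_Ico.mpr ⟨by omega, by omega⟩) hcb
          refine ⟨q, Finset.mem_insert_of_mem (Finset.mem_erase.mpr ⟨?_, hq⟩), hq1, hq2⟩
          rintro rfl
          omega
      · rw [Finset.erase_insert hr, hMp]
  · have h4 : (M.filter fun p => p.left = k).card = 1 ∧
        ((Finset.Ico 1 k).filter fun b => ¬HasPair M b k).card = 0 := by omega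
    obtain ⟨q, hq⟩ := Finset.card_eq_one.mp h4.1
    have h5 : ∀ r, r ∈ M ∧ r.left = k ↔ r = q := fun r => by
      simpa only [Finset.mem_filter, Finset.mem_singleton] using Finset.ext_iff.mp hq r
    obtain ⟨hqM, hqk⟩ := (h5 q).mpr rfl
    have h6 : ∀ c ∈ Finset.Ico 1 k, HasPair M c k := fun c hc =>
      not_not.mp (Finset.filter_eq_empty_iff.mp (Finset.card_eq_zero.mp h4.2) hc)
    have hpk : p.right = k := by
      obtain ⟨r, hr, hr1, hr2⟩ := h6 1 (Finset.mem_Ico.mpr ⟨by omega, by omega⟩)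
      rw [← hpu r hr hr1, hr2]
    have hqp : q ≠ p := by
      rintro rfl
      omega
    refine Or.inl (Or.inl ⟨p, q, (M.erase p).erase q, ⟨?_, ?_⟩, hp1, hpk, hqk, ?_⟩)
    · intro r hr
      have hr' := Finset.mem_of_mem_erase hr
      exact ⟨hrow1 r hr', fun h => Finset.ne_of_mem_erase hr
        ((h5 r).mp ⟨Finset.mem_of_mem_erase hr', h⟩)⟩
    · intro c hc
      have hc' := Finset.mem_Ico.mp hc
      obtain ⟨r, hr, hr1, hr2⟩ := h6 c (Finset.mem_Ico.mpr ⟨by omega, by omega⟩)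
      refine ⟨r, Finset.mem_erase.mpr ⟨?_, Finset.mem_erase.mpr ⟨?_, hr⟩⟩, hr1, hr2⟩
      · rintro rfl
        have := r.left_lt_right
        omega
      · rintro rfl
        omega
    · rw [Finset.insert_erase (Finset.mem_erase.mpr ⟨hqp, hqM⟩), hMp]

/-- Row 1 has a single entry, and type B is the only type in which it lies to the right of column
`k`. -/
theorem filtGens_eq {w : ℕ → ℤ} {k : ℕ} (hk : 2 ≤ k) (hkn : k ≤ n) (hw1 : w 1 = 2)
    (hwk : w k = 2) : filtGens n w (k + 1) = typeB n k ∩ gens n w := by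
  ext M
  constructor
  · rintro ⟨hM, r, hr, hr1, hrk⟩
    refine ⟨?_, hM⟩
    obtain ⟨s, hs, hs1, hsu⟩ := gens_unique_one (by omega) hw1 hM
    have hrs := hsu r hr hr1
    rcases gens_subset hk hkn hw1 hwk hM with (h | h) | (h | h)
    · obtain ⟨p, q, V, hV, hp1, hp2, hq1, rfl⟩ := h
      have hps := hsu p (by simp) hp1
      rw [hrs, ← hps] at hrk
      omega
    · exact h
    · obtain ⟨p, V, hV, hp1, hp2, rfl⟩ := h
      have hps := hsu p (by simp) hp1
      rw [hrs, ← hps] at hrk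
      omega
    · obtain ⟨p, V, hV, q, hq, hp1, hp2, hq1, rfl⟩ := h
      have hps := hsu p (by simp) hp1
      rw [hrs, ← hps] at hrk
      omega
  · rintro ⟨⟨p, V, hV, hp1, hp2, rfl⟩, hM⟩
    exact ⟨hM, p, by simp, hp1, hp2⟩

end Classification

end NilTorsion

namespace NilTorsion

/-! ### Homology of complexes of modules in terms of elements. -/

section Homology

open CategoryTheory HomologicalComplex

theorem exists_homologyπ_eq (K : ChainComplex (ModuleCat ℤ) ℤ) {j : ℤ} (x : K.homology j) :
    ∃ z : K.cycles j, K.homologyπ j z = x :=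
  (ModuleCat.epi_iff_surjective _).mp inferInstance x

theorem iCycles_injective (K : ChainComplex (ModuleCat ℤ) ℤ) (j : ℤ) :
    Function.Injective (K.iCycles j) :=
  (ModuleCat.mono_iff_injective _).mp inferInstance

theorem exists_iCycles_eq (K : ChainComplex (ModuleCat ℤ) ℤ) {j : ℤ} (x : K.X j)
    (hx : K.d j (j - 1) x = 0) : ∃ z : K.cycles j, K.iCycles j z = x := by
  have h := ShortComplex.exact_of_f_is_kernel
    (ShortComplex.mk (K.iCycles j) (K.d j (j - 1)) (by simp))
    (K.cyclesIsKernel j (j - 1) (ChainComplex.next ℤ j))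
  exact (ShortComplex.moduleCat_exact_iff _).mp h x hx

theorem exists_toCycles_eq (K : ChainComplex (ModuleCat ℤ) ℤ) {j : ℤ} (z : K.cycles j)
    (hz : K.homologyπ j z = 0) : ∃ x : K.X (j + 1), K.toCycles (j + 1) j x = z := by
  have h := ShortComplex.exact_of_g_is_cokernel
    (ShortComplex.mk (K.toCycles (j + 1) j) (K.homologyπ j) (by simp))
    (K.homologyIsCokernel (j + 1) j (ChainComplex.prev ℤ j))
  exact (ShortComplex.moduleCat_exact_iff _).mp h z hz

/-- A criterion for a chain map of complexes of modules to be an isomorphism on homology. -/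
theorem isIso_homologyMap_of_elements {K L : ChainComplex (ModuleCat ℤ) ℤ} (f : K ⟶ L) (j : ℤ)
    (surj : ∀ z : L.X j, L.d j (j - 1) z = 0 → ∃ (c : K.X j) (x : L.X (j + 1)),
      K.d j (j - 1) c = 0 ∧ z = f.f j c + L.d (j + 1) j x)
    (inj : ∀ (c : K.X j) (x : L.X (j + 1)), K.d j (j - 1) c = 0 →
      f.f j c = L.d (j + 1) j x → ∃ c' : K.X (j + 1), c = K.d (j + 1) j c') :
    IsIso (homologyMap f j) := by
  have hcomm : ∀ z : K.cycles j,
      homologyMap f j (K.homologyπ j z) = L.homologyπ j (cyclesMap f j z) := fun z => by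
    rw [← ConcreteCategory.comp_apply, ← ConcreteCategory.comp_apply, homologyπ_naturality]
  have hi : ∀ z : K.cycles j, L.iCycles j (cyclesMap f j z) = f.f j (K.iCycles j z) := fun z => by
    rw [← ConcreteCategory.comp_apply, ← ConcreteCategory.comp_apply, cyclesMap_i]
  have hto : ∀ (K : ChainComplex (ModuleCat ℤ) ℤ) (x : K.X (j + 1)),
      K.iCycles j (K.toCycles (j + 1) j x) = K.d (j + 1) j x := fun K x => by
    rw [← ConcreteCategory.comp_apply, toCycles_i]
  have hto' : ∀ (K : ChainComplex (ModuleCat ℤ) ℤ) (x : K.X (j + 1)),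
      K.homologyπ j (K.toCycles (j + 1) j x) = 0 := fun K x => by
    rw [← ConcreteCategory.comp_apply, toCycles_comp_homologyπ]
    rfl
  have hid : ∀ (K : ChainComplex (ModuleCat ℤ) ℤ) (z : K.cycles j),
      K.d j (j - 1) (K.iCycles j z) = 0 := fun K z => by
    rw [← ConcreteCategory.comp_apply, iCycles_d]
    rfl
  have h1 : Mono (homologyMap f j) := by
    rw [ModuleCat.mono_iff_injective, injective_iff_map_eq_zero]
    intro x hx
    obtain ⟨z, rfl⟩ := exists_homologyπ_eq K x
    rw [hcomm] at hx
    obtain ⟨y, hy⟩ := exists_toCycles_eq L _ hx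
    obtain ⟨c, hc⟩ := inj (K.iCycles j z) y (hid K z) (by rw [← hi, ← hy, hto])
    have h2 : z = K.toCycles (j + 1) j c := iCycles_injective K j (by rw [hto, hc])
    rw [h2, hto']
  have h2 : Epi (homologyMap f j) := by
    rw [ModuleCat.epi_iff_surjective]
    intro x
    obtain ⟨z, rfl⟩ := exists_homologyπ_eq L x
    obtain ⟨c, y, hc, hy⟩ := surj (L.iCycles j z) (hid L z)
    obtain ⟨c, rfl⟩ := exists_iCycles_eq K c hc
    refine ⟨K.homologyπ j c, ?_⟩
    have h3 : z = cyclesMap f j c + L.toCycles (j + 1) j y :=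
      iCycles_injective L j (by rw [map_add, hi, hto, hy])
    rw [hcomm, h3, map_add, hto', add_zero]
  exact isIso_of_mono_of_epi _

theorem exists_homotopyCofiber_eq {G : ChainComplex (ModuleCat ℤ) ℤ} (φ : G ⟶ G) {i j : ℤ}
    (hij : (ComplexShape.down ℤ).Rel j i) (c : (homotopyCofiber φ).X j) :
    ∃ (x : G.X i) (y : G.X j), c = homotopyCofiber.inlX φ i j hij x +
      homotopyCofiber.inrX φ j y := by
  have h : homotopyCofiber.fstX φ j i hij ≫ homotopyCofiber.inlX φ i j hij +
      homotopyCofiber.sndX φ j ≫ homotopyCofiber.inrX φ j = 𝟙 _ := by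
    apply homotopyCofiber.ext_to_X φ j i hij <;>
      simp only [Preadditive.add_comp, Category.assoc, homotopyCofiber.inlX_fstX,
        homotopyCofiber.inlX_sndX, homotopyCofiber.inrX_fstX, homotopyCofiber.inrX_sndX,
        Limits.comp_zero, Category.comp_id, Category.id_comp, add_zero, zero_add]
  refine ⟨homotopyCofiber.fstX φ j i hij c, homotopyCofiber.sndX φ j c, ?_⟩
  have h2 := ConcreteCategory.congr_hom h c
  exact h2.symm

end Homology

/-! ### The retraction of ⟦w⟧ and the comparison with the cone. -/

section Cone

open CategoryTheory HomologicalComplex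

variable {n : ℕ}

/-- The inclusion of a term of a subcomplex in the exterior algebra. -/
noncomputable def subcomplexVal {S : Set (Finset (Pair n))} {hS : ClosedUnderBoundary S} {j : ℤ} :
    (subcomplex S hS).X j →ₗ[ℤ] ExtNil n := (spanDeg S j).subtype

theorem subcomplexVal_injective {S : Set (Finset (Pair n))} {hS : ClosedUnderBoundary S} {j : ℤ} :
    Function.Injective (subcomplexVal (S := S) (hS := hS) (j := j)) := Subtype.val_injective

theorem subcomplexVal_mem {S : Set (Finset (Pair n))} {hS : ClosedUnderBoundary S} {j : ℤ}
    (x : (subcomplex S hS).X j) : subcomplexVal x ∈ spanDeg S j :=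
  Subtype.property (p := fun y => y ∈ spanDeg S j) x

theorem exists_subcomplexVal_eq {S : Set (Finset (Pair n))} (hS : ClosedUnderBoundary S) {j : ℤ}
    {x : ExtNil n} (hx : x ∈ spanDeg S j) :
    ∃ y : (subcomplex S hS).X j, subcomplexVal y = x := ⟨(⟨x, hx⟩ : spanDeg S j), rfl⟩

theorem subcomplexVal_d {S : Set (Finset (Pair n))} {hS : ClosedUnderBoundary S} {i j : ℤ}
    (hij : j + 1 = i) (x : (subcomplex S hS).X i) :
    subcomplexVal ((subcomplex S hS).d i j x) = bd n (subcomplexVal x) := by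
  simp only [subcomplex, dif_pos hij]
  rfl

theorem contraction_mem_spanDeg {w : ℕ → ℤ} {k : ℕ} (hkn : k ≤ n) {j : ℤ}
    {x : ExtNil n} (hx : x ∈ spanDeg (gens n w) j) :
    contraction n k x ∈ spanDeg (gens n w) (j + 1) := by
  rw [contraction, LinearMap.neg_apply, LinearMap.sum_apply]
  refine Submodule.neg_mem _ (Submodule.sum_mem _ fun b hb => ?_)
  have h := Finset.mem_Ico.mp hb
  exact splitOp_mem_spanDeg le_rfl (by omega) h.2 hkn hx

theorem tau_mem_spanDeg {w : ℕ → ℤ} {k : ℕ} {j : ℤ}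
    {x : ExtNil n} (hx : x ∈ spanDeg (gens n w) j) :
    tau n k x ∈ spanDeg (gens n w) (j + 1) := by
  rw [tau, LinearMap.sum_apply]
  refine Submodule.sum_mem _ fun c hc => ?_
  rw [LinearMap.sum_apply]
  refine Submodule.sum_mem _ fun b hb => ?_
  have h := Finset.mem_Icc.mp hb
  have h' := Finset.mem_Ioc.mp hc
  exact splitOp_mem_spanDeg le_rfl (by omega) (by omega) h'.2 hx

variable (n) in
/-- The endomorphism `1 - ∂h - h∂`, where `h` is the contraction. -/
noncomputable def retraction (k : ℕ) : ExtNil n →ₗ[ℤ] ExtNil n :=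
  LinearMap.id - bd n ∘ₗ contraction n k - contraction n k ∘ₗ bd n

theorem retraction_apply (k : ℕ) (x : ExtNil n) : retraction n k x =
    x - bd n (contraction n k x) - contraction n k (bd n x) := rfl

theorem bd_bd (x : ExtNil n) : bd n (bd n x) = 0 := ChevalleyEilenberg.boundary_boundary x

theorem retraction_typeU {k : ℕ} (hk : 2 ≤ k) (hkn : k ≤ n) {x : ExtNil n}
    (hx : x ∈ wedgeSpan (typeU n k)) : retraction n k x = 0 := by
  rw [retraction_apply, contraction_eq_zero_of_typeU hk hkn hx, contraction_bd_typeU hk hkn hx,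
    map_zero, sub_zero, sub_self]

theorem retraction_typeB {k : ℕ} (hk : 2 ≤ k) (hkn : k ≤ n) {x : ExtNil n}
    (hx : x ∈ wedgeSpan (typeB n k)) : retraction n k x = x := by
  rw [retraction_apply, contraction_eq_zero_of_typeB hk hkn hx,
    contraction_eq_zero_of_typeB hk hkn (bd_mem_typeB hk hx), map_zero, sub_zero, sub_zero]

/-- Write ∂τx = φx - τ∂x: both φx and ∂x lie in the span of B, and h kills B as well as τ(B). -/
theorem retraction_tau {k : ℕ} (hk : 2 ≤ k) (hkn : k ≤ n) {x : ExtNil n}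
    (hx : x ∈ wedgeSpan (typeB n k)) : retraction n k (tau n k x) = tau n k x := by
  have h1 : bd n (tau n k x) =
      (bd n (tau n k x) + tau n k (bd n x)) - tau n k (bd n x) := by abel
  rw [retraction_apply, contraction_tau hk hkn hx, h1, map_sub,
    contraction_eq_zero_of_typeB hk hkn (bd_tau_add_tau_bd_mem hk hx),
    contraction_tau hk hkn (bd_mem_typeB hk hx), map_zero]
  simp

/-- If x - ∂hx = y + z with y in U and z in B, then ∂x = ∂y + ∂z, so h∂x = y and rx = z. -/
theorem retraction_typeD {k : ℕ} (hk : 2 ≤ k) (hkn : k ≤ n) {x : ExtNil n}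
    (hx : x ∈ wedgeSpan (typeD n k)) : retraction n k x ∈ wedgeSpan (typeB n k) := by
  obtain ⟨y, hy, z, hz, hyz⟩ := Submodule.mem_sup.mp (typeD_sub_bd_contraction hk hkn hx)
  have h1 : bd n x = bd n y + bd n z := by
    rw [← map_add, hyz, map_sub, bd_bd, sub_zero]
  rw [retraction_apply, ← hyz, h1, map_add, contraction_bd_typeU hk hkn hy,
    contraction_eq_zero_of_typeB hk hkn (bd_mem_typeB hk hz), add_zero, add_sub_cancel_left]
  exact hz

theorem retraction_mem_spanDeg {w : ℕ → ℤ} {k : ℕ} (hkn : k ≤ n) {j : ℤ}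
    {x : ExtNil n} (hx : x ∈ spanDeg (gens n w) j) :
    retraction n k x ∈ spanDeg (gens n w) j := by
  rw [retraction_apply]
  refine Submodule.sub_mem _ (Submodule.sub_mem _ hx ?_) ?_
  · exact bd_mem_spanDeg (gens_closed n w) rfl _ (contraction_mem_spanDeg hkn hx)
  · have h1 := bd_mem_spanDeg (gens_closed n w) (sub_add_cancel j 1) x hx
    have h2 := contraction_mem_spanDeg (k := k) hkn h1
    rwa [sub_add_cancel] at h2

theorem spanDeg_filtGens {w : ℕ → ℤ} {k : ℕ} (hk : 2 ≤ k) (hkn : k ≤ n) (hw1 : w 1 = 2)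
    (hwk : w k = 2) (j : ℤ) (x : ExtNil n) : x ∈ spanDeg (filtGens n w (k + 1)) j ↔
      x ∈ wedgeSpan (typeB n k) ∧ x ∈ spanDeg (gens n w) j := by
  rw [spanDeg_eq, filtGens_eq hk hkn hw1 hwk, Set.inter_assoc, mem_wedgeSpan_inter, spanDeg_eq]

/-- Merging `e_{1k} e_{ka}` to `e_{1a}` keeps the weight and lowers the degree by one; τ reverses
this up to sign and up to U. -/
theorem exists_typeB_of_typeA {w : ℕ → ℤ} {k : ℕ} (hk : 2 ≤ k) (hkn : k ≤ n)
    {M : Finset (Pair n)} (hM : M ∈ gens n w) (hA : M ∈ typeA n k) :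
    ∃ x : ExtNil n, x ∈ wedgeSpan (typeB n k) ∧ x ∈ spanDeg (gens n w) (M.card - 1) ∧
      wedge n M - tau n k x ∈ wedgeSpan (typeU n k) := by
  obtain ⟨p, q, V, hV, hp1, hp2, hq1, rfl⟩ := hA
  have h : p.right = q.left := by omega
  have hr1 : (p.comp q h).left = p.left := rfl
  have hr2 : (p.comp q h).right = q.right := rfl
  have hqlr := q.left_lt_right
  have hqn := q.right_le
  have hVq : insert q V ∈ noRow n 1 := by
    intro r hr
    rcases Finset.mem_insert.mp hr with rfl | hr
    · omega
    · exact (hV.1 r hr).1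
  have hqV : q ∉ V := fun hq => (hV.1 q hq).2 hq1
  have hpV : p ∉ insert q V := fun hp => hVq p hp hp1
  have hrV : p.comp q h ∉ V := fun hr => (hV.1 _ hr).1 (hr1.trans hp1)
  have h1 : ((insert p (insert q V)).erase p).erase q = V := by
    rw [Finset.erase_insert hpV, Finset.erase_insert hqV]
  have hrg : insert (p.comp q h) V ∈ gens n w := by
    have h2 := gens_closed n w _ hM p q h (by simp) (by simp) (by rw [h1]; exact hrV)
    rwa [h1] at h2
  have ha : q.right ∈ Finset.Ioc k n := Finset.mem_Ioc.mpr ⟨by omega, hqn⟩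
  have hV' := wedge_mem_wedgeSpan hV
  have hx1 := e_one_mul_mem_typeB hk ha hV'
  have hx2 : e n 1 q.right * wedge n V ∈
      spanDeg (gens n w) ((insert p (insert q V)).card - 1) := by
    rw [← hr2, ← wedge_insert_one (hr1.trans hp1) (baseSet_subset_noRow_one hV)]
    refine wedge_mem_wedgeSpan ⟨hrg, ?_⟩
    rw [Finset.card_insert_of_notMem hrV, Finset.card_insert_of_notMem hpV,
      Finset.card_insert_of_notMem hqV]
    push_cast
    ring
  have hx3 := tau_mem hk hkn ha hV'
  rw [wedge_insert_one hp1 hVq, hp2]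
  have h4 := e_mul_wedge_of_notMem hqV
  rw [hq1] at h4
  rcases h4 with h4 | h4
  · refine ⟨_, hx1, hx2, ?_⟩
    rw [← h4, ← neg_sub]
    exact Submodule.neg_mem _ hx3
  · refine ⟨_, Submodule.neg_mem _ hx1, Submodule.neg_mem _ hx2, ?_⟩
    rw [← neg_eq_iff_eq_neg.mpr h4, map_neg, mul_neg, neg_sub_neg]
    exact hx3

/-- Checked type by type: A lies in τ(B) modulo U, B is fixed, U vanishes, and D goes into B. -/
theorem retraction_mem {w : ℕ → ℤ} {k : ℕ} (hk : 2 ≤ k) (hkn : k ≤ n) (hw1 : w 1 = 2)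
    (hwk : w k = 2) {j : ℤ} {x : ExtNil n} (hx : x ∈ spanDeg (gens n w) j) :
    retraction n k x ∈ (spanDeg (filtGens n w (k + 1)) (j - 1)).map (tau n k) ⊔
      spanDeg (filtGens n w (k + 1)) j := by
  have h : spanDeg (gens n w) j ≤ ((spanDeg (filtGens n w (k + 1)) (j - 1)).map (tau n k) ⊔
      spanDeg (filtGens n w (k + 1)) j).comap (retraction n k) := by
    refine wedgeSpan_le ?_
    rintro M ⟨hM, hMj⟩
    have hMj' : (M.card : ℤ) = j := hMj
    have hMs : wedge n M ∈ spanDeg (gens n w) j := wedge_mem_wedgeSpan ⟨hM, hMj⟩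
    rw [Submodule.mem_comap]
    rcases gens_subset hk hkn hw1 hwk hM with (h | h) | (h | h)
    · obtain ⟨x, hx1, hx2, hx3⟩ := exists_typeB_of_typeA hk hkn hM h
      have h1 := retraction_typeU hk hkn hx3
      rw [map_sub, sub_eq_zero, retraction_tau hk hkn hx1] at h1
      rw [h1]
      refine Submodule.mem_sup_left ⟨x, ?_, rfl⟩
      rw [← hMj']
      exact (spanDeg_filtGens hk hkn hw1 hwk _ x).mpr ⟨hx1, hx2⟩
    · rw [retraction_typeB hk hkn (wedge_mem_wedgeSpan h)]
      exact Submodule.mem_sup_right ((spanDeg_filtGens hk hkn hw1 hwk _ _).mpr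
        ⟨wedge_mem_wedgeSpan h, hMs⟩)
    · rw [retraction_typeU hk hkn (wedge_mem_wedgeSpan h)]
      exact Submodule.zero_mem _
    · exact Submodule.mem_sup_right ((spanDeg_filtGens hk hkn hw1 hwk _ _).mpr
        ⟨retraction_typeD hk hkn (wedge_mem_wedgeSpan h), retraction_mem_spanDeg hkn hMs⟩)
  exact h hx

/-- The homology of `⟦w⟧` is that of the cone of an endomorphism of any complex `G` with an
isomorphism `α` to the subcomplex `F_{k+1}` such that the homotopy is given by `± τ`. -/
theorem nonempty_homology_iso_cone {w : ℕ → ℤ} {k : ℕ} (hk : 2 ≤ k) (hkn : k ≤ n)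
    (hw1 : w 1 = 2) (hwk : w k = 2) {G : ChainComplex (ModuleCat ℤ) ℤ} (φ : G ⟶ G)
    (α : G ⟶ subcomplex (gens n w) (gens_closed n w)) (hα : Homotopy (φ ≫ α) 0)
    (inj : ∀ j (y : G.X j), α.f j y = 0 → y = 0)
    (mem : ∀ j (y : G.X j), subcomplexVal (α.f j y) ∈ wedgeSpan (typeB n k))
    (surj : ∀ j, ∀ x ∈ spanDeg (filtGens n w (k + 1)) j,
      ∃ y : G.X j, subcomplexVal (α.f j y) = x)
    (s : ℤ) (hs : s * s = 1)
    (hom : ∀ i j, i + 1 = j → ∀ y : G.X i,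
      subcomplexVal (hα.hom i j y) = s • tau n k (subcomplexVal (α.f i y)))
    (j : ℤ) : Nonempty ((subcomplex (gens n w) (gens_closed n w)).homology j ≅ (homotopyCofiber φ).homology j) := by
  have hrel : ∀ j : ℤ, (ComplexShape.down ℤ).Rel j (j - 1) := fun j => sub_add_cancel j 1
  -- On a pair (x, y) this is (x, y) ↦ s τ(αx) + αy.
  set f := homotopyCofiber.desc φ α hα with hf
  have hfl : ∀ i j (hij : (ComplexShape.down ℤ).Rel j i) (x : G.X i),
      f.f j (homotopyCofiber.inlX φ i j hij x) = hα.hom i j x := fun i j hij x => by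
    rw [← ConcreteCategory.comp_apply, hf, homotopyCofiber.inlX_desc_f]
  have hfr : ∀ j (x : G.X j), f.f j (homotopyCofiber.inrX φ j x) = α.f j x := fun j x => by
    rw [← ConcreteCategory.comp_apply, hf, homotopyCofiber.inrX_desc_f]
  have hfinj : ∀ j (c : (homotopyCofiber φ).X j), f.f j c = 0 → c = 0 := by
    intro j c hc
    obtain ⟨x, y, rfl⟩ := exists_homotopyCofiber_eq φ (hrel j) c
    rw [map_add, hfl, hfr] at hc
    have h1 := congrArg subcomplexVal hc
    rw [map_add, hom _ _ (sub_add_cancel j 1), map_zero] at h1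
    -- `mergeOp` kills the B-part and inverts τ, which isolates the component `x`.
    have h2 := congrArg (mergeOp n k) h1
    rw [map_add, map_smul, mergeOp_tau hk hkn (mem _ x), mergeOp_eq_zero_of_typeB hk hkn (mem _ y),
      map_zero, add_zero] at h2
    have h3 : subcomplexVal (α.f _ x) = 0 := by
      have h3 := congrArg (s • ·) h2
      simpa only [smul_smul, hs, one_smul, smul_zero] using h3
    have h4 : x = 0 := inj _ x (subcomplexVal_injective (h3.trans (map_zero _).symm))
    rw [h3, map_zero, smul_zero, zero_add] at h1
    have h5 : y = 0 := inj _ y (subcomplexVal_injective (h1.trans (map_zero _).symm))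
    rw [h4, h5, map_zero, map_zero, add_zero]
  have hfinj' : ∀ j (c c' : (homotopyCofiber φ).X j), f.f j c = f.f j c' → c = c' := by
    intro j c c' h
    rw [← sub_eq_zero]
    exact hfinj j _ (by rw [map_sub, h, sub_self])
  have hcontr : ∀ j (c : (homotopyCofiber φ).X j),
      contraction n k (subcomplexVal (f.f j c)) = 0 := by
    intro j c
    obtain ⟨x, y, rfl⟩ := exists_homotopyCofiber_eq φ (hrel j) c
    rw [map_add, hfl, hfr, map_add, hom _ _ (sub_add_cancel j 1), map_add, map_smul,
      contraction_tau hk hkn (mem _ x), contraction_eq_zero_of_typeB hk hkn (mem _ y)]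
    simp
  have hfsurj : ∀ j (z : (subcomplex (gens n w) (gens_closed n w)).X j), ∃ c : (homotopyCofiber φ).X j,
      subcomplexVal (f.f j c) = retraction n k (subcomplexVal z) := by
    intro j z
    obtain ⟨_, ⟨x, hx, rfl⟩, y, hy, hxy⟩ := Submodule.mem_sup.mp
      (retraction_mem hk hkn hw1 hwk (subcomplexVal_mem z))
    obtain ⟨x', hx'⟩ := surj _ (s • x) (Submodule.smul_mem _ s hx)
    obtain ⟨y', hy'⟩ := surj _ y hy
    refine ⟨homotopyCofiber.inlX φ _ j (hrel j) x' +
      homotopyCofiber.inrX φ j y', ?_⟩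
    rw [map_add, hfl, hfr, map_add, hom _ _ (sub_add_cancel j 1),
      hx', hy', map_smul, smul_smul, hs, one_smul, hxy]
  have hcomm : ∀ i j (c : (homotopyCofiber φ).X i),
      f.f j ((homotopyCofiber φ).d i j c) = (subcomplex (gens n w) (gens_closed n w)).d i j (f.f i c) := fun i j c => by
    rw [← ConcreteCategory.comp_apply, ← ConcreteCategory.comp_apply, f.comm]
  have hdd : ∀ i j l (x : (subcomplex (gens n w) (gens_closed n w)).X i),
      (subcomplex (gens n w) (gens_closed n w)).d j l ((subcomplex (gens n w) (gens_closed n w)).d i j x) = 0 := fun i j l x => by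
    rw [← ConcreteCategory.comp_apply, HomologicalComplex.d_comp_d]
    rfl
  have hiso : IsIso (homologyMap f j) := by
    refine isIso_homologyMap_of_elements f j ?_ ?_
    · intro z hz
      obtain ⟨c, hc⟩ := hfsurj j z
      obtain ⟨x, hx⟩ := exists_subcomplexVal_eq (gens_closed n w)
        (contraction_mem_spanDeg (k := k) hkn (subcomplexVal_mem z))
      have h1 : bd n (subcomplexVal z) = 0 := by
        have h2 := subcomplexVal_d (hS := gens_closed n w) (sub_add_cancel j 1) z
        rw [← h2]
        exact (congrArg _ hz).trans (map_zero _)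
      -- For a cycle, rz = z - ∂hz, and rz lies in the image of `f`.
      have h2 : z = f.f j c + (subcomplex (gens n w) (gens_closed n w)).d (j + 1) j x := by
        apply subcomplexVal_injective
        have h3 := subcomplexVal_d (hS := gens_closed n w) (rfl : j + 1 = j + 1) x
        rw [map_add, hc, retraction_apply, h1, map_zero, sub_zero, ← hx]
        refine Eq.trans ?_ (congrArg (_ + ·) h3.symm)
        abel
      refine ⟨c, x, ?_, h2⟩
      apply hfinj
      rw [hcomm]
      have h4 : f.f j c = z - (subcomplex (gens n w) (gens_closed n w)).d (j + 1) j x := by rw [h2]; abel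
      rw [h4, map_sub, hz, hdd, sub_zero]
    · intro c x _ hcx
      obtain ⟨c', hc'⟩ := hfsurj (j + 1) x
      obtain ⟨y, hy⟩ := exists_subcomplexVal_eq (gens_closed n w)
        (contraction_mem_spanDeg (k := k) hkn (subcomplexVal_mem x))
      -- The boundary of `x` lies in the image of `f`, which h annihilates. So rx = x - ∂hx has the
      -- same boundary as `x` and lies in the image of `f`.
      have h1 : contraction n k (bd n (subcomplexVal x)) = 0 := by
        have h2 := subcomplexVal_d (hS := gens_closed n w) (rfl : j + 1 = j + 1) x
        rw [← h2, ← hcontr j c, hcx]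
      have h2 : f.f (j + 1) c' = x - (subcomplex (gens n w) (gens_closed n w)).d (j + 1 + 1) (j + 1) y := by
        apply subcomplexVal_injective
        have h3 := subcomplexVal_d (hS := gens_closed n w) (rfl : j + 1 + 1 = j + 1 + 1) y
        rw [map_sub, hc', retraction_apply, h1, sub_zero, ← hy]
        exact congrArg (_ - ·) h3.symm
      refine ⟨c', hfinj' _ _ _ ?_⟩
      rw [hcomm, h2, map_sub, hdd, sub_zero, hcx]
  exact ⟨(asIso (homologyMap f j)).symm⟩

end Cone

end NilTorsion

namespace NilTorsion

/-! ### The null homotopy ±τ and the cone of an endomorphism of F_{k+1}. -/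

section Endomorphism

open CategoryTheory HomologicalComplex

variable {n : ℕ}

/-- The maps `x ↦ s τ(α(x))`. -/
noncomputable def tauHom {w : ℕ → ℤ} (k : ℕ) {G : ChainComplex (ModuleCat ℤ) ℤ}
    (α : G ⟶ subcomplex (gens n w) (gens_closed n w)) (s : ℤ) (i j : ℤ) :
    G.X i ⟶ (subcomplex (gens n w) (gens_closed n w)).X j :=
  if h : i + 1 = j then
    ModuleCat.ofHom (LinearMap.codRestrict (spanDeg (gens n w) j)
      (s • (tau n k ∘ₗ subcomplexVal ∘ₗ (α.f i).hom)) fun x =>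
        Submodule.smul_mem _ _ (h ▸ tau_mem_spanDeg (subcomplexVal_mem (α.f i x))))
  else 0

theorem subcomplexVal_tauHom {w : ℕ → ℤ} (k : ℕ) {G : ChainComplex (ModuleCat ℤ) ℤ}
    (α : G ⟶ subcomplex (gens n w) (gens_closed n w)) (s : ℤ) {i j : ℤ} (h : i + 1 = j)
    (x : G.X i) :
    subcomplexVal (tauHom k α s i j x) = s • tau n k (subcomplexVal (α.f i x)) := by
  have h1 : tauHom k α s i j = ModuleCat.ofHom (LinearMap.codRestrict (spanDeg (gens n w) j)
      (s • (tau n k ∘ₗ subcomplexVal ∘ₗ (α.f i).hom)) fun x =>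
        Submodule.smul_mem _ _ (h ▸ tau_mem_spanDeg (subcomplexVal_mem (α.f i x)))) := dif_pos h
  rw [h1]
  rfl

/-- The null homotopy of `α φ` given by `± τ`. -/
noncomputable def tauHomotopy {w : ℕ → ℤ} (k : ℕ) {G : ChainComplex (ModuleCat ℤ) ℤ} (φ : G ⟶ G)
    (α : G ⟶ subcomplex (gens n w) (gens_closed n w)) (s : ℤ)
    (h : ∀ j (y : G.X j), subcomplexVal (α.f j (φ.f j y)) =
      s • (bd n (tau n k (subcomplexVal (α.f j y))) +
        tau n k (bd n (subcomplexVal (α.f j y))))) :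
    Homotopy (φ ≫ α) 0 where
  hom i j := tauHom k α s i j
  zero i j hij := dif_neg hij
  comm j := by
    have h1 : (ComplexShape.down ℤ).Rel j (j - 1) := sub_add_cancel j 1
    have h2 : (ComplexShape.down ℤ).Rel (j + 1) j := rfl
    rw [dNext_eq _ h1, prevD_eq _ h2]
    ext y
    have h3 : α.f (j - 1) (G.d j (j - 1) y) =
        (subcomplex (gens n w) (gens_closed n w)).d j (j - 1) (α.f j y) := by
      rw [← ConcreteCategory.comp_apply, ← ConcreteCategory.comp_apply, α.comm]
    apply subcomplexVal_injective
    change subcomplexVal (α.f j (φ.f j y)) =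
      subcomplexVal (tauHom k α s (j - 1) j (G.d j (j - 1) y)) +
        subcomplexVal ((subcomplex (gens n w) (gens_closed n w)).d (j + 1) j
          (tauHom k α s j (j + 1) y)) + 0
    rw [subcomplexVal_d rfl, subcomplexVal_tauHom k α s rfl,
      subcomplexVal_tauHom k α s (sub_add_cancel j 1), h3, subcomplexVal_d (sub_add_cancel j 1),
      h, map_smul, add_zero, smul_add, add_comm]

/-- The model `G` of F_{k+1} and the sign `s` are free because there are two uses: F_{k+1} itself
with s = 1, and the shifted complex of smaller matrices with s = -1. -/
theorem nonempty_homology_iso_cone_of_eq {w : ℕ → ℤ} {k : ℕ} (hk : 2 ≤ k) (hkn : k ≤ n)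
    (hw1 : w 1 = 2) (hwk : w k = 2) {G : ChainComplex (ModuleCat ℤ) ℤ} (φ : G ⟶ G)
    (α : G ⟶ subcomplex (gens n w) (gens_closed n w))
    (inj : ∀ j (y : G.X j), α.f j y = 0 → y = 0)
    (mem : ∀ j (y : G.X j), subcomplexVal (α.f j y) ∈ wedgeSpan (typeB n k))
    (surj : ∀ j, ∀ x ∈ spanDeg (filtGens n w (k + 1)) j,
      ∃ y : G.X j, subcomplexVal (α.f j y) = x)
    (s : ℤ) (hs : s * s = 1)
    (h : ∀ j (y : G.X j), subcomplexVal (α.f j (φ.f j y)) =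
      s • (bd n (tau n k (subcomplexVal (α.f j y))) +
        tau n k (bd n (subcomplexVal (α.f j y)))))
    (j : ℤ) : Nonempty ((bracket n w).homology j ≅ (homotopyCofiber φ).homology j) :=
  nonempty_homology_iso_cone hk hkn hw1 hwk φ α (tauHomotopy k φ α s h) inj mem surj s hs
    (fun _ _ hij y => subcomplexVal_tauHom k α s hij y) j

/-- The inclusion of a subcomplex in a larger one. -/
noncomputable def subcomplexInclusion {S T : Set (Finset (Pair n))} (hS : ClosedUnderBoundary S)
    (hT : ClosedUnderBoundary T) (h : S ⊆ T) : subcomplex S hS ⟶ subcomplex T hT where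
  f j := ModuleCat.ofHom (Submodule.inclusion
    (wedgeSpan_mono (Set.inter_subset_inter_left _ h) : spanDeg S j ≤ spanDeg T j))
  comm' i j hij := by
    have hij' : j + 1 = i := hij
    ext x
    apply subcomplexVal_injective
    exact (subcomplexVal_d hij' _).trans (subcomplexVal_d (hS := hS) hij' x).symm

/-- An endomorphism of the exterior algebra which commutes with the boundary and preserves the
terms of a subcomplex induces an endomorphism of the subcomplex. -/
noncomputable def subcomplexEnd {S : Set (Finset (Pair n))} (hS : ClosedUnderBoundary S)
    (f : ExtNil n →ₗ[ℤ] ExtNil n) (hf : ∀ x, bd n (f x) = f (bd n x))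
    (hfS : ∀ j, ∀ x ∈ spanDeg S j, f x ∈ spanDeg S j) : subcomplex S hS ⟶ subcomplex S hS where
  f j := ModuleCat.ofHom (f.restrict (hfS j))
  comm' i j hij := by
    have hij' : j + 1 = i := hij
    ext x
    apply subcomplexVal_injective
    refine (subcomplexVal_d hij' _).trans ((hf _).trans ?_)
    exact congrArg f (subcomplexVal_d (hS := hS) hij' x).symm

/-- The homology of `⟦w⟧` is the homology of the cone of an endomorphism of `F_{k+1}`. -/
theorem exists_cone {w : ℕ → ℤ} {k : ℕ} (hk : 2 ≤ k) (hkn : k ≤ n)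
    (hw1 : w 1 = 2) (hwk : w k = 2) :
    ∃ φ : filtration n w (k + 1) ⟶ filtration n w (k + 1),
      ∀ j : ℤ, Nonempty ((bracket n w).homology j ≅ (homotopyCofiber φ).homology j) := by
  have hsub : filtGens n w (k + 1) ⊆ gens n w := fun _ hM => hM.1
  have hmem : ∀ j, ∀ x ∈ spanDeg (filtGens n w (k + 1)) j,
      (bd n ∘ₗ tau n k + tau n k ∘ₗ bd n) x ∈ spanDeg (filtGens n w (k + 1)) j := by
    intro j x hx
    obtain ⟨h1, h2⟩ := (spanDeg_filtGens hk hkn hw1 hwk j x).mp hx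
    refine (spanDeg_filtGens hk hkn hw1 hwk j _).mpr ⟨bd_tau_add_tau_bd_mem hk h1, ?_⟩
    refine Submodule.add_mem _ ?_ ?_
    · exact bd_mem_spanDeg (gens_closed n w) rfl _ (tau_mem_spanDeg h2)
    · have h3 := bd_mem_spanDeg (gens_closed n w) (sub_add_cancel j 1) x h2
      have h4 := tau_mem_spanDeg (k := k) h3
      rwa [sub_add_cancel] at h4
  refine ⟨subcomplexEnd (filtGens_closed n w (k + 1)) (bd n ∘ₗ tau n k + tau n k ∘ₗ bd n)
    (fun x => ?_) hmem, fun j => ?_⟩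
  · simp only [LinearMap.add_apply, LinearMap.comp_apply, map_add, bd_bd, map_zero, zero_add,
      add_zero]
  · refine nonempty_homology_iso_cone_of_eq hk hkn hw1 hwk _
      (subcomplexInclusion (filtGens_closed n w (k + 1)) (gens_closed n w) hsub)
      ?_ ?_ ?_ 1 (one_mul 1) ?_ j
    · intro j y hy
      exact Subtype.ext (congrArg subcomplexVal hy : _)
    · intro j y
      exact ((spanDeg_filtGens hk hkn hw1 hwk j _).mp
        (subcomplexVal_mem (hS := filtGens_closed n w (k + 1)) y)).1
    · intro j x hx
      exact ⟨(⟨x, hx⟩ : spanDeg (filtGens n w (k + 1)) j), rfl⟩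
    · intro j y
      rw [one_smul]
      rfl

end Endomorphism

end NilTorsion

/-! ### Naturality of the boundary for homomorphisms of Lie algebras. -/

namespace ChevalleyEilenberg

variable {R L L' : Type*} [CommRing R] [LieRing L] [LieAlgebra R L] [LieRing L'] [LieAlgebra R L']

theorem map_ι_mul (f : L →ₗ[R] L') (m : L) (u : ExteriorAlgebra R L) :
    ExteriorAlgebra.map f (ExteriorAlgebra.ι R m * u) =
      ExteriorAlgebra.ι R (f m) * ExteriorAlgebra.map f u := by
  rw [map_mul, ExteriorAlgebra.map_apply_ι]

theorem lieAction_map (f : L →ₗ⁅R⁆ L') (x : L) (u : ExteriorAlgebra R L) :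
    lieAction R L' (ExteriorAlgebra.map (f : L →ₗ[R] L') u) (f x) =
      ExteriorAlgebra.map (f : L →ₗ[R] L') (lieAction R L u x) := by
  induction u using CliffordAlgebra.left_induction with
  | algebraMap r =>
    rw [Algebra.algebraMap_eq_smul_one]
    have h := fun x => lieAction_one (R := R) (L := L) x
    have h' := fun x => lieAction_one (R := R) (L := L') x
    simp only [map_smul, map_one, LinearMap.smul_apply, h, h', smul_zero, map_zero]
  | add u v hu hv => simp only [map_add, LinearMap.add_apply, hu, hv]
  | ι_mul u m hu =>
    have hm := map_ι_mul (f : L →ₗ[R] L')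
    refine (congrArg (fun z => lieAction R L' z (f x)) (hm m u)).trans ?_
    refine Eq.trans ?_ (congrArg _ (lieAction_ι_mul x m u)).symm
    rw [map_add, hm, hm, lieAction_ι_mul, hu]
    simp

theorem boundary_map (f : L →ₗ⁅R⁆ L') (u : ExteriorAlgebra R L) :
    boundary R L' (ExteriorAlgebra.map (f : L →ₗ[R] L') u) =
      ExteriorAlgebra.map (f : L →ₗ[R] L') (boundary R L u) := by
  induction u using CliffordAlgebra.left_induction with
  | algebraMap r =>
    rw [Algebra.algebraMap_eq_smul_one]
    simp only [map_smul, map_one, boundary_one, smul_zero, map_zero]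
  | add u v hu hv => simp only [map_add, hu, hv]
  | ι_mul u m hu =>
    have hm := map_ι_mul (f : L →ₗ[R] L')
    refine (congrArg (boundary R L') (hm m u)).trans ?_
    refine Eq.trans ?_ (congrArg _ (boundary_ι_mul m u)).symm
    rw [map_sub, map_neg, hm, boundary_ι_mul, hu, ← lieAction_map]
    simp

end ChevalleyEilenberg

namespace NilTorsion

open ChevalleyEilenberg

attribute [local instance] LieRing.ofAssociativeRing

/-! ### Raising all indices by one. -/

section Shift

variable {m : ℕ}

/-- The pair `(a + 1, b + 1)`. -/
def Pair.succ (p : Pair m) : Pair (m + 1) :=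
  ⟨toLex (⟨p.left + 1, Finset.mem_Icc.mpr ⟨by omega, by
      have := p.left_lt_right; have := p.right_le; omega⟩⟩,
    ⟨p.right + 1, Finset.mem_Icc.mpr ⟨by omega, by have := p.right_le; omega⟩⟩), by
      have h := p.left_lt_right
      change (p.left + 1 : ℕ) < p.right + 1
      omega⟩

theorem Pair.succ_left (p : Pair m) : p.succ.left = p.left + 1 := rfl

theorem Pair.succ_right (p : Pair m) : p.succ.right = p.right + 1 := rfl

theorem Pair.succ_injective : Function.Injective (Pair.succ (m := m)) := by
  intro p q h
  have h1 := congrArg Pair.left h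
  have h2 := congrArg Pair.right h
  rw [Pair.succ_left, Pair.succ_left] at h1
  rw [Pair.succ_right, Pair.succ_right] at h2
  exact Pair.ext_iff'.mpr ⟨by omega, by omega⟩

theorem Pair.lt_iff {n : ℕ} {p q : Pair n} :
    p < q ↔ p.left < q.left ∨ p.left = q.left ∧ p.right < q.right := by
  change p.1 < q.1 ↔ _
  rw [Prod.Lex.lt_iff]
  refine or_congr Iff.rfl (and_congr ?_ Iff.rfl)
  exact Subtype.ext_iff

theorem Pair.succ_lt_succ {p q : Pair m} (h : p < q) : p.succ < q.succ := by
  rw [Pair.lt_iff] at h ⊢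
  simp only [Pair.succ_left, Pair.succ_right]
  omega

theorem Pair.exists_succ {p : Pair (m + 1)} (h : p.left ≠ 1) : ∃ q : Pair m, q.succ = p := by
  have h1 := p.left_pos
  have h2 := p.left_lt_right
  have h3 := p.right_le
  obtain ⟨q, hq1, hq2⟩ := Pair.exists_mk (n := m) (a := p.left - 1) (b := p.right - 1)
    (by omega) (by omega) (by omega)
  refine ⟨q, Pair.ext_iff'.mpr ?_⟩
  rw [Pair.succ_left, Pair.succ_right]
  omega

variable (m) in
/-- The linear map `e_{ab} ↦ e_{a+1,b+1}`. -/
noncomputable def shiftLinear : nil m →ₗ[ℤ] nil (m + 1) :=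
  (nilBasis m).constr ℤ fun p => matUnit (m + 1) p.succ.left p.succ.right

theorem shiftLinear_matUnit (p : Pair m) : shiftLinear m (matUnit m p.left p.right) =
    matUnit (m + 1) p.succ.left p.succ.right := by
  rw [← nilBasis_apply, shiftLinear, Module.Basis.constr_basis]

theorem shiftLinear_lie (x y : nil m) :
    shiftLinear m ⁅x, y⁆ = ⁅shiftLinear m x, shiftLinear m y⁆ := by
  have h : (LieModule.toEnd ℤ (nil m) (nil m) : nil m →ₗ[ℤ] Module.End ℤ (nil m)).compr₂
        (shiftLinear m) =
      (LieModule.toEnd ℤ (nil (m + 1)) (nil (m + 1)) :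
        nil (m + 1) →ₗ[ℤ] Module.End ℤ (nil (m + 1))).compl₁₂ (shiftLinear m) (shiftLinear m) := by
    refine (nilBasis m).ext fun p => (nilBasis m).ext fun q => ?_
    rw [nilBasis_apply, nilBasis_apply]
    change shiftLinear m ⁅matUnit m p.left p.right, matUnit m q.left q.right⁆ =
      ⁅shiftLinear m (matUnit m p.left p.right), shiftLinear m (matUnit m q.left q.right)⁆
    rw [shiftLinear_matUnit, shiftLinear_matUnit, matUnit_lie, matUnit_lie]
    have h1 : p.succ.right = q.succ.left ↔ p.right = q.left := by
      rw [Pair.succ_left, Pair.succ_right, add_left_inj]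
    have h2 : q.succ.right = p.succ.left ↔ q.right = p.left := by
      rw [Pair.succ_left, Pair.succ_right, add_left_inj]
    by_cases h3 : p.right = q.left
    · rw [dif_pos h3, dif_pos (h1.mpr h3), shiftLinear_matUnit]
      rfl
    · rw [dif_neg h3, dif_neg (mt h1.mp h3)]
      by_cases h4 : q.right = p.left
      · rw [dif_pos h4, dif_pos (h2.mpr h4), map_neg, shiftLinear_matUnit]
        rfl
      · rw [dif_neg h4, dif_neg (mt h2.mp h4), map_zero]
  exact LinearMap.congr_fun₂ h x y

variable (m) in
/-- The homomorphism of Lie rings `e_{ab} ↦ e_{a+1,b+1}`. -/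
noncomputable def shiftLie : nil m →ₗ⁅ℤ⁆ nil (m + 1) :=
  { shiftLinear m with map_lie' := fun {x y} => shiftLinear_lie x y }

variable (m) in
/-- The homomorphism of exterior algebras `e_{ab} ↦ e_{a+1,b+1}`. -/
noncomputable def shiftExt : ExtNil m →ₐ[ℤ] ExtNil (m + 1) :=
  ExteriorAlgebra.map (shiftLie m : nil m →ₗ[ℤ] nil (m + 1))

theorem shiftExt_e (p : Pair m) :
    shiftExt m (e m p.left p.right) = e (m + 1) p.succ.left p.succ.right := by
  rw [shiftExt, e, ExteriorAlgebra.map_apply_ι]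
  exact congrArg _ (shiftLinear_matUnit p)

theorem bd_shiftExt (x : ExtNil m) : bd (m + 1) (shiftExt m x) = shiftExt m (bd m x) :=
  boundary_map _ _

theorem shiftExt_wedge (M : Finset (Pair m)) :
    shiftExt m (wedge m M) = wedge (m + 1) (M.image Pair.succ) := by
  induction M using Finset.induction_on_min with
  | empty => rw [wedge_empty, Finset.image_empty, wedge_empty, map_one]
  | insert p M hp ih =>
    rw [wedge_insert_of_lt hp, Finset.image_insert, wedge_insert_of_lt, map_mul, ih, shiftExt_e]
    intro q hq
    obtain ⟨r, hr, rfl⟩ := Finset.mem_image.mp hq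
    exact Pair.succ_lt_succ (hp r hr)

theorem weight_image_succ (M : Finset (Pair m)) (i : ℕ) :
    weight (M.image Pair.succ) (i + 1) = weight M i + 1 := by
  have h1 : ((M.image Pair.succ).filter fun p => p.right = i + 1).card =
      (M.filter fun p => p.right = i).card := by
    rw [Finset.filter_image, Finset.card_image_of_injective _ Pair.succ_injective]
    simp only [Pair.succ_right, add_left_inj]
  have h2 : ((M.image Pair.succ).filter fun p => p.left = i + 1).card =
      (M.filter fun p => p.left = i).card := by
    rw [Finset.filter_image, Finset.card_image_of_injective _ Pair.succ_injective]
    simp only [Pair.succ_left, add_left_inj]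
  rw [weight, weight, h1, h2]
  push_cast
  ring

theorem weight_insert_of_notMem {n : ℕ} {M : Finset (Pair n)} {p : Pair n} (hp : p ∉ M) (i : ℕ) :
    weight (insert p M) i =
      weight M i - (if p.right = i then 1 else 0) + (if p.left = i then 1 else 0) := by
  rw [weight, weight, Finset.filter_insert, Finset.filter_insert]
  split_ifs <;> simp [hp] <;> ring

theorem image_succ_mem_noRow (M : Finset (Pair m)) : M.image Pair.succ ∈ noRow (m + 1) 1 := by
  intro p hp
  obtain ⟨q, -, rfl⟩ := Finset.mem_image.mp hp
  have := q.left_pos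
  rw [Pair.succ_left]
  omega

end Shift

/-! ### The case k = n - 1, where F_{k+1} comes from smaller matrices. -/

section LastButOne

variable {k : ℕ}

/-- The pair `(1, k + 1)`. -/
noncomputable def corner (hk : 2 ≤ k) : Pair (k + 1) :=
  (Pair.exists_mk (n := k + 1) (a := 1) (b := k + 1) le_rfl (by omega) le_rfl).choose

theorem corner_left (hk : 2 ≤ k) : (corner hk).left = 1 :=
  (Pair.exists_mk (n := k + 1) (a := 1) (b := k + 1) le_rfl (by omega) le_rfl).choose_spec.1

theorem corner_right (hk : 2 ≤ k) : (corner hk).right = k + 1 :=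
  (Pair.exists_mk (n := k + 1) (a := 1) (b := k + 1) le_rfl (by omega) le_rfl).choose_spec.2

/-- The set `{(1, k + 1)} ∪ {(a + 1, b + 1); (a, b) ∈ M}`. -/
noncomputable def suspend (hk : 2 ≤ k) (M : Finset (Pair k)) : Finset (Pair (k + 1)) :=
  insert (corner hk) (M.image Pair.succ)

theorem corner_notMem (hk : 2 ≤ k) (M : Finset (Pair k)) : corner hk ∉ M.image Pair.succ :=
  fun h => image_succ_mem_noRow M _ h (corner_left hk)

theorem suspend_injective (hk : 2 ≤ k) : Function.Injective (suspend hk) := by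
  intro M N h
  have h1 := congrArg (fun S => S.erase (corner hk)) h
  simp only [suspend, Finset.erase_insert (corner_notMem hk _)] at h1
  exact Finset.image_injective Pair.succ_injective h1

theorem card_suspend (hk : 2 ≤ k) (M : Finset (Pair k)) :
    (suspend hk M).card = M.card + 1 := by
  rw [suspend, Finset.card_insert_of_notMem (corner_notMem hk M),
    Finset.card_image_of_injective _ Pair.succ_injective]

/-- Raising the indices adds one to each weight, and the pair (1,k+1) takes one away in the last
place. The entry 1 of the reduced sequence is `w k - 1`, and the weight at 1 is automatically 2. -/
theorem suspend_mem_gens (hk : 2 ≤ k) {w : ℕ → ℤ} (hw1 : w 1 = 2) (hwk : w k = 2)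
    (M : Finset (Pair k)) :
    suspend hk M ∈ gens (k + 1) w ↔ M ∈ gens k (reducedSeq (k + 1) w) := by
  have h1 : weight (suspend hk M) 1 = 2 := by
    have h2 := weight_image_succ M 0
    rw [suspend, weight_insert_of_notMem (corner_notMem hk M), corner_left, corner_right,
      if_neg (by omega), if_pos rfl, h2, weight]
    have h3 : (M.filter fun p => p.right = 0) = ∅ := Finset.filter_eq_empty_iff.mpr fun p _ h => by
      have := p.left_lt_right
      omega
    have h4 : (M.filter fun p => p.left = 0) = ∅ := Finset.filter_eq_empty_iff.mpr fun p _ h => by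
      have := p.left_pos
      omega
    rw [h3, h4]
    simp
  have h2 : ∀ i, 1 ≤ i → weight (suspend hk M) (i + 1) =
      weight M i + if i = k then 0 else 1 := by
    intro i hi
    rw [suspend, weight_insert_of_notMem (corner_notMem hk M), corner_left, corner_right,
      weight_image_succ, if_neg (by omega : ¬1 = i + 1)]
    split_ifs <;> omega
  have h3 : ∀ i, 1 ≤ i → reducedSeq (k + 1) w i + (if i = k then 0 else 1) = w (i + 1) := by
    intro i hi
    rw [reducedSeq]
    split_ifs with h4 h5 h6 h7 h8
    · rw [h4]
      simp
    · omega
    · omega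
    · have h9 : i + 1 = k := by omega
      rw [h9, hwk]
      norm_num
    · omega
    · ring
  constructor
  · intro h i hi
    obtain ⟨hi1, hi2⟩ := Finset.mem_Icc.mp hi
    have h4 := h (i + 1) (Finset.mem_Icc.mpr ⟨by omega, by omega⟩)
    rw [h2 i hi1, ← h3 i hi1] at h4
    exact add_right_cancel h4
  · intro h i hi
    obtain ⟨hi1, hi2⟩ := Finset.mem_Icc.mp hi
    obtain ⟨j, rfl⟩ : ∃ j, i = j + 1 := ⟨i - 1, by omega⟩
    rcases Nat.eq_zero_or_pos j with rfl | hj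
    · rw [zero_add, h1, hw1]
    · rw [h2 j hj, ← h3 j hj, h j (Finset.mem_Icc.mpr ⟨hj, by omega⟩)]

/-- The single entry of row 1 is forced to be (1,k+1); all other pairs have positive indices after
lowering them by one. -/
theorem exists_suspend_eq (hk : 2 ≤ k) {w : ℕ → ℤ} (hw1 : w 1 = 2)
    {N : Finset (Pair (k + 1))} (hN : N ∈ filtGens (k + 1) w (k + 1)) :
    ∃ M, suspend hk M = N := by
  obtain ⟨hN, p, hp, hp1, hpk⟩ := hN
  obtain ⟨q, hq, hq1, hqu⟩ := gens_unique_one (by omega) hw1 hN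
  have hpc : p = corner hk := Pair.ext_iff'.mpr
    ⟨hp1.trans (corner_left hk).symm, by rw [corner_right]; have := p.right_le; omega⟩
  have h1 : ∀ r ∈ N, r.left = 1 → r = corner hk := fun r hr hr1 =>
    (hqu r hr hr1).trans ((hqu p hp hp1).symm.trans hpc)
  refine ⟨Finset.univ.filter fun r => r.succ ∈ N, ?_⟩
  ext r
  simp only [suspend, Finset.mem_insert, Finset.mem_image, Finset.mem_filter, Finset.mem_univ,
    true_and]
  constructor
  · rintro (rfl | ⟨s, hs, rfl⟩)
    · rwa [← hpc]
    · exact hs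
  · intro hr
    by_cases hr1 : r.left = 1
    · exact Or.inl (h1 r hr hr1)
    · obtain ⟨s, rfl⟩ := Pair.exists_succ hr1
      exact Or.inr ⟨s, hr, rfl⟩

variable (k) in
/-- The linear map `x ↦ e_{1,k+1} x'`, where `x'` arises from `x` by raising all the indices. -/
noncomputable def suspendExt : ExtNil k →ₗ[ℤ] ExtNil (k + 1) :=
  LinearMap.mulLeft ℤ (e (k + 1) 1 (k + 1)) ∘ₗ (shiftExt k).toLinearMap

theorem suspendExt_apply (x : ExtNil k) :
    suspendExt k x = e (k + 1) 1 (k + 1) * shiftExt k x := rfl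

theorem suspendExt_wedge (hk : 2 ≤ k) (M : Finset (Pair k)) :
    suspendExt k (wedge k M) = wedge (k + 1) (suspend hk M) := by
  rw [suspendExt_apply, shiftExt_wedge, suspend,
    wedge_insert_one (corner_left hk) (image_succ_mem_noRow M), corner_right]

theorem suspendExt_injective (hk : 2 ≤ k) : Function.Injective (suspendExt k) := by
  have h : (wedge (k + 1)).constr ℤ (fun N => wedge k (Function.invFun (suspend hk) N)) ∘ₗ
      suspendExt k = LinearMap.id := by
    refine (wedge k).ext fun M => ?_
    rw [LinearMap.comp_apply, suspendExt_wedge hk, Module.Basis.constr_basis,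
      Function.leftInverse_invFun (suspend_injective hk)]
    rfl
  intro x y hxy
  rw [← LinearMap.id_apply (R := ℤ) x, ← LinearMap.id_apply (R := ℤ) y, ← h,
    LinearMap.comp_apply, LinearMap.comp_apply, hxy]

/-- No pair starts in k+1, so `e_{1,k+1}` has zero bracket with everything that occurs. The
remaining sign is compensated by the factor (-1)^j in `suspendMap`. -/
theorem bd_suspendExt (hk : 2 ≤ k) (x : ExtNil k) :
    bd (k + 1) (suspendExt k x) = -suspendExt k (bd k x) := by
  rw [suspendExt_apply, suspendExt_apply, bd_e_one_mul (by omega) le_rfl, bd_shiftExt]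
  simp

theorem suspendExt_mem (hk : 2 ≤ k) {w : ℕ → ℤ} (hw1 : w 1 = 2) (hwk : w k = 2) {i j : ℤ}
    (hij : i + 1 = j) {x : ExtNil k} (hx : x ∈ spanDeg (gens k (reducedSeq (k + 1) w)) i) :
    suspendExt k x ∈ spanDeg (filtGens (k + 1) w (k + 1)) j := by
  have h : spanDeg (gens k (reducedSeq (k + 1) w)) i ≤
      (spanDeg (filtGens (k + 1) w (k + 1)) j).comap (suspendExt k) := by
    refine wedgeSpan_le ?_
    rintro M ⟨hM, hMi⟩
    have hMi' : (M.card : ℤ) = i := hMi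
    rw [Submodule.mem_comap, suspendExt_wedge hk]
    refine wedge_mem_wedgeSpan ⟨⟨(suspend_mem_gens hk hw1 hwk M).mpr hM, corner hk,
      Finset.mem_insert_self _ _, corner_left hk, (corner_right hk).ge⟩, ?_⟩
    rw [card_suspend]
    push_cast
    omega
  exact h hx

theorem exists_suspendExt_eq (hk : 2 ≤ k) {w : ℕ → ℤ} (hw1 : w 1 = 2) (hwk : w k = 2) {i j : ℤ}
    (hij : i + 1 = j) {x : ExtNil (k + 1)} (hx : x ∈ spanDeg (filtGens (k + 1) w (k + 1)) j) :
    ∃ y ∈ spanDeg (gens k (reducedSeq (k + 1) w)) i, suspendExt k y = x := by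
  have h : spanDeg (filtGens (k + 1) w (k + 1)) j ≤
      (spanDeg (gens k (reducedSeq (k + 1) w)) i).map (suspendExt k) := by
    refine wedgeSpan_le ?_
    rintro N ⟨hN, hNj⟩
    obtain ⟨M, rfl⟩ := exists_suspend_eq hk hw1 hN
    have hNj' : ((suspend hk M).card : ℤ) = j := hNj
    refine ⟨wedge k M, wedge_mem_wedgeSpan ⟨(suspend_mem_gens hk hw1 hwk M).mp hN.1, ?_⟩,
      suspendExt_wedge hk M⟩
    rw [card_suspend] at hNj'
    push_cast at hNj'
    omega
  exact h hx

/-- In the closed form only c = k+1 remains, and each entry (b,k+1) of V contributes the generator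
itself. There are k - w(k+1) such entries, and -(k-1) + (k - w(k+1)) = -(w(k+1) - 1). -/
theorem bd_tau_add_tau_bd_last {w : ℕ → ℤ} (hk : 2 ≤ k) {j : ℤ} {x : ExtNil (k + 1)}
    (hw1 : w 1 = 2) (hwk : w k = 2) (hx : x ∈ spanDeg (filtGens (k + 1) w (k + 1)) j) :
    bd (k + 1) (tau (k + 1) k x) + tau (k + 1) k (bd (k + 1) x) = -((w (k + 1) - 1) • x) := by
  have h : spanDeg (filtGens (k + 1) w (k + 1)) j ≤
      LinearMap.eqLocus (bd (k + 1) ∘ₗ tau (k + 1) k + tau (k + 1) k ∘ₗ bd (k + 1))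
        (-((w (k + 1) - 1) • LinearMap.id)) := by
    refine wedgeSpan_le ?_
    rintro N ⟨hN, -⟩
    rw [filtGens_eq hk (by omega) hw1 hwk] at hN
    obtain ⟨⟨p, V, hV, hp1, hp2, rfl⟩, hg⟩ := hN
    have hp3 := p.right_le
    have hpk : p.right = k + 1 := by omega
    have hpV : p ∉ V := fun h => (hV.1 p h).1 hp1
    have hV1 := wedge_mem_wedgeSpan (baseSet_subset_noRow_one hV)
    have hVk := wedge_mem_wedgeSpan (baseSet_subset_noRow hV)
    -- This is the weight condition at k+1. The pair `p` accounts for one entry of the last column,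
    -- and rows 1 and `k` of V are empty.
    have hcount : (((Finset.Ico 2 k).filter fun b => HasPair V b (k + 1)).card : ℤ) =
        k - w (k + 1) := by
      have h1 := hg (k + 1) (Finset.mem_Icc.mpr ⟨by omega, le_rfl⟩)
      rw [weight_insert_of_notMem hpV, if_pos hpk, if_neg (by omega), weight,
        card_filter_right] at h1
      have h2 : (V.filter fun q => q.left = k + 1) = ∅ :=
        Finset.filter_eq_empty_iff.mpr fun q _ h => by
          have := q.left_lt_right
          have := q.right_le
          omega
      have h3 : ((Finset.Ico 1 (k + 1)).filter fun b => HasPair V b (k + 1)) =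
          (Finset.Ico 2 k).filter fun b => HasPair V b (k + 1) := by
        ext b
        simp only [Finset.mem_filter, Finset.mem_Ico]
        refine and_congr_left ?_
        rintro ⟨q, hq, hq1, hq2⟩
        have := hV.1 q hq
        omega
      rw [h2, h3] at h1
      push_cast at h1
      simp only [Finset.card_empty, Nat.cast_zero] at h1
      linarith
    have hsum : ∑ b ∈ Finset.Ico 2 k, ∑ c ∈ Finset.Ioc k (k + 1),
        e (k + 1) b (k + 1) * (e (k + 1) 1 c * ctr (k + 1) b c (wedge (k + 1) V)) =
        -((k - w (k + 1)) • (e (k + 1) 1 (k + 1) * wedge (k + 1) V)) := by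
      rw [← hcount, natCast_zsmul, ← Finset.sum_const, Finset.sum_filter,
        ← Finset.sum_neg_distrib]
      refine Finset.sum_congr rfl fun b hb => ?_
      have h1 : Finset.Ioc k (k + 1) = {k + 1} := by
        ext
        simp only [Finset.mem_Ioc, Finset.mem_singleton]
        omega
      rw [h1, Finset.sum_singleton, e_mul_left_comm]
      split_ifs with h2
      · rw [e_mul_ctr_wedge h2]
      · rw [ctr_wedge_of_not_hasPair h2, mul_zero, mul_zero]
    have hfin : ∀ X : ExtNil (k + 1), -((k - 1 : ℤ) • X) - -((k - w (k + 1)) • X) =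
        -((w (k + 1) - 1) • X) := fun X => by module
    have hmain := bd_tau_add_tau_bd hk hV1 hVk (Finset.mem_Ioc.mpr ⟨by omega, le_rfl⟩)
    rw [hsum, hfin] at hmain
    rw [wedge_insert_one hp1 (baseSet_subset_noRow_one hV), hpk]
    exact hmain
  exact h hx

open CategoryTheory HomologicalComplex

theorem negOnePow_smul_suspendExt_mem (hk : 2 ≤ k) {w : ℕ → ℤ} (hw1 : w 1 = 2) (hwk : w k = 2)
    (j : ℤ) (x : ExtNil k) (hx : x ∈ spanDeg (gens k (reducedSeq (k + 1) w)) (j - 1)) :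
    ((Int.negOnePow j : ℤ) • suspendExt k) x ∈ spanDeg (gens (k + 1) w) j := by
  rw [LinearMap.smul_apply]
  refine Submodule.smul_mem _ _ ?_
  have h := suspendExt_mem hk hw1 hwk (sub_add_cancel j 1) hx
  exact wedgeSpan_mono (Set.inter_subset_inter_left _ fun _ hM => hM.1) h

/-- The terms of `suspendHom`. -/
noncomputable def suspendMap (hk : 2 ≤ k) {w : ℕ → ℤ} (hw1 : w 1 = 2) (hwk : w k = 2) (j : ℤ) :
    (shift (bracket k (reducedSeq (k + 1) w)) 1).X j ⟶
      (subcomplex (gens (k + 1) w) (gens_closed (k + 1) w)).X j :=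
  ModuleCat.ofHom (((Int.negOnePow j : ℤ) • suspendExt k).restrict
    (negOnePow_smul_suspendExt_mem hk hw1 hwk j))

theorem subcomplexVal_suspendMap (hk : 2 ≤ k) {w : ℕ → ℤ} (hw1 : w 1 = 2) (hwk : w k = 2) (j : ℤ)
    (x : (subcomplex _ (gens_closed k (reducedSeq (k + 1) w))).X (j - 1)) :
    subcomplexVal (suspendMap hk hw1 hwk j x) =
      (Int.negOnePow j : ℤ) • suspendExt k (subcomplexVal x) := rfl

theorem subcomplexVal_d_suspendMap (hk : 2 ≤ k) {w : ℕ → ℤ} (hw1 : w 1 = 2) (hwk : w k = 2)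
    {i j : ℤ} (hij : j + 1 = i) (hij' : j - 1 + 1 = i - 1)
    (x : (subcomplex _ (gens_closed k (reducedSeq (k + 1) w))).X (i - 1)) :
    subcomplexVal ((subcomplex (gens (k + 1) w) (gens_closed (k + 1) w)).d i j
      (suspendMap hk hw1 hwk i x)) =
    subcomplexVal (suspendMap hk hw1 hwk j
      ((subcomplex _ (gens_closed k (reducedSeq (k + 1) w))).d (i - 1) (j - 1) x)) := by
  have h1 := subcomplexVal_d (hS := gens_closed k (reducedSeq (k + 1) w)) hij' x
  have h2 := subcomplexVal_d hij (suspendMap hk hw1 hwk i x)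
  have h3 := subcomplexVal_suspendMap hk hw1 hwk j
    ((subcomplex _ (gens_closed k (reducedSeq (k + 1) w))).d (i - 1) (j - 1) x)
  refine h2.trans (Eq.trans ?_ h3.symm)
  have h4 := subcomplexVal_suspendMap hk hw1 hwk i x
  have hs : (Int.negOnePow i : ℤ) = -(Int.negOnePow j : ℤ) := by
    have := Int.negOnePow_succ j
    rw [hij] at this
    rw [this, Units.val_neg]
  rw [h1]
  refine (congrArg _ h4).trans ?_
  rw [map_smul, bd_suspendExt hk, hs]
  simp

/-- The embedding of the shifted complex of smaller matrices. -/
noncomputable def suspendHom (hk : 2 ≤ k) {w : ℕ → ℤ} (hw1 : w 1 = 2) (hwk : w k = 2) :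
    shift (bracket k (reducedSeq (k + 1) w)) 1 ⟶
      subcomplex (gens (k + 1) w) (gens_closed (k + 1) w) where
  f j := suspendMap hk hw1 hwk j
  comm' i j hij := by
    have hij' : j + 1 = i := hij
    have hij2 : j - 1 + 1 = i - 1 := by omega
    refine ModuleCat.hom_ext (LinearMap.ext fun x => subcomplexVal_injective ?_)
    exact subcomplexVal_d_suspendMap hk hw1 hwk hij' hij2 x

theorem negOnePow_mul_self (j : ℤ) : (Int.negOnePow j : ℤ) * (Int.negOnePow j : ℤ) = 1 := by
  rw [← Units.val_mul, Int.units_mul_self, Units.val_one]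

theorem suspendMap_mem (hk : 2 ≤ k) {w : ℕ → ℤ} (hw1 : w 1 = 2) (hwk : w k = 2) {j : ℤ}
    (y : (subcomplex _ (gens_closed k (reducedSeq (k + 1) w))).X (j - 1)) :
    subcomplexVal (suspendMap hk hw1 hwk j y) ∈ spanDeg (filtGens (k + 1) w (k + 1)) j := by
  rw [subcomplexVal_suspendMap]
  exact Submodule.smul_mem _ _
    (suspendExt_mem hk hw1 hwk (sub_add_cancel j 1) (subcomplexVal_mem y))

theorem suspendMap_eq_zero (hk : 2 ≤ k) {w : ℕ → ℤ} (hw1 : w 1 = 2) (hwk : w k = 2) {j : ℤ}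
    (y : (subcomplex _ (gens_closed k (reducedSeq (k + 1) w))).X (j - 1))
    (hy : suspendMap hk hw1 hwk j y = 0) : y = 0 := by
  have h1 := congrArg subcomplexVal hy
  rw [subcomplexVal_suspendMap, map_zero] at h1
  have h2 := congrArg ((Int.negOnePow j : ℤ) • ·) h1
  simp only [smul_smul, negOnePow_mul_self, one_smul, smul_zero] at h2
  exact subcomplexVal_injective (suspendExt_injective hk (h2.trans (map_zero _).symm))

theorem exists_suspendMap_eq (hk : 2 ≤ k) {w : ℕ → ℤ} (hw1 : w 1 = 2) (hwk : w k = 2) {j : ℤ}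
    {x : ExtNil (k + 1)} (hx : x ∈ spanDeg (filtGens (k + 1) w (k + 1)) j) :
    ∃ y : (subcomplex _ (gens_closed k (reducedSeq (k + 1) w))).X (j - 1),
      subcomplexVal (suspendMap hk hw1 hwk j y) = x := by
  obtain ⟨y, hy, hyx⟩ := exists_suspendExt_eq hk hw1 hwk (sub_add_cancel j 1)
    (Submodule.smul_mem _ (Int.negOnePow j : ℤ) hx)
  obtain ⟨z, rfl⟩ := exists_subcomplexVal_eq (gens_closed k (reducedSeq (k + 1) w)) hy
  refine ⟨z, ?_⟩
  rw [subcomplexVal_suspendMap, hyx, smul_smul, negOnePow_mul_self, one_smul]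

theorem subcomplexVal_suspendMap_smul (hk : 2 ≤ k) {w : ℕ → ℤ} (hw1 : w 1 = 2) (hwk : w k = 2)
    {j : ℤ} (y : (shift (bracket k (reducedSeq (k + 1) w)) 1).X j) :
    subcomplexVal (suspendMap hk hw1 hwk j ((w (k + 1) - 1) • y)) =
      (-1 : ℤ) • (bd (k + 1) (tau (k + 1) k (subcomplexVal (suspendMap hk hw1 hwk j y))) +
        tau (k + 1) k (bd (k + 1) (subcomplexVal (suspendMap hk hw1 hwk j y)))) := by
  rw [bd_tau_add_tau_bd_last hk hw1 hwk (suspendMap_mem hk hw1 hwk y), map_smul, map_smul]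
  simp

/-- The homology of `⟦w⟧` when the last but one entry of `w` is `2`. -/
theorem nonempty_homology_iso_cone_last (hk : 2 ≤ k) {w : ℕ → ℤ} (hw1 : w 1 = 2)
    (hwk : w k = 2) (j : ℤ) : Nonempty ((bracket (k + 1) w).homology j ≅
      (homotopyCofiber ((w (k + 1) - 1) •
        𝟙 (shift (bracket k (reducedSeq (k + 1) w)) 1))).homology j) := by
  -- Here s = -1, since ∂τ + τ∂ is multiplication by -(w(k+1) - 1).
  refine nonempty_homology_iso_cone_of_eq hk (by omega) hw1 hwk _ (suspendHom hk hw1 hwk)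
    ?_ ?_ ?_ (-1) (by norm_num) ?_ j
  · intro j y hy
    exact suspendMap_eq_zero hk hw1 hwk y hy
  · intro j y
    exact ((spanDeg_filtGens hk (by omega) hw1 hwk j _).mp (suspendMap_mem hk hw1 hwk y)).1
  · intro j x hx
    exact exists_suspendMap_eq hk hw1 hwk hx
  · intro j y
    exact subcomplexVal_suspendMap_smul hk hw1 hwk y

end LastButOne

end NilTorsion

/-! ### Zigzag paths and Morse coefficients for general matchings. -/

namespace AlgMorse

variable {V R : Type*} [CommRing R] {wt : V → V → R} {𝓜 : Set (V × V)} {deg : V → ℕ}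

theorem not_transGen_of_lt {E : V → V → Prop} (f : V → ℕ) (hf : ∀ u v, E u v → f v < f u) (v : V) :
    ¬ Relation.TransGen E v v := by
  have h : ∀ {u v}, Relation.TransGen E u v → f v < f u := by
    intro u v huv
    induction huv with
    | single h => exact hf _ _ h
    | tail _ h ih => exact (hf _ _ h).trans ih
  exact fun hv => lt_irrefl _ (h hv)

theorem not_exists_infinite_path_of_lt {E : V → V → Prop} (f : V → ℕ)
    (hf : ∀ u v, E u v → f v < f u) : ¬ ∃ g : ℕ → V, ∀ i, E (g i) (g (i + 1)) := by
  rintro ⟨g, hg⟩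
  have h : ∀ i, f (g i) + i ≤ f (g 0) := by
    intro i
    induction i with
    | zero => simp
    | succ i ih => have := hf _ _ (hg i); omega
  have := h (f (g 0) + 1)
  omega

theorem reversed_eq_of_notMem {u v : V} (h1 : (v, u) ∉ 𝓜) (h2 : (u, v) ∉ 𝓜) :
    reversed wt 𝓜 u v = wt u v := by
  rw [reversed, if_neg h1, if_neg h2]

theorem edge_reversed {u v : V} (h : Edge (reversed wt 𝓜) u v) :
    (v, u) ∈ 𝓜 ∨ ((v, u) ∉ 𝓜 ∧ (u, v) ∉ 𝓜 ∧ wt u v ≠ 0) := by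
  unfold Edge reversed at h
  split_ifs at h with h1 h2
  · exact Or.inl h1
  · exact absurd rfl h
  · exact Or.inr ⟨h1, h2, h⟩

theorem pathWeight_eq_zero (wt : V → V → R) {u : V} {l : List V}
    (h : ¬ List.IsChain (Edge wt) (u :: l)) : pathWeight wt u l = 0 := by
  induction l generalizing u with
  | nil => exact absurd (List.isChain_singleton u) h
  | cons v l ih =>
    rw [List.isChain_cons_cons, not_and_or] at h
    rw [pathWeight]
    rcases h with h | h
    · rw [not_not.mp h, zero_mul]
    · rw [ih h, mul_zero]

/-- Distinct edges are disjoint, and for a single edge equality would give a loop after reversal,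
against acyclicity. -/
theorem IsMorseMatching.not_lower (hM : IsMorseMatching deg wt 𝓜) {p q : V × V} (hp : p ∈ 𝓜)
    (hq : q ∈ 𝓜) : p.1 ≠ q.2 := by
  by_cases h : p = q
  · subst h
    intro h'
    refine hM.acyclic p.1 ?_
    have h1 : Edge (reversed wt 𝓜) p.1 p.1 := by
      have h2 : (p.1, p.1) ∈ 𝓜 := by
        have : (p.1, p.1) = p := Prod.ext rfl h'
        rwa [this]
      rw [Edge, reversed, if_pos h2]
      have h3 : IsUnit (wt p.1 p.1) := hM.isUnit _ h2
      have h4 : wt p.1 p.1 ≠ 0 := hM.edge _ h2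
      intro h5
      refine h4 ?_
      rw [← mul_one (wt p.1 p.1), ← Ring.mul_inverse_cancel _ h3, neg_eq_zero.mp h5, mul_zero,
        mul_zero]
    exact Relation.TransGen.single h1
  · exact (hM.disjoint p hp q hq h).2.1

/-- A reversed edge raises the degree by one but ends in an upper vertex. The path cannot stop
there, as its end is critical, and its next edge is not reversed and lowers the degree again. -/
theorem deg_le_of_path (hM : IsMorseMatching deg wt 𝓜)
    (hdeg : ∀ u v, wt u v ≠ 0 → deg u = deg v + 1) {v : V} (hv : v ∈ critical 𝓜) (l : List V) :
    ∀ x, l ∈ paths (reversed wt 𝓜) x v → deg v ≤ deg x ∧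
      ((∀ p ∈ 𝓜, p.2 ≠ x) → l ≠ [] → deg v < deg x) := by
  induction l with
  | nil =>
    rintro x ⟨-, rfl⟩
    exact ⟨le_rfl, fun _ h => absurd rfl h⟩
  | cons y l ih =>
    rintro x ⟨hc, hl⟩
    rw [List.isChain_cons_cons] at hc
    rw [List.getLast_cons (List.cons_ne_nil _ _)] at hl
    obtain ⟨h1, h2⟩ := ih y ⟨hc.2, hl⟩
    rcases edge_reversed hc.1 with h | ⟨-, -, h⟩
    · have h3 := hdeg _ _ (hM.edge _ h)
      have h4 : deg v < deg y := by
        refine h2 (fun p hp => (hM.not_lower h hp).symm) ?_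
        rintro rfl
        exact (hv _ h).1 hl
      exact ⟨by simp only at h3; omega, fun hx => absurd rfl (hx _ h)⟩
    · have h3 := hdeg _ _ h
      exact ⟨by omega, fun _ _ => by omega⟩

/-- The zigzag paths between critical vertices of adjacent degrees, when no lower vertex of the
matching is adjacent to an upper vertex which is not matched to it. -/
theorem eq_of_mem_paths (hM : IsMorseMatching deg wt 𝓜)
    (hdeg : ∀ u v, wt u v ≠ 0 → deg u = deg v + 1)
    (hloc : ∀ p ∈ 𝓜, ∀ q ∈ 𝓜, wt p.1 q.2 ≠ 0 → p = q) {u v : V} (hu : u ∈ critical 𝓜)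
    (hv : v ∈ critical 𝓜) (huv : deg v + 1 = deg u) {l : List V}
    (hl : l ∈ paths (reversed wt 𝓜) u v) : l = [v] ∨ ∃ p ∈ 𝓜, l = [p.2, p.1, v] := by
  have key := deg_le_of_path hM hdeg hv
  have hlast : ∀ x : V, ∀ l, (∀ p ∈ 𝓜, p.2 ≠ x) → deg x ≤ deg v →
      l ∈ paths (reversed wt 𝓜) x v → l = [] ∧ x = v := by
    intro x l hx hd hp
    have h : l = [] := by
      by_contra h
      exact absurd ((key l x hp).2 hx h) (by omega)
    subst h
    exact ⟨rfl, hp.2⟩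
  rcases l with - | ⟨y, l⟩
  · have : u = v := hl.2
    subst this
    omega
  obtain ⟨hc, hl⟩ := hl
  rw [List.isChain_cons_cons] at hc
  rw [List.getLast_cons (List.cons_ne_nil _ _)] at hl
  rcases edge_reversed hc.1 with h | ⟨-, -, h⟩
  · exact absurd rfl (hu _ h).2
  have hy := hdeg _ _ h
  by_cases hlow : ∀ p ∈ 𝓜, p.2 ≠ y
  · obtain ⟨rfl, rfl⟩ := hlast y l hlow (by omega) ⟨hc.2, hl⟩
    exact Or.inl rfl
  push Not at hlow
  obtain ⟨p, hp, rfl⟩ := hlow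
  rcases l with - | ⟨z, l⟩
  · exact absurd hl (hv _ hp).2
  have hc' := hc.2
  rw [List.isChain_cons_cons] at hc'
  rw [List.getLast_cons (List.cons_ne_nil _ _)] at hl
  have hz := key l z ⟨hc'.2, hl⟩
  rcases edge_reversed hc'.1 with h' | ⟨-, -, h'⟩
  swap
  · have := hdeg _ _ h'
    omega
  have hpz : p = (z, p.2) := by
    by_contra hne
    exact (hM.disjoint _ hp _ h' hne).2.2.2 rfl
  rcases l with - | ⟨t, l⟩
  · exact absurd hl (hv _ h').1
  have hc'' := hc'.2
  rw [List.isChain_cons_cons] at hc''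
  rw [List.getLast_cons (List.cons_ne_nil _ _)] at hl
  have hz2 := hdeg _ _ (hM.edge _ h')
  rcases edge_reversed hc''.1 with h'' | ⟨-, hnot, h''⟩
  · exact absurd rfl (hM.not_lower h' h'')
  have ht := hdeg _ _ h''
  -- By `hloc` the only lower vertex adjacent to `z` is its partner, and that edge has been
  -- reversed. So `t` is not a lower vertex, and for degree reasons the path ends there.
  obtain ⟨rfl, rfl⟩ := hlast t l (by
    rintro q hq rfl
    have := hloc _ h' q hq h''
    subst this
    exact hnot hq) (by simp only at hz2; omega) ⟨hc''.2, hl⟩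
  exact Or.inr ⟨p, hp, by rw [hpz]⟩

/-- The condition `hc'` says that the boundary of u + ∑ c x · x has no lower components. By `hloc`
this forces `c p.1` to be the weight of the path u → p.2 → p.1, and `eq_of_mem_paths` lists all
paths to be summed. -/
theorem morseCoeff_eq [Fintype V] (hM : IsMorseMatching deg wt 𝓜)
    (hdeg : ∀ u v, wt u v ≠ 0 → deg u = deg v + 1)
    (hloc : ∀ p ∈ 𝓜, ∀ q ∈ 𝓜, wt p.1 q.2 ≠ 0 → p = q) {u v : V} (hu : u ∈ critical 𝓜)
    (hv : v ∈ critical 𝓜) (huv : deg v + 1 = deg u) (c : V → R)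
    (hc : ∀ x, c x ≠ 0 → ∃ p ∈ 𝓜, p.1 = x)
    (hc' : ∀ p ∈ 𝓜, wt u p.2 + ∑ x, c x * wt x p.2 = 0) :
    morseCoeff wt 𝓜 u v = wt u v + ∑ x, c x * wt x v := by
  classical
  have hcv : ∀ p ∈ 𝓜, wt u p.2 + c p.1 * wt p.1 p.2 = 0 := by
    intro p hp
    rw [← hc' p hp, Finset.sum_eq_single p.1]
    · intro x _ hx
      by_cases h1 : c x = 0
      · rw [h1, zero_mul]
      obtain ⟨q, hq, rfl⟩ := hc x h1
      by_cases h2 : wt q.1 p.2 = 0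
      · rw [h2, mul_zero]
      · exact absurd (congrArg Prod.fst (hloc q hq p hp h2)) hx
    · intro h
      exact absurd (Finset.mem_univ _) h
  have hcv' : ∀ p ∈ 𝓜, c p.1 = wt u p.2 * -Ring.inverse (wt p.1 p.2) := by
    intro p hp
    rw [eq_neg_of_add_eq_zero_left (hcv p hp), neg_mul_neg, mul_assoc,
      Ring.mul_inverse_cancel _ (hM.isUnit p hp), mul_one]
  have hw1 : pathWeight (reversed wt 𝓜) u [v] = wt u v := by
    rw [pathWeight, pathWeight, mul_one,
      reversed_eq_of_notMem (fun h => (hu _ h).2 rfl) (fun h => (hu _ h).1 rfl)]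
  have hw2 : ∀ p ∈ 𝓜, pathWeight (reversed wt 𝓜) u [p.2, p.1, v] = c p.1 * wt p.1 v := by
    intro p hp
    have h1 : reversed wt 𝓜 p.2 p.1 = -Ring.inverse (wt p.1 p.2) := by
      rw [reversed, if_pos (show (p.1, p.2) ∈ 𝓜 from hp)]
    rw [pathWeight, pathWeight, pathWeight, pathWeight, mul_one, h1,
      reversed_eq_of_notMem (fun h => (hu _ h).2 rfl) (fun h => (hu _ h).1 rfl),
      reversed_eq_of_notMem (fun h => (hv _ h).1 rfl) (fun h => (hv _ h).2 rfl), hcv' p hp,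
      mul_assoc]
  let 𝓕 : Finset (V × V) := Finset.univ.filter (· ∈ 𝓜)
  have hF : ∀ p, p ∈ 𝓕 ↔ p ∈ 𝓜 := fun p => by simp [𝓕]
  -- Lists in the image that are not paths may be included, as their weight is zero.
  have hsum : morseCoeff wt 𝓜 u v =
      ∑ l ∈ insert [v] (𝓕.image fun p => [p.2, p.1, v]), pathWeight (reversed wt 𝓜) u l := by
    rw [morseCoeff]
    refine finsum_mem_eq_sum_of_inter_support_eq _ ?_
    ext l
    simp only [Set.mem_inter_iff, Function.mem_support, Finset.coe_insert, Set.mem_insert_iff,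
      Finset.coe_image, Set.mem_image, Finset.mem_coe, hF]
    refine and_congr_left fun hl => ?_
    constructor
    · intro h
      rcases eq_of_mem_paths hM hdeg hloc hu hv huv h with h | ⟨p, hp, h⟩
      · exact Or.inl h
      · exact Or.inr ⟨p, hp, h.symm⟩
    · intro h
      refine ⟨by_contra fun h' => hl (pathWeight_eq_zero _ h'), ?_⟩
      rcases h with rfl | ⟨p, -, rfl⟩ <;> rfl
  rw [hsum, Finset.sum_insert (by simp), hw1, Finset.sum_image]
  · congr 1
    rw [Finset.sum_congr rfl fun p hp => hw2 p ((hF p).mp hp)]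
    rw [← Finset.sum_image (s := 𝓕) (g := Prod.fst) (f := fun x => c x * wt x v)]
    · refine Finset.sum_subset (Finset.subset_univ _) fun x _ hx => ?_
      by_contra h
      obtain ⟨p, hp, rfl⟩ := hc x (left_ne_zero_of_mul h)
      exact hx (Finset.mem_image_of_mem _ ((hF p).mpr hp))
    · intro p hp q hq hpq
      by_contra hne
      exact (hM.disjoint p ((hF p).mp hp) q ((hF q).mp hq) hne).1 hpq
  · intro p _ q _ hpq
    simp only [List.cons.injEq, and_true] at hpq
    exact Prod.ext hpq.2 hpq.1

end AlgMorse

namespace NilTorsion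

/-! ### The matching of U with D, its acyclicity and its critical generators. -/

section Matching

variable {n k : ℕ}

/-- The relation between a set in `typeU n k` and the set in `typeD n k` obtained by replacing
`(1, b)` and `(b, k)` by `(1, k)`. -/
def IsPartner (k : ℕ) (M N : Finset (Pair n)) : Prop :=
  ∃ p q : Pair n, ∃ h : p.right = q.left, ∃ V ∈ baseSet n k, q ∈ V ∧ p.left = 1 ∧ q.right = k ∧
    M = insert p V ∧ N = insert (p.comp q h) (V.erase q)

theorem eq_of_mem_insert_one {p r : Pair n} {V : Finset (Pair n)} (hV : V ∈ noRow n 1)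
    (hr : r ∈ insert p V) (hr1 : r.left = 1) : r = p := by
  rcases Finset.mem_insert.mp hr with h | h
  · exact h
  · exact absurd hr1 (hV r h)

theorem erase_mem_noRow {r : ℕ} {V : Finset (Pair n)} (hV : V ∈ noRow n r) (q : Pair n) :
    V.erase q ∈ noRow n r := fun x hx => hV x (Finset.mem_of_mem_erase hx)

theorem insert_mem_noRow {r : ℕ} {V : Finset (Pair n)} (hV : V ∈ noRow n r) {q : Pair n}
    (hq : q.left ≠ r) : insert q V ∈ noRow n r := by
  intro x hx
  rcases Finset.mem_insert.mp hx with rfl | h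
  · exact hq
  · exact hV x h

theorem typeU_one {M : Finset (Pair n)} (hM : M ∈ typeU n k) {r : Pair n} (hr : r ∈ M)
    (hr1 : r.left = 1) : r.right < k := by
  obtain ⟨p, V, hV, _, hp, rfl⟩ := hM
  rwa [eq_of_mem_insert_one (baseSet_subset_noRow_one hV) hr hr1]

theorem typeB_one {M : Finset (Pair n)} (hM : M ∈ typeB n k) {r : Pair n} (hr : r ∈ M)
    (hr1 : r.left = 1) : k < r.right := by
  obtain ⟨p, V, hV, _, hp, rfl⟩ := hM
  rwa [eq_of_mem_insert_one (baseSet_subset_noRow_one hV) hr hr1]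

theorem typeD_one {M : Finset (Pair n)} (hM : M ∈ typeD n k) {r : Pair n} (hr : r ∈ M)
    (hr1 : r.left = 1) : r.right = k := by
  obtain ⟨p, V, hV, q, _, _, hp, _, rfl⟩ := hM
  rwa [eq_of_mem_insert_one (erase_mem_noRow (baseSet_subset_noRow_one hV) q) hr hr1]

theorem typeA_one (hk : 2 ≤ k) {M : Finset (Pair n)} (hM : M ∈ typeA n k) {r : Pair n}
    (hr : r ∈ M) (hr1 : r.left = 1) : r.right = k := by
  obtain ⟨p, q, V, hV, _, hp, hq, rfl⟩ := hM
  rwa [eq_of_mem_insert_one (insert_mem_noRow (baseSet_subset_noRow_one hV) (by omega)) hr hr1]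

theorem exists_one_of_mem {M : Finset (Pair n)}
    (hM : M ∈ (typeA n k ∪ typeB n k) ∪ (typeU n k ∪ typeD n k)) : ∃ r ∈ M, r.left = 1 := by
  rcases hM with (⟨p, q, V, -, h, -, -, rfl⟩ | ⟨p, V, -, h, -, rfl⟩) |
    (⟨p, V, -, h, -, rfl⟩ | ⟨p, V, -, q, -, h, -, -, rfl⟩) <;>
  exact ⟨p, Finset.mem_insert_self _ _, h⟩

theorem typeD_not_row (hk : 2 ≤ k) {M : Finset (Pair n)} (hM : M ∈ typeD n k) : M ∈ noRow n k := by
  obtain ⟨p, V, hV, q, _, hp1, _, _, rfl⟩ := hM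
  exact insert_mem_noRow (erase_mem_noRow (baseSet_subset_noRow hV) q) (by omega)

theorem not_typeD_of_typeA (hk : 2 ≤ k) {M : Finset (Pair n)} (hM : M ∈ typeA n k) :
    M ∉ typeD n k := by
  intro h
  obtain ⟨p, q, V, hV, _, hp, hq, rfl⟩ := hM
  exact typeD_not_row hk h q (by simp) hq

theorem not_typeU_of_typeA (hk : 2 ≤ k) {M : Finset (Pair n)} (hM : M ∈ typeA n k) :
    M ∉ typeU n k := by
  intro h
  obtain ⟨r, hr, hr1⟩ := exists_one_of_mem (Or.inl (Or.inl hM))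
  exact (typeU_one h hr hr1).ne (typeA_one hk hM hr hr1)

theorem not_typeU_of_typeB {M : Finset (Pair n)} (hM : M ∈ typeB n k) : M ∉ typeU n k := by
  intro h
  obtain ⟨r, hr, hr1⟩ := exists_one_of_mem (Or.inl (Or.inr hM))
  have h1 := typeU_one h hr hr1
  have h2 := typeB_one hM hr hr1
  omega

theorem not_typeD_of_typeB {M : Finset (Pair n)} (hM : M ∈ typeB n k) : M ∉ typeD n k := by
  intro h
  obtain ⟨r, hr, hr1⟩ := exists_one_of_mem (Or.inl (Or.inr hM))
  have h1 := typeD_one h hr hr1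
  have h2 := typeB_one hM hr hr1
  omega

theorem not_typeD_of_typeU {M : Finset (Pair n)} (hM : M ∈ typeU n k) : M ∉ typeD n k := by
  intro h
  obtain ⟨r, hr, hr1⟩ := exists_one_of_mem (Or.inr (Or.inl hM))
  have h1 := typeD_one h hr hr1
  have h2 := typeU_one hM hr hr1
  omega

theorem IsPartner.mem_typeU {M N : Finset (Pair n)} (h : IsPartner k M N) : M ∈ typeU n k := by
  obtain ⟨p, q, hpq, V, hV, hq, hp, hqk, rfl, rfl⟩ := h
  have := q.left_lt_right
  exact ⟨p, V, hV, hp, by omega, rfl⟩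

theorem IsPartner.mem_typeD {M N : Finset (Pair n)} (h : IsPartner k M N) : N ∈ typeD n k := by
  obtain ⟨p, q, hpq, V, hV, hq, hp, hqk, rfl, rfl⟩ := h
  exact ⟨p.comp q hpq, V, hV, q, hq, hp, hqk, hqk, rfl⟩

theorem exists_isPartner_of_typeU {M : Finset (Pair n)} (hM : M ∈ typeU n k) :
    ∃ N, IsPartner k M N := by
  obtain ⟨p, V, hV, hp1, hpk, rfl⟩ := hM
  have := p.left_lt_right
  obtain ⟨q, hq, hq1, hq2⟩ := hV.2 p.right (Finset.mem_Ico.mpr ⟨by omega, hpk⟩)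
  exact ⟨_, p, q, hq1.symm, V, hV, hq, hp1, hq2, rfl, rfl⟩

theorem exists_isPartner_of_typeD {N : Finset (Pair n)} (hN : N ∈ typeD n k) :
    ∃ M, IsPartner k M N := by
  obtain ⟨p, V, hV, q, hq, hp1, hpk, hqk, rfl⟩ := hN
  have h1 := q.left_lt_right
  have h2 := q.left_pos
  have h3 := (hV.1 q hq).1
  obtain ⟨r, hr1, hr2⟩ := Pair.exists_mk (n := n) (a := 1) (b := q.left) le_rfl (by omega)
    (h1.le.trans q.right_le)
  refine ⟨_, r, q, hr2, V, hV, hq, hr1, hqk, rfl, ?_⟩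
  congr 1
  exact Pair.ext_iff'.mpr ⟨hp1.trans hr1.symm, hpk.trans hqk.symm⟩

theorem IsPartner.right_unique {M N N' : Finset (Pair n)} (h : IsPartner k M N)
    (h' : IsPartner k M N') : N = N' := by
  obtain ⟨p, q, hpq, V, hV, hq, hp, hqk, rfl, rfl⟩ := h
  obtain ⟨p', q', hpq', V', hV', hq', hp', hqk', hM, rfl⟩ := h'
  have h1 : p = p' := eq_of_mem_insert_one (baseSet_subset_noRow_one hV')
    (hM ▸ Finset.mem_insert_self _ _) hp
  subst h1
  have h2 : q = q' := Pair.ext_iff'.mpr ⟨hpq.symm.trans hpq', hqk.trans hqk'.symm⟩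
  subst h2
  have h3 : V = V' := by
    rw [← Finset.erase_insert (s := V) (a := p) fun h => (hV.1 p h).1 hp, hM,
      Finset.erase_insert fun h => (hV'.1 p h).1 hp]
  rw [h3]

/-- The missing entry (b,k) of column `k` can be read off from the D-generator, and it determines
(1,b). -/
theorem IsPartner.left_unique {M M' N : Finset (Pair n)} (h : IsPartner k M N)
    (h' : IsPartner k M' N) : M = M' := by
  obtain ⟨p, q, hpq, V, hV, hq, hp, hqk, rfl, rfl⟩ := h
  obtain ⟨p', q', hpq', V', hV', hq', hp', hqk', rfl, hN⟩ := h'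
  have h1 : p.comp q hpq = p'.comp q' hpq' :=
    Pair.ext_iff'.mpr ⟨hp.trans hp'.symm, hqk.trans hqk'.symm⟩
  have h2 : V.erase q = V'.erase q' := by
    rw [← Finset.erase_insert (s := V.erase q) (a := p.comp q hpq)
      fun h => erase_mem_noRow (baseSet_subset_noRow_one hV) q _ h hp, hN, h1,
      Finset.erase_insert (a := p'.comp q' hpq')
        fun h => erase_mem_noRow (baseSet_subset_noRow_one hV') q' _ h hp']
  have h3 : q = q' := by
    by_contra hne
    obtain ⟨r, hr, hr1, hr2⟩ := hV'.2 q.left (Finset.mem_Ico.mpr ⟨by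
      have := q.left_pos
      have := (hV.1 q hq).1
      omega, hqk ▸ q.left_lt_right⟩)
    have hrq : r = q := Pair.ext_iff'.mpr ⟨hr1, hr2.trans hqk.symm⟩
    subst hrq
    -- If the missing entries differed, the first would be present in the second description.
    have h4 : r ∈ V.erase r := h2 ▸ Finset.mem_erase.mpr ⟨hne, hr⟩
    exact (Finset.mem_erase.mp h4).1 rfl
  subst h3
  have h4 : V = V' := by rw [← Finset.insert_erase hq, h2, Finset.insert_erase hq']
  have h5 : p = p' := Pair.ext_iff'.mpr ⟨hp.trans hp'.symm, hpq.trans hpq'.symm⟩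
  rw [h4, h5]

theorem IsPartner.card_eq {M N : Finset (Pair n)} (h : IsPartner k M N) : M.card = N.card + 1 := by
  obtain ⟨p, q, hpq, V, hV, hq, hp, hqk, rfl, rfl⟩ := h
  rw [Finset.card_insert_of_notMem fun h => (hV.1 p h).1 hp,
    Finset.card_insert_of_notMem (a := p.comp q hpq)
      fun h => erase_mem_noRow (baseSet_subset_noRow_one hV) q _ h hp,
    Finset.card_erase_add_one hq]

theorem IsPartner.mem_gens_iff {w : ℕ → ℤ} {M N : Finset (Pair n)} (h : IsPartner k M N) :
    M ∈ gens n w ↔ N ∈ gens n w := by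
  obtain ⟨p, q, hpq, V, hV, hq, hp, hqk, rfl, rfl⟩ := h
  have h1 : (insert p V).erase p = V := Finset.erase_insert fun h => (hV.1 p h).1 hp
  have h2 := weight_insert (insert p V) p q hpq (Finset.mem_insert_self _ _)
    (Finset.mem_insert_of_mem hq)
    (by rw [h1]; exact fun h => erase_mem_noRow (baseSet_subset_noRow_one hV) q _ h hp)
  rw [h1] at h2
  simp only [gens, Set.mem_ofPred_eq, h2]

theorem wedgeSpan_sup (S T : Set (Finset (Pair n))) :
    wedgeSpan S ⊔ wedgeSpan T = wedgeSpan (S ∪ T) := by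
  rw [wedgeSpan, wedgeSpan, wedgeSpan, Set.image_union, Submodule.span_union]

/-- This is `bd_typeU` for a single generator, whose contraction at (b,k) is ± the wedge with that
pair removed. -/
theorem IsPartner.bd_wedge (hk : 2 ≤ k) {M N : Finset (Pair n)} (h : IsPartner k M N) :
    bd n (wedge n M) + wedge n N ∈ wedgeSpan (typeU n k ∪ typeB n k) ∨
      bd n (wedge n M) - wedge n N ∈ wedgeSpan (typeU n k ∪ typeB n k) := by
  obtain ⟨p, q, hpq, V, hV, hq, hp, hqk, rfl, rfl⟩ := h
  have h1 := p.left_lt_right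
  have h2 := q.left_lt_right
  have h3 := q.right_le
  have h4 := bd_typeU (b := p.right) hk (by omega) (Finset.mem_Ico.mpr ⟨by omega, by omega⟩)
    (wedge_mem_wedgeSpan hV)
  have h5 : (p.comp q hpq).right = k := hqk
  rw [wedgeSpan_sup, ← wedge_insert_one hp (baseSet_subset_noRow_one hV)] at h4
  rw [wedge_insert_one (p := p.comp q hpq) hp (erase_mem_noRow (baseSet_subset_noRow_one hV) q), h5]
  rw [hpq] at h4
  rcases ctr_wedge_eq_or hq with h6 | h6
  · rw [hqk] at h6
    rw [h6] at h4
    exact Or.inl h4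
  · rw [hqk] at h6
    rw [h6, mul_neg, ← sub_eq_add_neg] at h4
    exact Or.inr h4

theorem IsPartner.repr_bd (hk : 2 ≤ k) {M N : Finset (Pair n)} (h : IsPartner k M N) :
    IsUnit ((wedge n).repr (bd n (wedge n M)) N) := by
  have hN : N ∉ typeU n k ∪ typeB n k := by
    rintro (h' | h')
    · exact not_typeD_of_typeU h' h.mem_typeD
    · exact not_typeD_of_typeB h' h.mem_typeD
  rcases h.bd_wedge hk with h' | h'
  · have h1 := repr_eq_zero_of_mem_wedgeSpan h' hN
    rw [map_add, Finsupp.add_apply, Module.Basis.repr_self, Finsupp.single_eq_same] at h1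
    rw [eq_neg_of_add_eq_zero_left h1]
    exact isUnit_one.neg
  · have h1 := repr_eq_zero_of_mem_wedgeSpan h' hN
    rw [map_sub, Finsupp.sub_apply, Module.Basis.repr_self, Finsupp.single_eq_same] at h1
    rw [sub_eq_zero.mp h1]
    exact isUnit_one

theorem mem_of_repr_bd_typeU_ne_zero (hk : 2 ≤ k) {M N : Finset (Pair n)} (hM : M ∈ typeU n k)
    (h : (wedge n).repr (bd n (wedge n M)) N ≠ 0) :
    N ∈ typeU n k ∪ typeB n k ∨ IsPartner k M N := by
  obtain ⟨N', hN'⟩ := exists_isPartner_of_typeU hM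
  by_cases hN : N' = N
  · exact Or.inr (hN ▸ hN')
  refine Or.inl (by_contra fun hU => h ?_)
  rcases hN'.bd_wedge hk with h' | h'
  · have h1 := repr_eq_zero_of_mem_wedgeSpan h' hU
    rwa [map_add, Finsupp.add_apply, Module.Basis.repr_self, Finsupp.single_eq_of_ne (Ne.symm hN),
      add_zero] at h1
  · have h1 := repr_eq_zero_of_mem_wedgeSpan h' hU
    rwa [map_sub, Finsupp.sub_apply, Module.Basis.repr_self, Finsupp.single_eq_of_ne (Ne.symm hN),
      sub_zero] at h1

/-- The matching of the generators in `typeU n k` with those in `typeD n k`. -/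
def matching (n : ℕ) (w : ℕ → ℤ) (k : ℕ) : Set (gens n w × gens n w) :=
  {P | IsPartner k P.1.1 P.2.1}

theorem degree_eq_of_digraph_ne_zero {w : ℕ → ℤ} (M N : gens n w) (h : digraph n w M N ≠ 0) :
    degree n w M = degree n w N + 1 := by
  have h1 := bd_mem_spanDeg (gens_closed n w) (i := M.1.card) (j := M.1.card - 1) (by ring)
    (wedge n M.1) (wedge_mem_wedgeSpan ⟨M.2, rfl⟩)
  have h2 : (N.1.card : ℤ) = M.1.card - 1 := (mem_wedgeSpan.mp h1 N.1 h).2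
  unfold degree
  omega

variable {w : ℕ → ℤ}

/-- The boundary of a U-generator meets D only in its partner. This is the locality hypothesis
`hloc` of the path computation. -/
theorem digraph_matching (hk : 2 ≤ k) :
    ∀ P ∈ matching n w k, ∀ Q ∈ matching n w k, digraph n w P.1 Q.2 ≠ 0 → P = Q := by
  rintro ⟨M, N⟩ hP ⟨M', N'⟩ hQ h
  rcases mem_of_repr_bd_typeU_ne_zero hk hP.mem_typeU h with (h' | h') | h'
  · exact absurd hQ.mem_typeD (not_typeD_of_typeU h')
  · exact absurd hQ.mem_typeD (not_typeD_of_typeB h')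
  · exact Prod.ext (Subtype.ext (IsPartner.left_unique h' hQ))
      (Subtype.ext (IsPartner.right_unique hP h'))

-- A reversed edge raises the cardinality by one and removes (1,k), changing the potential by 2 - 3.
-- Any other edge lowers the cardinality by one and cannot create (1,k): A and D contain it already,
-- ∂ preserves B, and from U it arises only along the matching.
open Classical in
theorem potential_lt (hk : 2 ≤ k) (hkn : k ≤ n) (hw1 : w 1 = 2) (hwk : w k = 2) (M N : gens n w)
    (h : Edge (reversed (digraph n w) (matching n w k)) M N) :
    2 * N.1.card + (if HasPair N.1 1 k then 3 else 0) <
      2 * M.1.card + (if HasPair M.1 1 k then 3 else 0) := by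
  rcases edge_reversed h with h | ⟨-, h1, h2⟩
  · have h1 : IsPartner k N.1 M.1 := h
    have h2 := h1.card_eq
    have h3 : HasPair M.1 1 k := by
      obtain ⟨p, hp, hp1⟩ := exists_one_of_mem (Or.inr (Or.inr h1.mem_typeD))
      exact ⟨p, hp, hp1, typeD_one h1.mem_typeD hp hp1⟩
    have h4 : ¬HasPair N.1 1 k := by
      rintro ⟨p, hp, hp1, hpk⟩
      exact (typeU_one h1.mem_typeU hp hp1).ne hpk
    rw [if_pos h3, if_neg h4]
    omega
  · have h3 := degree_eq_of_digraph_ne_zero M N h2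
    unfold degree at h3
    have h4 : HasPair N.1 1 k → HasPair M.1 1 k := by
      rintro ⟨p, hp, hp1, hpk⟩
      have hNU : N.1 ∉ typeU n k := fun h => (typeU_one h hp hp1).ne hpk
      have hNB : N.1 ∉ typeB n k := fun h => (typeB_one h hp hp1).ne' hpk
      obtain ⟨r, hr, hr1⟩ := exists_one_of_mem (gens_subset hk hkn hw1 hwk M.2)
      rcases gens_subset hk hkn hw1 hwk M.2 with (hM | hM) | (hM | hM)
      · exact ⟨r, hr, hr1, typeA_one hk hM hr hr1⟩
      · exact absurd (mem_wedgeSpan.mp (bd_mem_typeB hk (wedge_mem_wedgeSpan hM)) _ h2) hNB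
      · rcases mem_of_repr_bd_typeU_ne_zero hk hM h2 with (h' | h') | h'
        · exact absurd h' hNU
        · exact absurd h' hNB
        · exact absurd h' h1
      · exact ⟨r, hr, hr1, typeD_one hM hr hr1⟩
    split_ifs with h5 h6
    · omega
    · exact absurd (h4 h5) h6
    · omega
    · omega

theorem isMorseMatching (hk : 2 ≤ k) (hkn : k ≤ n) (hw1 : w 1 = 2) (hwk : w k = 2) :
    IsMorseMatching (degree n w) (digraph n w) (matching n w k) where
  edge P hP := (IsPartner.repr_bd hk hP).ne_zero
  disjoint := by
    intro P hP Q hQ hne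
    have hP' : IsPartner k P.1.1 P.2.1 := hP
    have hQ' : IsPartner k Q.1.1 Q.2.1 := hQ
    refine ⟨fun h => hne ?_, fun h => ?_, fun h => ?_, fun h => hne ?_⟩
    · rw [← h] at hQ'
      exact Prod.ext h (Subtype.ext (hP'.right_unique hQ'))
    · rw [← h] at hQ'
      exact not_typeD_of_typeU hP'.mem_typeU hQ'.mem_typeD
    · rw [← h] at hQ'
      exact not_typeD_of_typeU hQ'.mem_typeU hP'.mem_typeD
    · rw [← h] at hQ'
      exact Prod.ext (Subtype.ext (hP'.left_unique hQ')) h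
  isUnit P hP := IsPartner.repr_bd hk hP
  acyclic := not_transGen_of_lt _ (potential_lt hk hkn hw1 hwk)
  noInfinitePath d := by
    rintro ⟨f, hf⟩
    exact not_exists_infinite_path_of_lt _ (potential_lt hk hkn hw1 hwk) ⟨f, fun i => (hf i).1⟩

theorem mem_critical_matching (hk : 2 ≤ k) (hkn : k ≤ n) (hw1 : w 1 = 2) (hwk : w k = 2)
    (N : gens n w) : N ∈ critical (matching n w k) ↔ N.1 ∈ typeA n k ∪ typeB n k := by
  constructor
  · intro h
    rcases gens_subset hk hkn hw1 hwk N.2 with hN | hN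
    · exact hN
    exfalso
    rcases hN with hN | hN
    · obtain ⟨N', h'⟩ := exists_isPartner_of_typeU hN
      exact (h (N, ⟨N', h'.mem_gens_iff.mp N.2⟩) h').1 rfl
    · obtain ⟨N', h'⟩ := exists_isPartner_of_typeD hN
      exact (h (⟨N', h'.mem_gens_iff.mpr N.2⟩, N) h').2 rfl
  · intro hN P hP
    have hP' : IsPartner k P.1.1 P.2.1 := hP
    constructor
    · rintro rfl
      rcases hN with h | h
      · exact not_typeU_of_typeA hk h hP'.mem_typeU
      · exact not_typeU_of_typeB h hP'.mem_typeU
    · rintro rfl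
      rcases hN with h | h
      · exact not_typeD_of_typeA hk h hP'.mem_typeD
      · exact not_typeD_of_typeB h hP'.mem_typeD

/-- Among the generators of ⟦w⟧, the pairs (1,k) and (k,a) already single out type A. -/
theorem setA_eq (hk : 2 ≤ k) (hkn : k ≤ n) (hw1 : w 1 = 2) (hwk : w k = 2) :
    setA n w k = typeA n k ∩ gens n w := by
  ext N
  constructor
  · rintro ⟨a, M, ⟨hka, han, hdisj, hN⟩, rfl⟩
    refine ⟨?_, hN⟩
    obtain ⟨p, hp1, hpk⟩ := Pair.exists_mk (n := n) (a := 1) (b := k) le_rfl (by omega) hkn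
    obtain ⟨q, hq1, hqa⟩ := Pair.exists_mk (n := n) (a := k) (b := a) (by omega) hka han
    have hp : p ∈ pairsA n k a ∪ M :=
      Finset.mem_union_left _ (Finset.mem_filter.mpr ⟨Finset.mem_univ _, Or.inl hpk⟩)
    have hq : q ∈ pairsA n k a ∪ M :=
      Finset.mem_union_left _ (Finset.mem_filter.mpr ⟨Finset.mem_univ _, Or.inr ⟨hq1, hqa⟩⟩)
    rcases gens_subset hk hkn hw1 hwk hN with (h | h) | (h | h)
    · exact h
    · exact absurd hpk (typeB_one h hp hp1).ne'
    · exact absurd hpk (typeU_one h hp hp1).ne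
    · exact absurd hq1 (typeD_not_row hk h q hq)
  · rintro ⟨⟨p, q, V, hV, hp1, hpk, hqk, rfl⟩, hN⟩
    have h1 : pairsA n k q.right ⊆ insert p (insert q V) := by
      intro r hr
      rcases (Finset.mem_filter.mp hr).2 with h | ⟨h, h'⟩
      · have h2 := r.left_lt_right
        have h3 := r.left_pos
        by_cases h4 : r.left = 1
        · rw [Pair.ext_iff'.mpr ⟨h4.trans hp1.symm, h.trans hpk.symm⟩]
          simp
        · obtain ⟨s, hs, hs1, hs2⟩ := hV.2 r.left (Finset.mem_Ico.mpr ⟨by omega, by omega⟩)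
          rw [Pair.ext_iff'.mpr ⟨hs1.symm, h.trans hs2.symm⟩]
          simp [hs]
      · rw [Pair.ext_iff'.mpr ⟨h.trans hqk.symm, h'⟩]
        simp
    have h2 := Finset.union_sdiff_of_subset h1
    exact ⟨q.right, insert p (insert q V) \ pairsA n k q.right,
      ⟨hqk ▸ q.left_lt_right, q.right_le, Finset.disjoint_sdiff, h2.symm ▸ hN⟩, h2.symm⟩

theorem setB_eq (hk : 2 ≤ k) (hkn : k ≤ n) (hw1 : w 1 = 2) (hwk : w k = 2) :
    setB n w k = typeB n k ∩ gens n w := by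
  ext N
  constructor
  · rintro ⟨a, M, ⟨hka, han, hdisj, hN⟩, rfl⟩
    refine ⟨?_, hN⟩
    obtain ⟨p, hp1, hpa⟩ := Pair.exists_mk (n := n) (a := 1) (b := a) le_rfl (by omega) han
    have hp : p ∈ pairsB n k a ∪ M :=
      Finset.mem_union_left _ (Finset.mem_filter.mpr ⟨Finset.mem_univ _, Or.inl ⟨hp1, hpa⟩⟩)
    rcases gens_subset hk hkn hw1 hwk hN with (h | h) | (h | h)
    · have := typeA_one hk h hp hp1
      omega
    · exact h
    · have := typeU_one h hp hp1
      omega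
    · have := typeD_one h hp hp1
      omega
  · rintro ⟨⟨p, V, hV, hp1, hpk, rfl⟩, hN⟩
    have h1 : pairsB n k p.right ⊆ insert p V := by
      intro r hr
      rcases (Finset.mem_filter.mp hr).2 with ⟨h, h'⟩ | ⟨h, h'⟩
      · rw [Pair.ext_iff'.mpr ⟨h.trans hp1.symm, h'⟩]
        simp
      · have h2 := r.left_lt_right
        obtain ⟨s, hs, hs1, hs2⟩ := hV.2 r.left (Finset.mem_Ico.mpr ⟨by omega, by omega⟩)
        rw [Pair.ext_iff'.mpr ⟨hs1.symm, h'.trans hs2.symm⟩]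
        simp [hs]
    have h2 := Finset.union_sdiff_of_subset h1
    exact ⟨p.right, insert p V \ pairsB n k p.right,
      ⟨hpk, p.right_le, Finset.disjoint_sdiff, h2.symm ▸ hN⟩, h2.symm⟩

theorem image_critical_matching (hk : 2 ≤ k) (hkn : k ≤ n) (hw1 : w 1 = 2) (hwk : w k = 2) :
    Subtype.val '' critical (matching n w k) = setA n w k ∪ setB n w k := by
  rw [setA_eq hk hkn hw1 hwk, setB_eq hk hkn hw1 hwk, ← Set.union_inter_distrib_right]
  ext N
  constructor
  · rintro ⟨N, hN, rfl⟩
    exact ⟨(mem_critical_matching hk hkn hw1 hwk N).mp hN, N.2⟩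
  · rintro ⟨hN, hN'⟩
    exact ⟨⟨N, hN'⟩, (mem_critical_matching hk hkn hw1 hwk _).mpr hN, rfl⟩

end Matching

end NilTorsion

namespace NilTorsion

/-! ### The Morse boundary as the critical part of a corrected boundary. -/

section MorseBoundary

variable {n k : ℕ} {w : ℕ → ℤ}

theorem repr_incl (C : Set (gens n w)) (x : C →₀ ℤ) :
    (wedge n).repr (incl C x) = x.mapDomain fun M => M.1.1 := by
  rw [incl, Finsupp.linearCombination_apply, map_finsuppSum, Finsupp.mapDomain]
  simp only [map_smul, Module.Basis.repr_self, Finsupp.smul_single, smul_eq_mul, mul_one]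

open Classical in
theorem repr_bd_eq_sum [Fintype (gens n w)] {u : ExtNil n} (hu : u ∈ wedgeSpan (gens n w))
    (N : gens n w) : (wedge n).repr (bd n u) N =
      ∑ M : gens n w, (wedge n).repr u M * digraph n w M N := by
  have h := eqOn_wedgeSpan (S := gens n w)
    (f := Finsupp.lapply N.1 ∘ₗ (wedge n).repr.toLinearMap ∘ₗ bd n)
    (g := ∑ M : gens n w, digraph n w M N • (Finsupp.lapply M.1 ∘ₗ (wedge n).repr.toLinearMap))
    ?_ hu
  · simp only [LinearMap.comp_apply, LinearMap.sum_apply, LinearMap.smul_apply,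
      LinearEquiv.coe_coe, Finsupp.lapply_apply, smul_eq_mul] at h
    rw [h]
    exact Finset.sum_congr rfl fun _ _ => mul_comm _ _
  · intro M hM
    simp only [LinearMap.comp_apply, LinearMap.sum_apply, LinearMap.smul_apply,
      LinearEquiv.coe_coe, Finsupp.lapply_apply, smul_eq_mul, Module.Basis.repr_self]
    rw [Finset.sum_eq_single ⟨M, hM⟩]
    · rw [Finsupp.single_eq_same, mul_one]
      rfl
    · intro M' _ h'
      rw [Finsupp.single_eq_of_ne, mul_zero]
      exact fun h => h' (Subtype.ext h)
    · exact fun h => absurd (Finset.mem_univ _) h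

/-- The Morse boundary of a critical generator is the critical part of the boundary of any
`u` that arises from it by adding generators in `typeU n k`, and whose boundary
has no components in `typeD n k`. -/
theorem incl_morseBoundary (hk : 2 ≤ k) (hkn : k ≤ n) (hw1 : w 1 = 2) (hwk : w k = 2)
    (N : critical (matching n w k)) {u t : ExtNil n}
    (hu : u ∈ spanDeg (gens n w) (N.1.1.card : ℤ))
    (huN : u - wedge n N.1.1 ∈ wedgeSpan (typeU n k))
    (ht : t ∈ wedgeSpan (typeA n k ∪ typeB n k)) (hbd : bd n u - t ∈ wedgeSpan (typeU n k)) :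
    incl (critical (matching n w k)) (morseBoundary (degree n w) (digraph n w) (matching n w k)
      (Finsupp.single N 1)) = t := by
  classical
  have := Fintype.ofFinite (gens n w)
  have hM := isMorseMatching hk hkn hw1 hwk
  have huw : u ∈ wedgeSpan (gens n w) := wedgeSpan_mono Set.inter_subset_left hu
  have hNw : wedge n N.1.1 ∈ wedgeSpan (gens n w) := wedge_mem_wedgeSpan N.1.2
  have hbdu := bd_mem_spanDeg (gens_closed n w) (sub_add_cancel (N.1.1.card : ℤ) 1) u hu
  have hreprU : ∀ M, M ∉ typeU n k → (wedge n).repr (bd n u) M = (wedge n).repr t M := by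
    intro M hM
    have h := repr_eq_zero_of_mem_wedgeSpan hbd hM
    rwa [map_sub, Finsupp.sub_apply, sub_eq_zero] at h
  have hAB : ∀ M ∈ typeA n k ∪ typeB n k, M ∉ typeU n k := by
    rintro M (h | h)
    · exact not_typeU_of_typeA hk h
    · exact not_typeU_of_typeB h
  -- The coefficients of `u - e_N` play the role of `c` in `morseCoeff_eq`.
  have hsum : ∀ M : gens n w, digraph n w N.1 M +
      ∑ x : gens n w, (wedge n).repr (u - wedge n N.1.1) x * digraph n w x M =
        (wedge n).repr (bd n u) M := by
    intro M
    rw [← repr_bd_eq_sum (Submodule.sub_mem _ huw hNw), map_sub, map_sub, Finsupp.sub_apply]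
    exact add_sub_cancel _ _
  have hcoeff : ∀ M : critical (matching n w k), morseBoundary (degree n w) (digraph n w)
      (matching n w k) (Finsupp.single N 1) M = (wedge n).repr t M.1.1 := by
    intro M
    have hMAB := (mem_critical_matching hk hkn hw1 hwk _).mp M.2
    rw [morseBoundary, Finsupp.linearCombination_single, one_smul,
      Finsupp.equivFunOnFinite_symm_apply_apply, ← hreprU _ (hAB _ hMAB)]
    split_ifs with h
    · rw [morseCoeff_eq hM degree_eq_of_digraph_ne_zero (digraph_matching hk) N.2 M.2 h
        (fun x => (wedge n).repr (u - wedge n N.1.1) x) ?_ ?_, hsum]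
      · intro x hx
        obtain ⟨N', h'⟩ := exists_isPartner_of_typeU (mem_wedgeSpan.mp huN _ hx)
        exact ⟨(x, ⟨N', h'.mem_gens_iff.mp x.2⟩), h', rfl⟩
      · intro P hP
        have hP' := IsPartner.mem_typeD hP
        rw [hsum, hreprU _ fun h => not_typeD_of_typeU h hP']
        refine repr_eq_zero_of_mem_wedgeSpan ht ?_
        rintro (h' | h')
        · exact not_typeD_of_typeA hk h' hP'
        · exact not_typeD_of_typeB h' hP'
    · symm
      refine repr_eq_zero_of_mem_wedgeSpan hbdu fun h' => h ?_
      have h2 : (M.1.1.card : ℤ) = N.1.1.card - 1 := h'.2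
      unfold degree
      omega
  apply (wedge n).repr.injective
  ext M
  rw [repr_incl]
  by_cases hMt : ∃ M' : critical (matching n w k), M'.1.1 = M
  · obtain ⟨M', rfl⟩ := hMt
    rw [Finsupp.mapDomain_apply (f := fun M : critical (matching n w k) => M.1.1)
      (fun _ _ h => Subtype.ext (Subtype.ext h)), hcoeff]
  · rw [Finsupp.mapDomain_of_notMem_range]
    -- A component of `t` has type A or B and occurs in the boundary of `u`, hence lies in ⟦w⟧ and
    -- is critical.
    · by_contra h
      have h1 := mem_wedgeSpan.mp ht M (Ne.symm h)
      have h2 : (wedge n).repr (bd n u) M ≠ 0 := by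
        rw [hreprU _ (hAB _ h1)]
        exact Ne.symm h
      have h3 := (mem_wedgeSpan.mp hbdu M h2).1
      exact hMt ⟨⟨⟨M, h3⟩, (mem_critical_matching hk hkn hw1 hwk _).mpr h1⟩, rfl⟩
    · rintro ⟨M', rfl⟩
      exact hMt ⟨M', rfl⟩

/-- The boundary stays in B, so no correction is necessary: u is the generator itself. -/
theorem incl_morseBoundary_of_typeB (hk : 2 ≤ k) (hkn : k ≤ n) (hw1 : w 1 = 2) (hwk : w k = 2)
    (N : critical (matching n w k)) (hN : N.1.1 ∈ typeB n k) :
    incl (critical (matching n w k)) (morseBoundary (degree n w) (digraph n w) (matching n w k)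
      (Finsupp.single N 1)) = bd n (wedge n N.1.1) :=
  incl_morseBoundary hk hkn hw1 hwk N (wedge_mem_wedgeSpan ⟨N.1.2, rfl⟩)
    (by rw [sub_self]; exact Submodule.zero_mem _)
    (wedgeSpan_mono Set.subset_union_right (bd_mem_typeB hk (wedge_mem_wedgeSpan hN)))
    (by rw [sub_self]; exact Submodule.zero_mem _)

end MorseBoundary

end NilTorsion

namespace NilTorsion

/-! ### Products of the entries of column k. -/

section ColumnProduct

variable {n k : ℕ}

theorem e_mul_prod_column (a b : ℕ) (l : List ℕ) (u : ExtNil n) :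
    e n a b * ((l.map fun i => e n i k).prod * u) =
      (-1 : ℤ) ^ l.length • ((l.map fun i => e n i k).prod * (e n a b * u)) := by
  induction l with
  | nil => simp
  | cons i l ih =>
    rw [List.map_cons, List.prod_cons, mul_assoc, e_mul_left_comm, ih, mul_smul_comm, mul_assoc,
      List.length_cons, pow_succ, mul_neg_one, neg_smul]

theorem e_mul_prod_column_of_mem {i : ℕ} {l : List ℕ} (h : i ∈ l) (u : ExtNil n) :
    e n i k * ((l.map fun i => e n i k).prod * u) = 0 := by
  induction l with
  | nil => simp at h
  | cons j l ih =>
    rw [List.map_cons, List.prod_cons, mul_assoc]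
    rcases List.mem_cons.mp h with rfl | h
    · exact e_mul_e_mul_self _ _ _
    · rw [e_mul_left_comm, ih h, mul_zero, neg_zero]

theorem ctr_prod_column {a b : ℕ} (hb : b ≠ k) (l : List ℕ) (u : ExtNil n) :
    ctr n a b ((l.map fun i => e n i k).prod * u) =
      (-1 : ℤ) ^ l.length • ((l.map fun i => e n i k).prod * ctr n a b u) := by
  induction l with
  | nil => simp
  | cons i l ih =>
    rw [List.map_cons, List.prod_cons, mul_assoc, ctr_e_mul_of_ne (Or.inr hb), ih, mul_smul_comm,
      mul_assoc, List.length_cons, pow_succ, mul_neg_one, neg_smul]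

theorem prod_column_mem_noRow {r : ℕ} (hkn : k ≤ n) {l : List ℕ}
    (hl : ∀ i ∈ l, i ≠ r ∧ 1 ≤ i ∧ i < k) {u : ExtNil n} (hu : u ∈ wedgeSpan (noRow n r)) :
    (l.map fun i => e n i k).prod * u ∈ wedgeSpan (noRow n r) := by
  induction l with
  | nil => simpa using hu
  | cons i l ih =>
    rw [List.map_cons, List.prod_cons, mul_assoc]
    obtain ⟨h1, h2, h3⟩ := hl i List.mem_cons_self
    exact e_mul_mem_noRow h1 h2 h3 hkn (ih fun j hj => hl j (List.mem_cons_of_mem _ hj))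

/-- Brackets with column entries contribute nothing: (k,c) does not occur, and `[e_{xt}, e_{tk}] =
e_{xk}` repeats a factor for x ≥ 2, while x = 1 does not occur. -/
theorem bd_prod_column (hkn : k ≤ n) {u : ExtNil n} (hu : u ∈ wedgeSpan (noRow n 1))
    (hu' : u ∈ wedgeSpan (noRow n k)) {t : ℕ} (ht : 2 ≤ t) (htk : t ≤ k) :
    bd n (((List.Ico 2 t).map fun i => e n i k).prod * u) =
      (-1 : ℤ) ^ (t - 2) • (((List.Ico 2 t).map fun i => e n i k).prod * bd n u) := by
  induction t, ht using Nat.le_induction with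
  | base => simp
  | succ t ht ih =>
    have hmem : ∀ {r}, r = 1 ∨ r = k → ∀ i ∈ List.Ico 2 t, i ≠ r ∧ 1 ≤ i ∧ i < k := by
      intro r hr i hi
      have := List.Ico.mem.mp hi
      omega
    -- The new last factor is moved to the front past t - 2 others, so that `bd_e_mul` applies.
    have h1 : ∀ v : ExtNil n, ((List.Ico 2 (t + 1)).map fun i => e n i k).prod * v =
        (-1 : ℤ) ^ (t - 2) • (e n t k * (((List.Ico 2 t).map fun i => e n i k).prod * v)) := by
      intro v
      rw [e_mul_prod_column, List.Ico.length, smul_smul, ← mul_pow, neg_one_mul, neg_neg, one_pow,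
        one_smul, List.Ico.succ_top ht, List.map_append, List.prod_append, mul_assoc]
      simp
    rw [h1, h1, map_smul, bd_e_mul (by omega) (by omega) hkn, ih (by omega)]
    have h2 : ∀ c ∈ Finset.Ioc k n,
        e n t c * ctr n k c (((List.Ico 2 t).map fun i => e n i k).prod * u) = 0 := by
      intro c hc
      rw [ctr_eq_zero_of_noRow (prod_column_mem_noRow hkn (hmem (Or.inr rfl)) hu'), mul_zero]
    have h3 : ∀ x ∈ Finset.Ico 1 t,
        e n x k * ctr n x t (((List.Ico 2 t).map fun i => e n i k).prod * u) = 0 := by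
      intro x hx
      obtain ⟨hx1, hx2⟩ := Finset.mem_Ico.mp hx
      rcases hx1.eq_or_lt with rfl | hx1
      · rw [ctr_eq_zero_of_noRow (prod_column_mem_noRow hkn (hmem (Or.inl rfl)) hu), mul_zero]
      · rw [ctr_prod_column (by omega), mul_smul_comm,
          e_mul_prod_column_of_mem (List.Ico.mem.mpr ⟨hx1, hx2⟩), smul_zero]
    rw [Finset.sum_eq_zero h2, Finset.sum_eq_zero h3, neg_zero, zero_add, zero_sub, mul_smul_comm,
      show t + 1 - 2 = t - 2 + 1 by omega, pow_succ, mul_neg_one, neg_smul, smul_neg]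

theorem neg_one_pow_sub_two (hk : 2 ≤ k) : (-1 : ℤ) ^ (k - 2) = (-1) ^ k := by
  obtain ⟨j, rfl⟩ := Nat.exists_eq_add_of_le hk
  rw [Nat.add_sub_cancel_left, pow_add, neg_one_sq, one_mul]

theorem e_mul_col (hk : 2 ≤ k) (a b : ℕ) (u : ExtNil n) :
    e n a b * (col n 2 k * u) = (-1 : ℤ) ^ k • (col n 2 k * (e n a b * u)) := by
  rw [col, e_mul_prod_column, List.Ico.length, neg_one_pow_sub_two hk]

theorem ctr_col (hk : 2 ≤ k) {a b : ℕ} (hb : b ≠ k) (u : ExtNil n) :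
    ctr n a b (col n 2 k * u) = (-1 : ℤ) ^ k • (col n 2 k * ctr n a b u) := by
  rw [col, ctr_prod_column hb, List.Ico.length, neg_one_pow_sub_two hk]

theorem bd_col (hk : 2 ≤ k) (hkn : k ≤ n) {u : ExtNil n} (hu : u ∈ wedgeSpan (noRow n 1))
    (hu' : u ∈ wedgeSpan (noRow n k)) :
    bd n (col n 2 k * u) = (-1 : ℤ) ^ k • (col n 2 k * bd n u) := by
  rw [col, bd_prod_column hkn hu hu' hk le_rfl, neg_one_pow_sub_two hk]

theorem col_one (hk : 2 ≤ k) : col n 1 k = e n 1 k * col n 2 k := by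
  rw [col, List.Ico.eq_cons (by omega), List.map_cons, List.prod_cons, col]

open Classical in
theorem col_mul_wedge {s : ℕ} (hs : 1 ≤ s) (hsk : s ≤ k) (hkn : k ≤ n) {M : Finset (Pair n)}
    (hM : ∀ p ∈ M, p.right ≠ k) :
    col n s k * wedge n M =
        wedge n (Finset.univ.filter fun p => p ∈ M ∨ (p.right = k ∧ s ≤ p.left)) ∨
      col n s k * wedge n M =
        -wedge n (Finset.univ.filter fun p => p ∈ M ∨ (p.right = k ∧ s ≤ p.left)) := by
  induction hsk using Nat.decreasingInduction with
  | self =>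
    left
    rw [col, List.Ico.self_empty, List.map_nil, List.prod_nil, one_mul]
    congr 1
    ext p
    have := p.left_lt_right
    simp only [Finset.mem_filter, Finset.mem_univ, true_and]
    exact ⟨Or.inl, fun h => h.resolve_right (by omega)⟩
  | of_succ s hsk ih =>
    obtain ⟨p, hp1, hpk⟩ := Pair.exists_mk (n := n) (a := s) (b := k) hs hsk hkn
    have h1 : insert p (Finset.univ.filter fun p => p ∈ M ∨ (p.right = k ∧ s + 1 ≤ p.left)) =
        Finset.univ.filter fun p => p ∈ M ∨ (p.right = k ∧ s ≤ p.left) := by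
      ext r
      simp only [Finset.mem_insert, Finset.mem_filter, Finset.mem_univ, true_and, Pair.ext_iff']
      constructor
      · rintro (h | h | h)
        · exact Or.inr ⟨h.2.trans hpk, by omega⟩
        · exact Or.inl h
        · exact Or.inr ⟨h.1, by omega⟩
      · rintro (h | ⟨h, h'⟩)
        · exact Or.inr (Or.inl h)
        · rcases h'.eq_or_lt with h2 | h2
          · exact Or.inl ⟨by omega, by omega⟩
          · exact Or.inr (Or.inr ⟨h, h2⟩)
    have h2 := e_mul_wedge_of_notMem (p := p)
      (M := Finset.univ.filter fun p => p ∈ M ∨ (p.right = k ∧ s + 1 ≤ p.left)) (by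
        simp only [Finset.mem_filter, Finset.mem_univ, true_and]
        rintro (h | h)
        · exact hM p h hpk
        · omega)
    rw [h1, hp1, hpk] at h2
    have h3 : col n s k = e n s k * col n (s + 1) k := by
      rw [col, List.Ico.eq_cons hsk, List.map_cons, List.prod_cons, col]
    rw [h3, mul_assoc]
    rcases ih (by omega) with h4 | h4 <;> rcases h2 with h2 | h2 <;> rw [h4] <;>
      simp only [mul_neg, neg_neg, h2, true_or, or_true]

end ColumnProduct

end NilTorsion

namespace NilTorsion

/-! ### The Morse boundary on generators of type A. -/

section TypeA

variable {n k a : ℕ}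

theorem e_one_mul_e_mul_mem_typeA (hk : 2 ≤ k) (hkn : k ≤ n) {c : ℕ} (hc : c ∈ Finset.Ioc k n)
    {v : ExtNil n} (hv : v ∈ wedgeSpan (baseSet n k)) :
    e n 1 k * (e n k c * v) ∈ wedgeSpan (typeA n k) := by
  obtain ⟨h1, h2⟩ := Finset.mem_Ioc.mp hc
  refine e_mul_mem_wedgeSpan (S := {M | ∃ q : Pair n, ∃ V ∈ baseSet n k, q.left = k ∧
    M = insert q V}) (T := typeA n k) ?_ le_rfl (by omega) hkn ?_
  · rintro _ ⟨q, V, hV, hq, rfl⟩ p hp1 hpk _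
    exact ⟨p, q, V, hV, hp1, hpk, hq, rfl⟩
  · refine e_mul_mem_wedgeSpan (S := baseSet n k) ?_ (by omega) h1 h2 hv
    intro V hV q hq _ _
    exact ⟨q, V, hV, hq, rfl⟩

/-- Modulo U, only the summand b = k of τ counts. -/
theorem tau_bd_e_one_mul_sub_mem (hk : 2 ≤ k) (hkn : k ≤ n) (ha : a ∈ Finset.Ioc k n)
    {v : ExtNil n} (hv : v ∈ wedgeSpan (baseSet n k)) :
    tau n k (bd n (e n 1 a * v)) + (∑ c ∈ Finset.Ioc a n, e n 1 k * (e n k c * ctr n a c v) +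
      e n 1 k * (e n k a * bd n v)) ∈ wedgeSpan (typeU n k) := by
  obtain ⟨h1, h2⟩ := Finset.mem_Ioc.mp ha
  rw [bd_e_one_mul (by omega) h2, map_sub, map_neg, map_sum]
  have h3 : ∀ c ∈ Finset.Ioc a n, tau n k (e n 1 c * ctr n a c v) -
      e n 1 k * (e n k c * ctr n a c v) ∈ wedgeSpan (typeU n k) := by
    intro c hc
    obtain ⟨h4, h5⟩ := Finset.mem_Ioc.mp hc
    exact tau_mem hk hkn (Finset.mem_Ioc.mpr ⟨by omega, h5⟩) (ctr_mem_baseSet (by omega) hv)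
  have h6 := Submodule.neg_mem _ (Submodule.sum_mem _ h3)
  have h7 := tau_mem hk hkn ha (bd_mem_wedgeSpan baseSet_closed hv)
  rw [Finset.sum_sub_distrib] at h6
  have h8 := Submodule.sub_mem _ h6 h7
  refine (congrArg (· ∈ wedgeSpan (typeU n k)) ?_).mp h8
  abel

/-- Identifies the A-part of τ∂ with the first term of the formula. Both the contraction or ∂ and
the factor `e_{kc}` pass the k - 2 column entries, so the signs cancel; brackets of `e_{ka}` with
column `k` are absent from `M`. -/
theorem col_one_mul_bd (hk : 2 ≤ k) (hkn : k ≤ n) (ha : a ∈ Finset.Ioc k n) {M : Finset (Pair n)}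
    (hM1 : M ∈ noRow n 1) (hMk : M ∈ noRow n k) (hM : ∀ p ∈ M, p.right ≠ k) :
    col n 1 k * bd n (e n k a * wedge n M) =
      -(∑ c ∈ Finset.Ioc a n, e n 1 k * (e n k c * ctr n a c (col n 2 k * wedge n M)) +
        e n 1 k * (e n k a * bd n (col n 2 k * wedge n M))) := by
  obtain ⟨h1, h2⟩ := Finset.mem_Ioc.mp ha
  have hs : (-1 : ℤ) ^ k * (-1) ^ k = 1 := by rw [← mul_pow]; simp
  have h3 : ∑ x ∈ Finset.Ico 1 k, e n x a * ctr n x k (wedge n M) = 0 := by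
    refine Finset.sum_eq_zero fun x _ => ?_
    rw [ctr_wedge_of_not_hasPair, mul_zero]
    rintro ⟨p, hp, -, hpk⟩
    exact hM p hp hpk
  have h4 : ∀ c ∈ Finset.Ioc a n, e n k c * ctr n a c (col n 2 k * wedge n M) =
      col n 2 k * (e n k c * ctr n a c (wedge n M)) := by
    intro c hc
    have := Finset.mem_Ioc.mp hc
    rw [ctr_col hk (by omega), mul_smul_comm, e_mul_col hk, smul_smul, hs, one_smul]
  rw [bd_col hk hkn (wedge_mem_wedgeSpan hM1) (wedge_mem_wedgeSpan hMk), mul_smul_comm,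
    e_mul_col hk, smul_smul, hs, one_smul, Finset.sum_congr rfl fun c hc => by rw [h4 c hc],
    bd_e_mul (by omega) h1 h2, h3, col_one hk, ← Finset.mul_sum, ← Finset.mul_sum, mul_assoc,
    add_zero, mul_sub, mul_neg, mul_sub, mul_neg]
  abel

theorem numMissing_add_card (hk : 1 ≤ k) (a : ℕ) (M : Finset (Pair n)) :
    numMissing k a M + ((M.filter fun p => p.left < k ∧ p.right = a).card : ℤ) = k - 1 := by
  have h : (M.filter fun p => p.left < k ∧ p.right = a).card =
      ((Finset.Ico 1 k).filter fun b => HasPair M b a).card := by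
    refine Finset.card_bij (fun p _ => p.left) ?_ ?_ ?_
    · intro p hp
      obtain ⟨h1, h2, h3⟩ := Finset.mem_filter.mp hp
      exact Finset.mem_filter.mpr ⟨Finset.mem_Ico.mpr ⟨p.left_pos, h2⟩, p, h1, rfl, h3⟩
    · intro p hp q hq hpq
      exact Pair.ext_iff'.mpr ⟨hpq, (Finset.mem_filter.mp hp).2.2.trans
        (Finset.mem_filter.mp hq).2.2.symm⟩
    · intro b hb
      obtain ⟨h1, p, hp, rfl, hpa⟩ := Finset.mem_filter.mp hb
      exact ⟨p, Finset.mem_filter.mpr ⟨hp, (Finset.mem_Ico.mp h1).2, hpa⟩, rfl⟩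
  have h2 := Finset.card_filter_add_card_filter_not (s := Finset.Ico 1 k)
    (fun b => HasPair M b a)
  rw [Nat.card_Ico] at h2
  rw [h, numMissing]
  omega

/-- The components in `typeB n k` of the boundary of `e_{1a}`, multiplied with a column and a
wedge of the remaining matrix units. -/
theorem sum_e_mul_e_one_mul_ctr (hk : 2 ≤ k) (ha : a ∈ Finset.Ioc k n) {M : Finset (Pair n)}
    (hM1 : M ∈ noRow n 1) :
    (k - 1 : ℤ) • (e n 1 a * (col n 2 k * wedge n M)) +
      ∑ b ∈ Finset.Ico 2 k, ∑ c ∈ Finset.Ioc k n,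
        e n b a * (e n 1 c * ctr n b c (col n 2 k * wedge n M)) =
    numMissing k a M • (e n 1 a * col n 2 k * wedge n M) +
      ∑ p ∈ setX k a M, (-1 : ℤ) ^ position p M •
        (e n 1 p.right * col n 2 k * e n p.left a * wedge n (M.erase p)) := by
  obtain ⟨hka, han⟩ := Finset.mem_Ioc.mp ha
  have hs : (-1 : ℤ) ^ k * (-1) ^ k = 1 := by rw [← mul_pow]; simp
  have hterm : ∀ b c : ℕ, c ≠ k → e n b a * (e n 1 c * ctr n b c (col n 2 k * wedge n M)) =
      -(e n 1 c * (col n 2 k * (e n b a * ctr n b c (wedge n M)))) := by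
    intro b c hc
    rw [ctr_col hk hc, mul_smul_comm, mul_smul_comm, e_mul_left_comm, e_mul_col hk,
      mul_smul_comm, smul_neg, smul_smul, hs, one_smul]
  have hterm' : ∀ p ∈ M, p.right ≠ k →
      e n p.left a * (e n 1 p.right * ctr n p.left p.right (col n 2 k * wedge n M)) =
        (-1 : ℤ) ^ position p M •
          (e n 1 p.right * col n 2 k * e n p.left a * wedge n (M.erase p)) := by
    intro p hp hpk
    rw [hterm _ _ hpk, ctr_wedge_of_mem hp, mul_smul_comm, mul_smul_comm, mul_smul_comm, pow_succ,
      mul_neg_one, neg_smul, neg_neg]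
    simp only [mul_assoc]
  have h1 : ∑ b ∈ Finset.Ico 2 k, ∑ c ∈ Finset.Ioc k n,
        e n b a * (e n 1 c * ctr n b c (col n 2 k * wedge n M)) =
      ∑ p ∈ M.filter fun p => p.left < k ∧ k < p.right, (-1 : ℤ) ^ position p M •
          (e n 1 p.right * col n 2 k * e n p.left a * wedge n (M.erase p)) := by
    rw [← Finset.sum_product']
    symm
    refine Finset.sum_of_injOn (fun p => (p.left, p.right)) ?_ ?_ ?_ ?_
    · intro p _ q _ hpq
      exact Pair.ext_iff'.mpr ⟨congrArg Prod.fst hpq, congrArg Prod.snd hpq⟩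
    · intro p hp
      obtain ⟨hp1, hp2, hp3⟩ := Finset.mem_filter.mp hp
      have h1 := hM1 p hp1
      have h2 := p.left_pos
      exact Finset.mem_coe.mpr (Finset.mem_product.mpr
        ⟨Finset.mem_Ico.mpr ⟨show 2 ≤ p.left by omega, hp2⟩, Finset.mem_Ioc.mpr ⟨hp3, p.right_le⟩⟩)
    · rintro ⟨b, c⟩ hbc hnot
      obtain ⟨hb, hc⟩ := Finset.mem_product.mp hbc
      obtain ⟨hb1, hb2⟩ := Finset.mem_Ico.mp hb
      obtain ⟨hc1, hc2⟩ := Finset.mem_Ioc.mp hc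
      rw [hterm _ _ (by simp only at hc1; omega), ctr_wedge_of_not_hasPair, mul_zero, mul_zero,
        mul_zero, neg_zero]
      rintro ⟨p, hp, rfl, rfl⟩
      exact hnot ⟨p, Finset.mem_coe.mpr (Finset.mem_filter.mpr ⟨hp, hb2, hc1⟩), rfl⟩
    · intro p hp
      obtain ⟨hp1, hp2, hp3⟩ := Finset.mem_filter.mp hp
      exact (hterm' p hp1 (by omega)).symm
  -- If (b,a) ∈ M, then `e_{ba}` kills the wedge of M∖(b,c) unless c = a. The terms with c = a
  -- reduce the coefficient k - 1 to n_M.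
  have h2 : ∑ p ∈ (M.filter fun p => p.left < k ∧ k < p.right).filter
      fun p => HasPair M p.left a, (-1 : ℤ) ^ position p M •
          (e n 1 p.right * col n 2 k * e n p.left a * wedge n (M.erase p)) =
      -(((M.filter fun p => p.left < k ∧ p.right = a).card : ℤ) •
        (e n 1 a * (col n 2 k * wedge n M))) := by
    have h3 : (M.filter fun p => p.left < k ∧ p.right = a) ⊆
        (M.filter fun p => p.left < k ∧ k < p.right).filter fun p => HasPair M p.left a := by
      intro p hp
      obtain ⟨hp1, hp2, hp3⟩ := Finset.mem_filter.mp hp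
      exact Finset.mem_filter.mpr ⟨Finset.mem_filter.mpr ⟨hp1, hp2, by omega⟩, p, hp1, rfl, hp3⟩
    rw [← Finset.sum_subset h3, Finset.sum_congr rfl (g := fun _ =>
      -(e n 1 a * (col n 2 k * wedge n M))), Finset.sum_const, smul_neg, natCast_zsmul]
    · intro p hp
      obtain ⟨hp1, hp2, rfl⟩ := Finset.mem_filter.mp hp
      rw [← hterm' p hp1 (by omega), hterm _ _ (by omega), e_mul_ctr_wedge ⟨p, hp1, rfl, rfl⟩]
    · intro p hp hp'
      obtain ⟨hp1, q, hq, hq1, hqa⟩ := Finset.mem_filter.mp hp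
      obtain ⟨hp1, hp2, hp3⟩ := Finset.mem_filter.mp hp1
      have hqp : q ≠ p := by
        rintro rfl
        exact hp' (Finset.mem_filter.mpr ⟨hp1, hp2, hqa⟩)
      rw [mul_assoc, e_mul_wedge_of_hasPair ⟨q, Finset.mem_erase.mpr ⟨hqp, hq⟩, hq1, hqa⟩,
        mul_zero, smul_zero]
  have h4 : (M.filter fun p => p.left < k ∧ k < p.right).filter (fun p => ¬HasPair M p.left a) =
      setX k a M := by
    ext p
    simp only [setX, Finset.mem_filter, and_assoc]
  rw [h1, ← Finset.sum_filter_add_sum_filter_not _ (fun p => HasPair M p.left a), h2, h4,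
    ← numMissing_add_card (by omega) a M, add_smul, mul_assoc]
  abel

theorem exists_sign_of_eq_or {x y : ExtNil n} (h : x = y ∨ x = -y) :
    ∃ ε : ℤ, ε * ε = 1 ∧ x = ε • y := by
  rcases h with h | h
  · exact ⟨1, by norm_num, by rw [h, one_smul]⟩
  · exact ⟨-1, by norm_num, by rw [h, neg_one_smul]⟩

variable {w : ℕ → ℤ} {M : Finset (Pair n)}

/-- The single entries (1,k) and (k,a) of rows 1 and `k`, and all of column `k`, are used up by
`pairsA`, which is disjoint from `M`. -/
theorem IsTypeA.not_mem (hk : 2 ≤ k) (hkn : k ≤ n) (hw1 : w 1 = 2) (hwk : w k = 2)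
    (h : IsTypeA n w k a M) : M ∈ noRow n 1 ∧ M ∈ noRow n k ∧ ∀ p ∈ M, p.right ≠ k := by
  obtain ⟨hka, han, hdisj, hN⟩ := h
  have hA : pairsA n k a ∪ M ∈ typeA n k :=
    ((setA_eq hk hkn hw1 hwk).subset ⟨a, M, ⟨hka, han, hdisj, hN⟩, rfl⟩).1
  have h1 : ∀ p ∈ M, p.right ≠ k := fun p hp hpk =>
    Finset.disjoint_right.mp hdisj hp (Finset.mem_filter.mpr ⟨Finset.mem_univ _, Or.inl hpk⟩)
  refine ⟨fun p hp hp1 => h1 p hp (typeA_one hk hA (Finset.mem_union_right _ hp) hp1), ?_, h1⟩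
  intro p hp hpk
  obtain ⟨q, hq1, hqa⟩ := Pair.exists_mk (n := n) (a := k) (b := a) (by omega) hka han
  have hq : q ∈ pairsA n k a :=
    Finset.mem_filter.mpr ⟨Finset.mem_univ _, Or.inr ⟨hq1, hqa⟩⟩
  obtain ⟨r, s, V, hV, hr1, -, hsk, hNV⟩ := hA
  have hrow : ∀ x ∈ pairsA n k a ∪ M, x.left = k → x = s := by
    intro x hx hxk
    rw [hNV] at hx
    rcases Finset.mem_insert.mp hx with rfl | hx
    · omega
    rcases Finset.mem_insert.mp hx with rfl | hx
    · rfl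
    · exact absurd hxk (hV.1 x hx).2
  have hpq : p = q := (hrow p (Finset.mem_union_right _ hp) hpk).trans
    (hrow q (Finset.mem_union_left _ hq) hq1).symm
  exact Finset.disjoint_right.mp hdisj hp (hpq ▸ hq)

theorem IsTypeA.col_mul_eq (hk : 2 ≤ k) (hkn : k ≤ n) (hw1 : w 1 = 2) (hwk : w k = 2)
    (h : IsTypeA n w k a M) : ∃ ε : ℤ, ε * ε = 1 ∧
      col n 1 k * (e n k a * wedge n M) = ε • wedge n (pairsA n k a ∪ M) := by
  obtain ⟨-, hMk, hM⟩ := h.not_mem hk hkn hw1 hwk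
  obtain ⟨hka, han, hdisj, hN⟩ := h
  obtain ⟨q, rfl, rfl⟩ := Pair.exists_mk (n := n) (by omega) hka han
  have hqM : ∀ p ∈ insert q M, p.right ≠ q.left := by
    intro p hp
    rcases Finset.mem_insert.mp hp with rfl | hp
    · omega
    · exact hM p hp
  obtain ⟨ε, hε, h1⟩ := exists_sign_of_eq_or (e_mul_wedge_of_notMem fun hq => hMk q hq rfl)
  obtain ⟨δ, hδ, h2⟩ := exists_sign_of_eq_or
    (col_mul_wedge (s := 1) le_rfl (by omega) hkn hqM)
  refine ⟨ε * δ, by rw [mul_mul_mul_comm, hε, hδ, one_mul], ?_⟩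
  rw [h1, mul_smul_comm, h2, smul_smul]
  congr 2
  ext p
  have := p.left_pos
  simp only [pairsA, Finset.mem_filter, Finset.mem_univ, true_and, Finset.mem_insert,
    Finset.mem_union, Pair.ext_iff']
  tauto

/-- Merging (1,k) and (k,a) in the A-generator gives, up to sign, the second product; so it lies in
⟦w⟧, one degree lower. -/
theorem IsTypeA.col_two_mul_wedge (hk : 2 ≤ k) (hkn : k ≤ n) (hw1 : w 1 = 2) (hwk : w k = 2)
    (h : IsTypeA n w k a M) : col n 2 k * wedge n M ∈ wedgeSpan (baseSet n k) ∧
      e n 1 a * (col n 2 k * wedge n M) ∈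
        spanDeg (gens n w) ((pairsA n k a ∪ M).card - 1) := by
  obtain ⟨hM1, hMk, hM⟩ := h.not_mem hk hkn hw1 hwk
  obtain ⟨hka, han, hdisj, hN⟩ := h
  classical
  set V := Finset.univ.filter fun p : Pair n => p ∈ M ∨ (p.right = k ∧ 2 ≤ p.left) with hVdef
  have hVmem : ∀ p, p ∈ V ↔ p ∈ M ∨ (p.right = k ∧ 2 ≤ p.left) := fun p => by simp [V]
  obtain ⟨ε, -, h1⟩ := exists_sign_of_eq_or (col_mul_wedge (s := 2) (by omega) hk hkn hM)
  have hV : V ∈ baseSet n k := by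
    constructor
    · intro p hp
      rcases (hVmem p).mp hp with h | ⟨h, h'⟩
      · exact ⟨hM1 p h, hMk p h⟩
      · have := p.left_lt_right
        omega
    · intro b hb
      obtain ⟨hb1, hb2⟩ := Finset.mem_Ico.mp hb
      obtain ⟨p, rfl, hp⟩ := Pair.exists_mk (n := n) (by omega) hb2 hkn
      exact ⟨p, (hVmem p).mpr (Or.inr ⟨hp, hb1⟩), rfl, hp⟩
  obtain ⟨p, hp1, hpk⟩ := Pair.exists_mk (n := n) (a := 1) (b := k) le_rfl (by omega) hkn
  obtain ⟨q, hq1, hqa⟩ := Pair.exists_mk (n := n) (a := k) (b := a) (by omega) hka han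
  have hpq : p.right = q.left := hpk.trans hq1.symm
  have hr1 : (p.comp q hpq).left = 1 := hp1
  have hra : (p.comp q hpq).right = a := hqa
  have hqp : q ≠ p := by
    rintro rfl
    omega
  have hp : p ∈ pairsA n k a ∪ M :=
    Finset.mem_union_left _ (Finset.mem_filter.mpr ⟨Finset.mem_univ _, Or.inl hpk⟩)
  have hq : q ∈ (pairsA n k a ∪ M).erase p := Finset.mem_erase.mpr ⟨hqp,
    Finset.mem_union_left _ (Finset.mem_filter.mpr ⟨Finset.mem_univ _, Or.inr ⟨hq1, hqa⟩⟩)⟩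
  have hVN : ((pairsA n k a ∪ M).erase p).erase q = V := by
    ext r
    have h2 := r.left_pos
    have h3 := r.left_lt_right
    simp only [hVmem, Finset.mem_erase, Finset.mem_union, pairsA, Finset.mem_filter,
      Finset.mem_univ, true_and, ne_eq, Pair.ext_iff', hp1, hpk, hq1, hqa]
    constructor
    · rintro ⟨h4, h5, (h6 | h6) | h6⟩
      · exact Or.inr ⟨h6, by omega⟩
      · exact absurd h6 h4
      · exact Or.inl h6
    · rintro (h4 | ⟨h4, h5⟩)
      · have h5 := hM1 r h4
        have h6 := hMk r h4
        exact ⟨fun h => h6 h.1, fun h => h5 h.1, Or.inr h4⟩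
      · exact ⟨by omega, by omega, Or.inl (Or.inl h4)⟩
  have hrV : p.comp q hpq ∉ V := fun hr => (hV.1 _ hr).1 hr1
  have hgens : insert (p.comp q hpq) V ∈ gens n w := by
    have h2 := gens_closed n w _ hN p q hpq hp (Finset.mem_of_mem_erase hq)
      (by rw [hVN]; exact hrV)
    rwa [hVN] at h2
  have hcard : (insert (p.comp q hpq) V).card + 1 = (pairsA n k a ∪ M).card := by
    rw [Finset.card_insert_of_notMem hrV, ← hVN, Finset.card_erase_add_one hq,
      Finset.card_erase_add_one hp]
  have hy : e n 1 a * wedge n V = wedge n (insert (p.comp q hpq) V) := by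
    rw [wedge_insert_one hr1 (baseSet_subset_noRow_one hV), hra]
  rw [h1]
  refine ⟨Submodule.smul_mem _ _ (wedge_mem_wedgeSpan hV), ?_⟩
  rw [mul_smul_comm, hy]
  refine Submodule.smul_mem _ _ (wedge_mem_wedgeSpan ⟨hgens, ?_⟩)
  rw [← hcard]
  push_cast
  ring

theorem exists_incl_morseBoundary_of_typeA (hk : 2 ≤ k) (hkn : k ≤ n) (hw1 : w 1 = 2)
    (hwk : w k = 2) (h : IsTypeA n w k a M) :
    ∃ x : critical (matching n w k) →₀ ℤ,
      incl (critical (matching n w k)) x = col n 1 k * e n k a * wedge n M ∧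
      incl (critical (matching n w k))
        (morseBoundary (degree n w) (digraph n w) (matching n w k) x) =
          (-1 : ℤ) ^ (k + 1) •
            (col n 1 k * bd n (e n k a * wedge n M) +
              numMissing k a M • (e n 1 a * col n 2 k * wedge n M) +
              ∑ p ∈ setX k a M, (-1 : ℤ) ^ position p M •
                (e n 1 p.right * col n 2 k * e n p.left a * wedge n (M.erase p))) := by
  obtain ⟨hM1, hMk, hM⟩ := h.not_mem hk hkn hw1 hwk
  obtain ⟨ε, hε, hcol⟩ := h.col_mul_eq hk hkn hw1 hwk
  obtain ⟨hv, hy⟩ := h.col_two_mul_wedge hk hkn hw1 hwk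
  have ha : a ∈ Finset.Ioc k n := Finset.mem_Ioc.mpr ⟨h.1, h.2.1⟩
  have hs : (-1 : ℤ) ^ k * (-1) ^ k = 1 := by rw [← mul_pow]; simp
  have hN : pairsA n k a ∪ M ∈ typeA n k ∩ gens n w :=
    (setA_eq hk hkn hw1 hwk).subset ⟨a, M, h, rfl⟩
  set v := col n 2 k * wedge n M with hvdef
  have hyB := e_one_mul_mem_typeB hk ha hv
  have h1 := tau_bd_e_one_mul_sub_mem hk hkn ha hv
  have h2 := col_one_mul_bd hk hkn ha hM1 hMk hM
  have h3 := bd_tau_add_tau_bd hk (wedgeSpan_mono baseSet_subset_noRow_one hv)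
    (wedgeSpan_mono baseSet_subset_noRow hv) ha
  have h4 := sum_e_mul_e_one_mul_ctr hk ha hM1
  have h5 := tau_mem hk hkn ha hv
  -- The sign (-1)^k comes from moving `e_{ka}` past k - 2 column entries.
  have h6 : e n 1 k * (e n k a * v) = (-1 : ℤ) ^ k • ε • wedge n (pairsA n k a ∪ M) := by
    rw [hvdef, e_mul_col hk, mul_smul_comm, ← mul_assoc, ← col_one hk, hcol]
  rw [← hvdef] at h2 h4
  rw [add_assoc, ← h4]
  set y := e n 1 a * v with hydef
  set b := col n 1 k * bd n (e n k a * wedge n M)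
  have hb : b ∈ wedgeSpan (typeA n k) := by
    rw [h2]
    exact Submodule.neg_mem _ (Submodule.add_mem _ (Submodule.sum_mem _ fun c hc =>
      e_one_mul_e_mul_mem_typeA hk hkn
        (Finset.mem_Ioc.mpr ⟨h.1.trans (Finset.mem_Ioc.mp hc).1, (Finset.mem_Ioc.mp hc).2⟩)
        (ctr_mem_baseSet (by have := (Finset.mem_Ioc.mp hc).1; have := h.1; omega) hv))
      (e_one_mul_e_mul_mem_typeA hk hkn ha (bd_mem_wedgeSpan baseSet_closed hv)))
  rw [neg_sub_left, eq_neg_iff_add_eq_zero, add_comm (∑ b ∈ _, _), ← eq_neg_iff_add_eq_zero] at h3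
  have hφB := bd_tau_add_tau_bd_mem hk hyB
  set z := (k - 1 : ℤ) • y + ∑ b ∈ Finset.Ico 2 k, ∑ c ∈ Finset.Ioc k n,
        e n b a * (e n 1 c * ctr n b c v) with hz
  rw [h3] at hφB
  let N : critical (matching n w k) := ⟨⟨pairsA n k a ∪ M, hN.2⟩,
    (mem_critical_matching hk hkn hw1 hwk _).mpr (Or.inl hN.1)⟩
  refine ⟨Finsupp.single N ε, ?_, ?_⟩
  · rw [incl, Finsupp.linearCombination_single, mul_assoc, hcol]
  -- The signs make the A-part of `u` equal to the generator `e_N`; by `h5` and `h6`, the rest of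
  -- `u` has type U.
  · have hmain := incl_morseBoundary hk hkn hw1 hwk N (u := ε • (-1 : ℤ) ^ k • tau n k y)
      (t := ε • (-1 : ℤ) ^ (k + 1) • (b + z)) ?_ ?_ ?_ ?_
    · rw [← mul_one ε, ← smul_eq_mul, ← Finsupp.smul_single, map_smul, map_smul, hmain, smul_smul,
        hε, one_smul]
    · have h7 := tau_mem_spanDeg (k := k) hy
      rw [sub_add_cancel] at h7
      exact Submodule.smul_mem _ _ (Submodule.smul_mem _ _ h7)
    · have h7 := Submodule.smul_mem _ ε (Submodule.smul_mem _ ((-1 : ℤ) ^ k) h5)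
      rw [h6, smul_sub, smul_sub, smul_smul ((-1 : ℤ) ^ k), hs, one_smul, smul_smul ε ε, hε,
        one_smul] at h7
      exact h7
    · rw [← wedgeSpan_sup]
      exact Submodule.smul_mem _ _ (Submodule.smul_mem _ _ (Submodule.add_mem _
        (Submodule.mem_sup_left hb) (Submodule.mem_sup_right (neg_neg z ▸
          Submodule.neg_mem _ hφB))))
    · rw [map_smul, map_smul, ← smul_sub, pow_succ, mul_neg_one, neg_smul, sub_neg_eq_add,
        ← smul_add]
      refine Submodule.smul_mem _ _ (Submodule.smul_mem _ _ ?_)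
      -- By ∂τy = φy - τ∂y with φy = -z, and since τ∂y agrees with `b` modulo U, the critical part
      -- of ∂τy is -(b + z). This accounts for the sign (-1)^(k+1).
      have h7 : bd n (tau n k y) + (b + z) = -(tau n k (bd n y) + -b) := by
        rw [eq_sub_of_add_eq h3]
        abel
      rw [h7, h2, neg_neg]
      exact Submodule.neg_mem _ h1

end TypeA

end NilTorsion

theorem lemma3p5 (n k : ℕ) (w : ℕ → ℤ) (hk : 2 ≤ k) (hkn : k ≤ n) (hw1 : w 1 = 2)
    (hwk : w k = 2) :
    -- the Morse matching, its critical generators and its boundary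
    (∃ 𝓜 : Set (gens n w × gens n w),
      IsMorseMatching (degree n w) (digraph n w) 𝓜 ∧
      (Subtype.val '' critical 𝓜 : Set (Finset (Pair n))) = setA n w k ∪ setB n w k ∧
      (∀ N : critical 𝓜, N.1.1 ∈ setB n w k →
        incl (critical 𝓜) (morseBoundary (degree n w) (digraph n w) 𝓜 (Finsupp.single N 1)) =
          bd n (wedge n N.1.1)) ∧
      (∀ (a : ℕ) (M : Finset (Pair n)), IsTypeA n w k a M →
        ∃ x : critical 𝓜 →₀ ℤ,
          incl (critical 𝓜) x = col n 1 k * e n k a * wedge n M ∧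
          incl (critical 𝓜) (morseBoundary (degree n w) (digraph n w) 𝓜 x) =
            (-1 : ℤ) ^ (k + 1) •
              (col n 1 k * bd n (e n k a * wedge n M) +
                numMissing k a M • (e n 1 a * col n 2 k * wedge n M) +
                ∑ p ∈ setX k a M, (-1 : ℤ) ^ position p M •
                  (e n 1 p.right * col n 2 k * e n p.left a * wedge n (M.erase p))))) ∧
    -- the homology of `⟦w⟧` is the homology of a cone
    (∃ φ : filtration n w (k + 1) ⟶ filtration n w (k + 1),
      ∀ j : ℤ, Nonempty ((bracket n w).homology j ≅
        (HomologicalComplex.homotopyCofiber φ).homology j)) ∧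
    -- the case where `2` is in the last but one position
    (k + 1 = n → ∀ j : ℤ, Nonempty ((bracket n w).homology j ≅
      (HomologicalComplex.homotopyCofiber
        ((w n - 1) • CategoryTheory.CategoryStruct.id
          (shift (bracket (n - 1) (reducedSeq n w)) 1))).homology j)) := by
  refine ⟨⟨matching n w k, isMorseMatching hk hkn hw1 hwk,
    image_critical_matching hk hkn hw1 hwk, fun N hN => ?_, fun a M h =>
      exists_incl_morseBoundary_of_typeA hk hkn hw1 hwk h⟩, exists_cone hk hkn hw1 hwk, ?_⟩
  · exact incl_morseBoundary_of_typeB hk hkn hw1 hwk N ((setB_eq hk hkn hw1 hwk).subset hN).1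
  · rintro rfl j
    exact nonempty_homology_iso_cone_last hk hw1 hwk j
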